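/- **Setting.** There are $m\ge1$ arms, $d\ge1$ components and $T\ge1$ rounds. Arm $i$ has an unknown distribution $D_i$ on $[0,1]^d$ with mean $V_i$; let $V\in[0,1]^{d\times m}$ be the matrix with columns $V_i$, and $\Delta_m$ the simplex of distributions on the arms. In round $t$ a learner chooses $p_t\in\Delta_m$ from the history (and possibly internal randomness), an arm $i_t$ is drawn from $p_t$, and a vector $v_t$ is drawn from $D_{i_t}$ and observed. Let $S\subseteq\mathbb R^d$ be closed and convex, such that $Vp\in S$ for some $p\in\Delta_m$. Let $f:[0,1]^d\to[0,1]$ be concave and $L$-Lipschitz with respect to an $L_q$ norm $\|\cdot\|_f$; let $d(\cdot,S)$ be the distance to $S$ in an $L_q$ norm $\|\cdot\|_S$ (both with $q\in[1,\infty]$, possibly different). Let $\mathbf 1_d$ be the all-ones vector, and let $*$ denote dual norms. $\mathrm{OPT}_f$ is the supremum of $\mathbb E[f(\frac1T\sum_t v_t)]$ over all dynamic (non-anticipating) policies with $\frac1T\sum_t v_t\in S$ almost surely. The regrets are $$\mathrm{areg}_1(T)=\mathrm{OPT}_f-f\Big(\frac1T\sum_{t=1}^T v_t\Big),\qquad \mathrm{areg}_2(T)=d\Big(\frac1T\sum_{t=1}^T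 v_t,\,S\Big).$$ Let $h_S(\varphi)=\sup_{s\in S}\varphi\cdot s\in(-\infty,\infty]$ and $f^*(\theta)=\max_{y\in[0,1]^d}\{y\cdot\theta+f(y)\}$. **Algorithm.** For a parameter $\gamma$, let $k_{t,i}$ be the number of plays of arm $i$ before round $t$, $\hat V_{t,ji}=\frac{1}{k_{t,i}+1}\sum_{s<t,\,i_s=i}v_{s,j}$, $\mathrm{rad}(\nu,N)=\sqrt{\gamma\nu/N}+\gamma/N$, and $$U_{t,ji}=\min\{1,\hat V_{t,ji}+2\,\mathrm{rad}(\hat V_{t,ji},k_{t,i}+1)\},\qquad L_{t,ji}=\max\{0,\hat V_{t,ji}-2\,\mathrm{rad}(\hat V_{t,ji},k_{t,i}+1)\}.$$ Let $Z_t(\theta)\in[0,1]^{d\times m}$ have the entries $U_{t,ji}$ if $\theta_j\le0$ and $L_{t,ji}$ if $\theta_j>0$. Given $\theta_t,\varphi_t\in\mathbb R^d$ computed from the history, the algorithm chooses $$p_t\in\arg\min\{\theta_t\cdot Z_t(\theta_t)p \;:\; p\in\Delta_m,\ \varphi_t\cdot Z_t(\varphi_t)p\le h_S(\varphi_t)\},$$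 and $p_t\in\Delta_m$ arbitrarily if there is no feasible $p$. Put $x_t=Z_t(\theta_t)p_t$, $z_t=Z_t(\varphi_t)p_t$, $\bar x_t=\frac1t\sum_{s\le t}x_s$, $\bar z_t=\frac1t\sum_{s\le t}z_s$, and $\mu=\sqrt{\frac dT\log_2(2T)}$. The sequence $\theta_t$ is updated in one of the following ways. * *Dual:* $\theta_t$ are the points with $\|\theta_t\|_{f,*}\le L$ played by any online convex optimization (OCO) algorithm on the losses $g_t(\theta)=f^*(\theta)-\theta\cdot x_t$; its regret is $R_1=\sum_{t\le T} g_t(\theta_t)-\min_{\|\theta\|_{f,*}\le L}\sum_{t\le T} g_t(\theta)$. * *Primal* ($f$ differentiable and $C$-smooth, that is, $f(z+\alpha(y-z))\ge f(z)+\alpha\nabla f(z)\cdot(y-z)-\frac C2\alpha^2$ for all $y,z\in[0,1]^d$, $\alpha\in[0,1]$): $\theta_1$ is arbitrary and $\theta_{t+1}=-\nabla f(\bar x_t)$. * *Primal with smooth approximation* ($\|\cdot\|_f$ Euclidean): $\theta_1$ is arbitrary and $\theta_{t+1}=-\nabla\hat f_\mu(\bar x_t)$, where $\hat f_\mu(z)=\min_{\|\theta\|_2\le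 L}\{f^*(\theta)+\frac{\mu}{2L}\theta\cdot\theta-\theta\cdot z\}$. Independently, $\varphi_t$ is updated in one of the following ways. * *Dual:* $\varphi_t$ are the points with $\|\varphi_t\|_{S,*}\le1$ played by any OCO algorithm on the losses $g_t(\varphi)=h_S(\varphi)-\varphi\cdot z_t$; its regret is $R_2=\sum_{t\le T} g_t(\varphi_t)-\min_{\|\varphi\|_{S,*}\le1}\sum_{t\le T} g_t(\varphi)$. * *Primal (with smooth approximation;* $\|\cdot\|_S$ *Euclidean):* $\varphi_1$ is arbitrary and $\varphi_{t+1}=\nabla\hat d_\mu(\bar z_t)$, where $\hat d_\mu(z)=\max_{\|\varphi\|_2\le1}\{\varphi\cdot z-h_S(\varphi)-\frac\mu2\varphi\cdot\varphi\}$. **Theorem.** There are absolute constants $c_0,K>0$ such that the following holds for all $\delta\in(0,1)$ with $2\delta\le mTd$ (automatic unless $m=T=d=1$) and all $\gamma\ge c_0\log(mTd/\delta)$. With probability at least $1-\delta$, all of the following bounds hold simultaneously. For the objective, according to how $\theta_t$ is updated (and however $\varphi_t$ is updated): * dual: $\mathrm{areg}_1(T)\le K L\|\mathbf 1_d\|_f\sqrt{\frac{\gamma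 m}{T}}+\frac{R_1}{T}$; * primal: $\mathrm{areg}_1(T)\le K\Big(L\|\mathbf 1_d\|_f\sqrt{\frac{\gamma m}{T}}+\frac{C\log T}{T}\Big)$; * primal with smooth approximation: $\mathrm{areg}_1(T)\le K\Big(L\|\mathbf 1_d\|_f\sqrt{\frac{\gamma m}{T}}+L\sqrt{\frac{d\log T}{T}}\Big)$. For the constraint, according to how $\varphi_t$ is updated (and however $\theta_t$ is updated): * dual: $\mathrm{areg}_2(T)\le K\|\mathbf 1_d\|_S\sqrt{\frac{\gamma m}{T}}+\frac{R_2}{T}$; * primal: $\mathrm{areg}_2(T)\le K\Big(\|\mathbf 1_d\|_S\sqrt{\frac{\gamma m}{T}}+\sqrt{\frac{d\log T}{T}}\Big)$. The bounds on $\mathrm{areg}_1(T)$ also hold when $\mathrm{OPT}_f$ is replaced by $f(Vp)$ for any $p\in\Delta_m$ with $Vp\in S$. -/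

import Mathlib

open MeasureTheory Matrix
open scoped BigOperators ENNReal

noncomputable section

/-- The cube `[0,1]^d`. -/
def unitCube (d : ℕ) : Set (Fin d → ℝ) := Set.Icc 0 1

/-- The `L_q` norm on `ℝ^d`. -/
def lqNorm {d : ℕ} (q : ℝ≥0∞) (x : Fin d → ℝ) : ℝ := ‖WithLp.toLp q x‖

/-- The distance from `x` to `S` in the `L_q` norm. -/
def lqDist {d : ℕ} (q : ℝ≥0∞) (x : Fin d → ℝ) (S : Set (Fin d → ℝ)) : ℝ :=
  sInf ((fun s => lqNorm q (x - s)) '' S)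

/-- The vectors whose dual norm (dual to the `L_q` norm) is at most `L`. -/
def dualBall {d : ℕ} (q : ℝ≥0∞) (L : ℝ) : Set (Fin d → ℝ) :=
  {θ | ∀ y : Fin d → ℝ, θ ⬝ᵥ y ≤ L * lqNorm q y}

/-- The support function `h_S(φ) = sup_{s ∈ S} φ · s`; it is `+∞` where the supremum is infinite. -/
def supportFn {d : ℕ} (S : Set (Fin d → ℝ)) (φ : Fin d → ℝ) : EReal :=
  ⨆ s ∈ S, ((φ ⬝ᵥ s : ℝ) : EReal)

/-- The Fenchel conjugate `f^*(θ) = max_{y ∈ [0,1]^d} (y · θ + f y)`. -/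
def fenchelConj {d : ℕ} (f : (Fin d → ℝ) → ℝ) (θ : Fin d → ℝ) : ℝ :=
  sSup ((fun y => y ⬝ᵥ θ + f y) '' unitCube d)

/-- The gradient at `z` of a function on the cube, as the vector of the components of its
derivative within the cube (which is unique, on the boundary as well, when `d ≥ 1`). -/
def cubeGradient {d : ℕ} (F : (Fin d → ℝ) → ℝ) (z : Fin d → ℝ) : Fin d → ℝ :=
  fun j => fderivWithin ℝ F (unitCube d) z (Pi.single j 1)

/-- `C`-smoothness of a (concave) function on the cube. -/
def IsCubeSmooth {d : ℕ} (C : ℝ) (f : (Fin d → ℝ) → ℝ) : Prop :=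
  DifferentiableOn ℝ f (unitCube d) ∧
    ∀ y ∈ unitCube d, ∀ z ∈ unitCube d, ∀ α ∈ Set.Icc (0 : ℝ) 1,
      f z + α * (cubeGradient f z ⬝ᵥ (y - z)) - C / 2 * α ^ 2 ≤ f (z + α • (y - z))

/-- The smooth approximation
`min_{‖θ‖₂ ≤ L} (f^*(θ) + (μ / 2L) θ · θ - θ · z)` of a concave `L`-Lipschitz function `f`. -/
def smoothApprox {d : ℕ} (L μ : ℝ) (f : (Fin d → ℝ) → ℝ) (z : Fin d → ℝ) : ℝ :=
  sInf ((fun θ => fenchelConj f θ + μ / (2 * L) * (θ ⬝ᵥ θ) - θ ⬝ᵥ z) ''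
    {θ : Fin d → ℝ | lqNorm 2 θ ≤ L})

/-- The smooth approximation
`max_{‖φ‖₂ ≤ 1} (φ · z - h_S(φ) - (μ / 2) φ · φ)` of the Euclidean distance to `S`.
The maximum is finite when `S` is nonempty. -/
def smoothDist {d : ℕ} (μ : ℝ) (S : Set (Fin d → ℝ)) (z : Fin d → ℝ) : ℝ :=
  (⨆ φ ∈ {φ : Fin d → ℝ | lqNorm 2 φ ≤ 1},
    ((φ ⬝ᵥ z - μ / 2 * (φ ⬝ᵥ φ) : ℝ) : EReal) - supportFn S φ).toReal

/-- The regret `∑_{t<T} g_t(θ_t) - min_{θ ∈ B} ∑_{t<T} g_t(θ)` of the points `θ_t` in online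
convex optimization with domain `B` and losses `g_t`. -/
def ocoRegret {d : ℕ} (T : ℕ) (B : Set (Fin d → ℝ)) (g : ℕ → (Fin d → ℝ) → EReal)
    (θ : ℕ → Fin d → ℝ) : EReal :=
  ∑ t ∈ Finset.range T, g t (θ t) - ⨅ θ' ∈ B, ∑ t ∈ Finset.range T, g t θ'

/-- The `d × m` matrix of the means of the distributions of the `m` arms. -/
def meanMatrix {m d : ℕ} (D : Fin m → Measure (Fin d → ℝ)) : Matrix (Fin d) (Fin m) ℝ :=
  fun j i => ∫ x, x j ∂(D i)

/-- `T` rounds of interaction of a non-anticipating, possibly randomized learner with an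
`m`-armed bandit whose arm `i` yields observations with distribution `D i`.
Rounds are numbered `0, …, T - 1`, and `hist t` is the information available just before
round `t`. -/
structure BanditRun {m d : ℕ} (T : ℕ) (D : Fin m → Measure (Fin d → ℝ))
    {Ω : Type*} [mΩ : MeasurableSpace Ω] (P : Measure Ω) where
  hist : Filtration ℕ mΩ
  /-- the distribution from which the arm is drawn -/
  p : ℕ → Ω → Fin m → ℝ
  /-- the arm that is played -/
  arm : ℕ → Ω → Fin m
  /-- the vector that is observed -/
  obs : ℕ → Ω → Fin d → ℝ
  p_mem : ∀ t < T, ∀ ω, p t ω ∈ stdSimplex ℝ (Fin m)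
  p_measurable : ∀ t < T, Measurable[hist t] (p t)
  arm_measurable : ∀ t < T, Measurable[hist (t + 1)] (arm t)
  obs_measurable : ∀ t < T, Measurable[hist (t + 1)] (obs t)
  /-- Given the history, arm `i` is played with probability `p t i`, and given the history and
  that arm `i` is played, the observation has distribution `D i`. -/
  law : ∀ t < T, ∀ A : Set Ω, MeasurableSet[hist t] A → ∀ i : Fin m,
    ∀ B : Set (Fin d → ℝ), MeasurableSet B →
      P (A ∩ (arm t ⁻¹' {i} ∩ obs t ⁻¹' B)) =
        (∫⁻ ω in A, ENNReal.ofReal (p t ω i) ∂P) * D i B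

namespace BanditRun

variable {m d T : ℕ} {D : Fin m → Measure (Fin d → ℝ)} {Ω : Type*} [mΩ : MeasurableSpace Ω]
  {P : Measure Ω}

/-- The average `(1/T) ∑_t v_t` of the observed vectors. -/
def obsAvg (run : BanditRun T D P) (ω : Ω) : Fin d → ℝ :=
  (T : ℝ)⁻¹ • ∑ t ∈ Finset.range T, run.obs t ω

/-- The number of plays of arm `i` before round `t`. -/
def plays (run : BanditRun T D P) (t : ℕ) (ω : Ω) (i : Fin m) : ℕ :=
  ((Finset.range t).filter (fun s => run.arm s ω = i)).card

/-- The empirical average of component `j` for arm `i` before round `t`. -/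
def empMean (run : BanditRun T D P) (t : ℕ) (ω : Ω) (j : Fin d) (i : Fin m) : ℝ :=
  (∑ s ∈ (Finset.range t).filter (fun s => run.arm s ω = i), run.obs s ω j) /
    (run.plays t ω i + 1)

/-- `rad(empirical mean, number of plays + 1)`, where `rad(ν, N) = √(γ ν / N) + γ / N`. -/
def rad (γ : ℝ) (run : BanditRun T D P) (t : ℕ) (ω : Ω) (j : Fin d) (i : Fin m) : ℝ :=
  Real.sqrt (γ * run.empMean t ω j i / (run.plays t ω i + 1)) + γ / (run.plays t ω i + 1)

/-- Upper confidence bound. -/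
def ucb (γ : ℝ) (run : BanditRun T D P) (t : ℕ) (ω : Ω) (j : Fin d) (i : Fin m) : ℝ :=
  min 1 (run.empMean t ω j i + 2 * rad γ run t ω j i)

/-- Lower confidence bound. -/
def lcb (γ : ℝ) (run : BanditRun T D P) (t : ℕ) (ω : Ω) (j : Fin d) (i : Fin m) : ℝ :=
  max 0 (run.empMean t ω j i - 2 * rad γ run t ω j i)

/-- The vertex `Z_t(θ)` of the confidence box: row `j` consists of the upper confidence bounds
if `θ_j ≤ 0`, and of the lower confidence bounds if `θ_j > 0`. -/
def vertex (γ : ℝ) (run : BanditRun T D P) (t : ℕ) (ω : Ω) (θ : Fin d → ℝ) :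
    Matrix (Fin d) (Fin m) ℝ :=
  fun j i => if θ j ≤ 0 then ucb γ run t ω j i else lcb γ run t ω j i

/-- The estimated point `Z_t(θ_t) p_t`. -/
def estPoint (γ : ℝ) (run : BanditRun T D P) (θ : ℕ → Ω → Fin d → ℝ) (t : ℕ) (ω : Ω) :
    Fin d → ℝ :=
  vertex γ run t ω (θ t ω) *ᵥ run.p t ω

/-- The average of the first `n` estimated points. -/
def estAvg (γ : ℝ) (run : BanditRun T D P) (θ : ℕ → Ω → Fin d → ℝ) (n : ℕ) (ω : Ω) :
    Fin d → ℝ :=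
  (n : ℝ)⁻¹ • ∑ t ∈ Finset.range n, estPoint γ run θ t ω

/-- The linearized constraint `(φ · Z_t(φ)) p ≤ h_S(φ)`. -/
def Feasible (γ : ℝ) (run : BanditRun T D P) (S : Set (Fin d → ℝ)) (t : ℕ) (ω : Ω)
    (φ : Fin d → ℝ) (p : Fin m → ℝ) : Prop :=
  ((φ ⬝ᵥ (vertex γ run t ω φ *ᵥ p) : ℝ) : EReal) ≤ supportFn S φ

/-- The run is one of the efficient algorithm with parameters `θ_t`, `φ_t`: these are computed
from the history, and `p_t` minimizes `(θ_t · Z_t(θ_t)) p` over the `p` in the simplex with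
`(φ_t · Z_t(φ_t)) p ≤ h_S(φ_t)`; if there is no such `p`, then `p_t` is arbitrary. -/
structure IsEfficient (γ : ℝ) (S : Set (Fin d → ℝ)) (run : BanditRun T D P)
    (θ φ : ℕ → Ω → Fin d → ℝ) : Prop where
  theta_measurable : ∀ t < T, Measurable[run.hist t] (θ t)
  phi_measurable : ∀ t < T, Measurable[run.hist t] (φ t)
  choice : ∀ t < T, ∀ ω, ∀ p' ∈ stdSimplex ℝ (Fin m), Feasible γ run S t ω (φ t ω) p' →
    Feasible γ run S t ω (φ t ω) (run.p t ω) ∧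
      θ t ω ⬝ᵥ (vertex γ run t ω (θ t ω) *ᵥ run.p t ω) ≤
        θ t ω ⬝ᵥ (vertex γ run t ω (θ t ω) *ᵥ p')

/-- The dual way of updating: the parameters are the points played by some algorithm for online
convex optimization on the dual ball of radius `L`. Any such algorithm is allowed; its losses
enter through its regret. -/
def DualUpdate (T : ℕ) (q : ℝ≥0∞) (L : ℝ) (θ : ℕ → Ω → Fin d → ℝ) : Prop :=
  ∀ t < T, ∀ ω, θ t ω ∈ dualBall q L

/-- The primal way of updating for the concave function `F`: each parameter after the first
(which is arbitrary) is `-∇F` at the average of the previous estimated points. -/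
def PrimalUpdate (γ : ℝ) (run : BanditRun T D P) (F : (Fin d → ℝ) → ℝ)
    (θ : ℕ → Ω → Fin d → ℝ) : Prop :=
  ∀ t, t + 1 < T → ∀ ω, θ (t + 1) ω = -cubeGradient F (estAvg γ run θ (t + 1) ω)

/-- The regret in the dual update for the objective, with losses
`g_t(θ) = f^*(θ) - θ · x_t`, where `x_t = Z_t(θ_t) p_t`. -/
def objOcoRegret (γ : ℝ) (run : BanditRun T D P) (q : ℝ≥0∞) (L : ℝ) (f : (Fin d → ℝ) → ℝ)
    (θ : ℕ → Ω → Fin d → ℝ) (ω : Ω) : EReal :=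
  ocoRegret T (dualBall q L)
    (fun t θ' => ((fenchelConj f θ' - θ' ⬝ᵥ estPoint γ run θ t ω : ℝ) : EReal))
    (fun t => θ t ω)

/-- The regret in the dual update for the constraint, with losses
`g_t(φ) = h_S(φ) - φ · z_t`, where `z_t = Z_t(φ_t) p_t`. -/
def conOcoRegret (γ : ℝ) (run : BanditRun T D P) (q : ℝ≥0∞) (S : Set (Fin d → ℝ))
    (φ : ℕ → Ω → Fin d → ℝ) (ω : Ω) : EReal :=
  ocoRegret T (dualBall q 1)
    (fun t φ' => supportFn S φ' - ((φ' ⬝ᵥ estPoint γ run φ t ω : ℝ) : EReal))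
    (fun t => φ t ω)

end BanditRun

/-- `OPT_f`: the supremum of `E[f((1/T) ∑_t v_t)]` over all dynamic policies whose average
observation lies in `S` almost surely. -/
def optValue {m d : ℕ} (T : ℕ) (D : Fin m → Measure (Fin d → ℝ)) (f : (Fin d → ℝ) → ℝ)
    (S : Set (Fin d → ℝ)) : ℝ :=
  sSup {r : ℝ | ∃ (Ω : Type) (_ : MeasurableSpace Ω) (P : Measure Ω) (_ : IsProbabilityMeasure P)
    (run : BanditRun T D P), (∀ᵐ ω ∂P, run.obsAvg ω ∈ S) ∧ r = ∫ ω, f (run.obsAvg ω) ∂P}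

/-- The values to compare with: `OPT_f`, and the values `f(V p)` of all static distributions `p`
that satisfy the constraint in expectation. -/
def objBenchmarks {m d : ℕ} (T : ℕ) (D : Fin m → Measure (Fin d → ℝ)) (f : (Fin d → ℝ) → ℝ)
    (S : Set (Fin d → ℝ)) : Set ℝ :=
  insert (optValue T D f S)
    {b | ∃ p ∈ stdSimplex ℝ (Fin m), meanMatrix D *ᵥ p ∈ S ∧ b = f (meanMatrix D *ᵥ p)}

/-- The smoothing parameter `√((d / T) log (2T))`; the logarithm has base 2. -/
def smoothingParam (d T : ℕ) : ℝ := Real.sqrt (d / T * Real.logb 2 (2 * T))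

end

/-! All randomness is confined to one event, `BanditRun.Accurate`; on it the five bounds are
deterministic.

The event. For `|l| ≤ 1` and `X` in `[0,1]` the exponential of `l X - (l + l²) E X` has mean at most
1, and so does that of a centred predictable function of the drawn arm with `l²` subtracted.
Products over rounds keep this property (`lintegral_prod_le_one`). Markov's inequality and a union
bound over rounds, play counts, arms, components and signs then put all means within their
confidence bounds. Moreover `v_t - x_t` splits into `v_t - V_{i_t}`, `V_{i_t} - V p_t` and `V p_t -
x_t`. The first part is controlled arm by arm, with Cauchy–Schwarz over the arms; the second
concentrates; the third is at most a multiple of the `p_t`-mean of the confidence widths, whose sum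
is compared with the widths of the arms actually drawn, and these telescope. So each coordinate of
the observed average is within `35 √(γm/T)` of `x̄_T`, whatever parameters define the estimates: one
event serves both `x̄_T` and `z̄_T`.

Optimism. `Z_t(θ)` minimizes `θ · Z p` over the confidence box. Hence every `p` with `V p ∈ S` is
feasible, `θ_t · x_t ≤ θ_t · V p`, and `φ_t · z_t ≤ h_S(φ_t)`.

Dual updates. Optimism bounds the losses actually suffered from below, by `f(V p)` or by 0. Fenchel
duality, obtained by separating a concave function from a cone above it, provides one fixed
parameter whose average loss is at most `f(x̄_T)` or `-d(z̄_T, S)`. The difference is the regret.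

Primal updates. These are Frank–Wolfe steps of size `1/(n+1)`: optimism and the gradient inequality
give an increase proportional to the gap, up to a curvature term, and the recursion
`mul_le_add_log_of_recursion` sums the curvature to a logarithm. Without smoothness, quadratic
regularization of the dual problem gives a smooth function within `O(μ)` of the original
(`exists_regularized_gradient`), and `μ` balances this error against the curvature.

Benchmark. By Jensen's inequality a dynamic policy is no better than its average play distribution,
so comparison with static `p` is enough. -/

section

open Filter Topology

/-! ### The `L_q` norms -/

section LqNorm

variable {d : ℕ} {q : ℝ≥0∞}

theorem lqNorm_nonneg (hq : 1 ≤ q) (x : Fin d → ℝ) : 0 ≤ lqNorm q x :=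
  haveI : Fact (1 ≤ q) := ⟨hq⟩
  norm_nonneg _

theorem lqNorm_add_le (hq : 1 ≤ q) (x y : Fin d → ℝ) :
    lqNorm q (x + y) ≤ lqNorm q x + lqNorm q y :=
  haveI : Fact (1 ≤ q) := ⟨hq⟩
  norm_add_le (WithLp.toLp q x) (WithLp.toLp q y)

theorem lqNorm_smul (hq : 1 ≤ q) (c : ℝ) (x : Fin d → ℝ) :
    lqNorm q (c • x) = |c| * lqNorm q x :=
  haveI : Fact (1 ≤ q) := ⟨hq⟩
  norm_smul c (WithLp.toLp q x)

theorem lqNorm_zero (hq : 1 ≤ q) : lqNorm q (0 : Fin d → ℝ) = 0 := by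
  simpa using lqNorm_smul hq 0 (0 : Fin d → ℝ)

theorem lqNorm_neg (hq : 1 ≤ q) (x : Fin d → ℝ) : lqNorm q (-x) = lqNorm q x := by
  simpa using lqNorm_smul hq (-1) x

theorem continuous_lqNorm (hq : 1 ≤ q) : Continuous (lqNorm q : (Fin d → ℝ) → ℝ) :=
  haveI : Fact (1 ≤ q) := ⟨hq⟩
  continuous_norm.comp (PiLp.continuous_toLp q _)

theorem lqNorm_mono (hq : 1 ≤ q) {x y : Fin d → ℝ} (h : ∀ j, |x j| ≤ |y j|) :
    lqNorm q x ≤ lqNorm q y := by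
  unfold lqNorm
  rcases eq_or_ne q ∞ with rfl | hq'
  · rw [PiLp.norm_eq_ciSup, PiLp.norm_eq_ciSup]
    exact ciSup_mono (Set.finite_range _).bddAbove h
  · have hpos : 0 < q.toReal := ENNReal.toReal_pos (by positivity) hq'
    rw [PiLp.norm_eq_sum hpos, PiLp.norm_eq_sum hpos]
    refine Real.rpow_le_rpow (by positivity) (Finset.sum_le_sum fun j _ => ?_) (by positivity)
    exact Real.rpow_le_rpow (norm_nonneg _) (h j) hpos.le

theorem lqNorm_le_mul_lqNorm_one (hq : 1 ≤ q) {x : Fin d → ℝ} {ε : ℝ} (hε : 0 ≤ ε)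
    (h : ∀ j, |x j| ≤ ε) : lqNorm q x ≤ ε * lqNorm q (1 : Fin d → ℝ) := by
  rw [← abs_of_nonneg hε, ← lqNorm_smul hq]
  refine lqNorm_mono hq fun j => ?_
  simpa [abs_of_nonneg hε] using h j

theorem lqNorm_sub_le_of_mem_unitCube (hq : 1 ≤ q) {x y : Fin d → ℝ} (hx : x ∈ unitCube d)
    (hy : y ∈ unitCube d) : lqNorm q (x - y) ≤ lqNorm q (1 : Fin d → ℝ) := by
  refine lqNorm_mono hq fun j => ?_
  have h1 := hx.1 j; have h2 := hx.2 j; have h3 := hy.1 j; have h4 := hy.2 j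
  simp only [Pi.zero_apply, Pi.one_apply, Pi.sub_apply, abs_one] at *
  rw [abs_le]; constructor <;> linarith

theorem lqNorm_two_sq (x : Fin d → ℝ) : lqNorm 2 x ^ 2 = x ⬝ᵥ x := by
  rw [lqNorm, PiLp.norm_eq_of_L2, Real.sq_sqrt (by positivity)]
  simp [dotProduct, sq]

theorem lqNorm_two_one : lqNorm 2 (1 : Fin d → ℝ) = Real.sqrt d := by
  rw [← Real.sqrt_sq (lqNorm_nonneg (by norm_num) _), lqNorm_two_sq]
  simp

theorem lqNorm_two_le_of_mem_dualBall {L : ℝ} {θ : Fin d → ℝ} (hL : 0 ≤ L)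
    (h : θ ∈ dualBall 2 L) : lqNorm 2 θ ≤ L := by
  have h1 := h θ
  rw [← lqNorm_two_sq] at h1
  by_contra! h2
  nlinarith

theorem convex_lqNorm_le (hq : 1 ≤ q) (L : ℝ) :
    Convex ℝ {x : Fin d → ℝ | lqNorm q x ≤ L} := by
  intro x hx y hy a b ha hb hab
  have hx' : lqNorm q x ≤ L := hx
  have hy' : lqNorm q y ≤ L := hy
  have := lqNorm_add_le hq (a • x) (b • y)
  rw [lqNorm_smul hq, lqNorm_smul hq, abs_of_nonneg ha, abs_of_nonneg hb] at this
  calc _ ≤ _ := this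
    _ ≤ a * L + b * L := by gcongr
    _ = L := by rw [← add_mul, hab, one_mul]

theorem isBounded_lqNorm_two_le (L : ℝ) :
    Bornology.IsBounded {x : Fin d → ℝ | lqNorm 2 x ≤ L} := by
  refine (Metric.isBounded_closedBall (x := (0 : Fin d → ℝ)) (r := |L|)).subset fun x hx => ?_
  rw [mem_closedBall_zero_iff, pi_norm_le_iff_of_nonneg (abs_nonneg _)]
  intro j
  have h1 : x j ^ 2 ≤ x ⬝ᵥ x := by
    rw [sq]
    exact Finset.single_le_sum (f := fun j => x j * x j) (fun i _ => mul_self_nonneg _)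
      (Finset.mem_univ j)
  rw [← lqNorm_two_sq] at h1
  have h2 := abs_le_of_sq_le_sq h1 (lqNorm_nonneg (by norm_num) x)
  exact h2.trans (le_trans hx (le_abs_self L))

end LqNorm

/-! ### Supporting hyperplanes -/

theorem exists_eq_dotProduct {d : ℕ} (ℓ : (Fin d → ℝ) →ₗ[ℝ] ℝ) :
    ∃ g : Fin d → ℝ, ∀ x, ℓ x = g ⬝ᵥ x := by
  refine ⟨fun j => ℓ (Pi.single j 1), fun x => ?_⟩
  rw [LinearMap.pi_apply_eq_sum_univ]
  refine Finset.sum_congr rfl fun j _ => ?_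
  rw [smul_eq_mul, mul_comm]
  congr 2
  funext i
  simp [Pi.single_apply, eq_comm]

/-- A concave function on `A` that lies below the cone `c + L ‖y - x‖` lies below an affine function
that takes the value `c` at `x` and lies below the cone. -/
theorem exists_mem_dualBall_le {d : ℕ} {q : ℝ≥0∞} (hq : 1 ≤ q) {A : Set (Fin d → ℝ)}
    (hA : A.Nonempty) {f : (Fin d → ℝ) → ℝ} (hf : ConcaveOn ℝ A f) (x : Fin d → ℝ) (c : ℝ)
    {L : ℝ} (hL : 0 ≤ L) (h : ∀ y ∈ A, f y ≤ c + L * lqNorm q (y - x)) :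
    ∃ g ∈ dualBall q L, ∀ y ∈ A, f y ≤ c + g ⬝ᵥ (y - x) := by
  have hcont : Continuous fun p : (Fin d → ℝ) × ℝ => c + L * lqNorm q (p.1 - x) := by
    have := continuous_lqNorm (d := d) hq
    fun_prop
  have hconv : Convex ℝ {p : (Fin d → ℝ) × ℝ | c + L * lqNorm q (p.1 - x) < p.2} := by
    intro y hy z hz a b ha hb hab
    simp only [Set.mem_ofPred_eq, Prod.fst_add, Prod.smul_fst, Prod.snd_add, Prod.smul_snd,
      smul_eq_mul] at *
    have h1 : a • y.1 + b • z.1 - x = a • (y.1 - x) + b • (z.1 - x) := by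
      rw [smul_sub, smul_sub, sub_add_sub_comm, ← add_smul, hab, one_smul]
    have h2 := lqNorm_add_le hq (a • (y.1 - x)) (b • (z.1 - x))
    rw [lqNorm_smul hq, lqNorm_smul hq, abs_of_nonneg ha, abs_of_nonneg hb, ← h1] at h2
    have h3 := mul_le_mul_of_nonneg_left h2 hL
    have h4 : c = a * c + b * c := by rw [← add_mul, hab, one_mul]
    rcases ha.eq_or_lt with rfl | ha'
    · have : b = 1 := by linarith
      subst this
      linarith
    · linarith [mul_lt_mul_of_pos_left hy ha', mul_le_mul_of_nonneg_left hz.le hb]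
  have hdisj : Disjoint {p : (Fin d → ℝ) × ℝ | c + L * lqNorm q (p.1 - x) < p.2}
      {p : (Fin d → ℝ) × ℝ | p.1 ∈ A ∧ p.2 ≤ f p.1} :=
    Set.disjoint_left.2 fun p hp hp' =>
      absurd (lt_of_lt_of_le hp (hp'.2.trans (h _ hp'.1))) (lt_irrefl _)
  obtain ⟨ψ, u, hu1, hu2⟩ := geometric_hahn_banach_open hconv
    (isOpen_lt hcont continuous_snd) hf.convex_hypograph hdisj
  obtain ⟨g, hg⟩ := exists_eq_dotProduct (ψ.toLinearMap.comp (LinearMap.inl ℝ _ ℝ))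
  have hψ : ∀ y t, ψ (y, t) = g ⬝ᵥ y + ψ (0, 1) * t := fun y t => by
    have h1 : ((y, t) : (Fin d → ℝ) × ℝ) = (y, 0) + t • (0, 1) := by simp
    have h2 : ψ (y, 0) = g ⬝ᵥ y := hg y
    rw [h1, map_add, map_smul, h2, smul_eq_mul, mul_comm]
  obtain ⟨y₀, hy₀⟩ := hA
  set k := ψ (0, 1)
  have hB : ∀ y t, c + L * lqNorm q (y - x) < t → g ⬝ᵥ y + k * t < u := fun y t hyt => by
    rw [← hψ]; exact hu1 (y, t) hyt
  have hA' : ∀ y ∈ A, u ≤ g ⬝ᵥ y + k * f y := fun y hy => by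
    rw [← hψ]; exact hu2 (y, f y) ⟨hy, le_rfl⟩
  -- The cone lies over the whole space, so the vertical line over `y₀` meets both sets; this
  -- excludes a vertical hyperplane.
  have hk : k < 0 := by
    have h1 := hA' y₀ hy₀
    have h2 := hB y₀ (c + L * lqNorm q (y₀ - x) + 1) (by linarith)
    have h3 := h y₀ hy₀
    by_contra! hk
    nlinarith
  have hB' : ∀ y, g ⬝ᵥ y + k * (c + L * lqNorm q (y - x)) ≤ u := fun y => by
    refine le_of_forall_pos_le_add fun ε hε => ?_
    have h1 := hB y (c + L * lqNorm q (y - x) + ε / (-k)) (by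
      have : 0 < ε / (-k) := div_pos hε (by linarith)
      linarith)
    have h2 : k * (ε / (-k)) = -ε := by
      have := hk.ne
      field_simp
    rw [mul_add, h2] at h1
    linarith
  refine ⟨(-k)⁻¹ • g, fun v => ?_, fun y hy => ?_⟩
  · rw [smul_dotProduct, smul_eq_mul, inv_mul_le_iff₀ (by linarith)]
    by_contra! hv
    set M := g ⬝ᵥ v - -k * (L * lqNorm q v) with hM
    have hM0 : 0 < M := by linarith
    -- If the slope in direction `v` exceeded that of the cone, the excess would grow without bound
    -- along the ray from `x`. At the step `N / M` it equals `N`, more than `hB'` permits.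
    set N := |u - g ⬝ᵥ x - k * c| + 1
    have hN0 : 0 < N := by positivity
    have h1 := hB' (x + (N / M) • v)
    rw [add_sub_cancel_left, lqNorm_smul hq, abs_of_pos (by positivity), dotProduct_add,
      dotProduct_smul, smul_eq_mul] at h1
    have h2 : N / M * (g ⬝ᵥ v) + k * (L * (N / M * lqNorm q v)) = N := by
      have : N / M * M = N := by field_simp
      rw [hM] at this ⊢
      linear_combination this
    have h3 := le_abs_self (u - g ⬝ᵥ x - k * c)
    simp only [N] at h2 h1
    linarith
  · have h1 := hA' y hy
    have h2 := hB' x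
    rw [sub_self, lqNorm_zero hq, mul_zero, add_zero] at h2
    rw [smul_dotProduct, smul_eq_mul, dotProduct_sub, ← sub_le_iff_le_add',
      le_inv_mul_iff₀ (by linarith)]
    linarith

/-! ### Regularized minimization -/

theorem dotProduct_self_nonneg' {d : ℕ} (x : Fin d → ℝ) : 0 ≤ x ⬝ᵥ x :=
  Finset.sum_nonneg fun _ _ => mul_self_nonneg _

theorem tendsto_dotProduct {d : ℕ} {u v : ℕ → Fin d → ℝ} {x y : Fin d → ℝ}
    (hu : Tendsto u atTop (𝓝 x)) (hv : Tendsto v atTop (𝓝 y)) :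
    Tendsto (fun n => u n ⬝ᵥ v n) atTop (𝓝 (x ⬝ᵥ y)) :=
  tendsto_finsetSum _ fun j _ => ((tendsto_pi_nhds.1 hu) j).mul ((tendsto_pi_nhds.1 hv) j)

/-- The infimum over `θ ∈ B` of `h(θ) + κ θ · θ - θ · z` is a concave and smooth function of `z`,
and minus its gradient is a limit of near-minimizers. -/
theorem exists_regularized_gradient {d : ℕ} {B : Set (Fin d → ℝ)} (hB : Bornology.IsBounded B)
    (hne : B.Nonempty) {h : (Fin d → ℝ) → ℝ} (hh : ConvexOn ℝ B h) {κ : ℝ} (hκ : 0 < κ)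
    {F : (Fin d → ℝ) → ℝ}
    (hF : ∀ z, IsGLB ((fun θ => h θ + κ * (θ ⬝ᵥ θ) - θ ⬝ᵥ z) '' B) (F z)) (z : Fin d → ℝ) :
    ∃ g : Fin d → ℝ,
      (∃ u : ℕ → Fin d → ℝ, (∀ n, u n ∈ B) ∧ Tendsto u atTop (𝓝 g) ∧
        Tendsto (fun n => h (u n)) atTop (𝓝 (F z - κ * (g ⬝ᵥ g) + g ⬝ᵥ z))) ∧
      ∀ w, F w ≤ F z - g ⬝ᵥ (w - z) ∧
        F z - g ⬝ᵥ (w - z) - (w - z) ⬝ᵥ (w - z) / (4 * κ) ≤ F w := by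
  -- `B` need not be closed nor `h` semicontinuous, so the infimum may not be attained; `g` is a
  -- limit of a minimizing sequence and may lie outside `B`.
  obtain ⟨r, -, -, hr, hrB⟩ := (hF z).exists_seq_antitone_tendsto (hne.image _)
  choose v hvB hv using hrB
  obtain ⟨g, -, σ, hσ, hg⟩ := tendsto_subseq_of_bounded hB hvB
  have hψ : Tendsto (fun n => h (v (σ n)) + κ * (v (σ n) ⬝ᵥ v (σ n)) - v (σ n) ⬝ᵥ z) atTop
      (𝓝 (F z)) :=
    (hr.comp hσ.tendsto_atTop).congr fun n => (hv (σ n)).symm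
  have hgg := tendsto_dotProduct hg hg
  have hgz : ∀ z, Tendsto (fun n => v (σ n) ⬝ᵥ z) atTop (𝓝 (g ⬝ᵥ z)) := fun z =>
    tendsto_dotProduct hg tendsto_const_nhds
  have hle : ∀ w, ∀ θ ∈ B, F w ≤ h θ + κ * (θ ⬝ᵥ θ) - θ ⬝ᵥ w := fun w θ hθ =>
    (hF w).1 (Set.mem_image_of_mem _ hθ)
  -- Quadratic growth from strong convexity: compare `F z` with the value at `(1 - s) v_n + s θ`,
  -- let `n → ∞`, divide by `s`, and let `s → 0`.
  have hgrow : ∀ θ ∈ B, F z + κ * ((θ - g) ⬝ᵥ (θ - g)) ≤ h θ + κ * (θ ⬝ᵥ θ) - θ ⬝ᵥ z := by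
    intro θ hθ
    have hs : ∀ s ∈ Set.Ioo (0 : ℝ) 1, F z + κ * (1 - s) * ((θ - g) ⬝ᵥ (θ - g)) ≤
        h θ + κ * (θ ⬝ᵥ θ) - θ ⬝ᵥ z := by
      intro s hs
      have h1 : ∀ n, F z ≤ (1 - s) * (h (v (σ n)) + κ * (v (σ n) ⬝ᵥ v (σ n)) - v (σ n) ⬝ᵥ z) +
          s * (h θ + κ * (θ ⬝ᵥ θ) - θ ⬝ᵥ z) -
          κ * s * (1 - s) * ((θ - v (σ n)) ⬝ᵥ (θ - v (σ n))) := by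
        intro n
        have h2 := hle z _ (hh.1 (hvB (σ n)) hθ (sub_nonneg.2 hs.2.le) hs.1.le (by ring))
        have h3 := hh.2 (hvB (σ n)) hθ (sub_nonneg.2 hs.2.le) hs.1.le (by ring)
        simp only [add_dotProduct, dotProduct_add, smul_dotProduct, dotProduct_smul,
          sub_dotProduct, dotProduct_sub, smul_eq_mul, dotProduct_comm θ (v (σ n))] at h2 h3 ⊢
        linarith
      have h4 := ge_of_tendsto' (((hψ.const_mul (1 - s)).add_const
        (s * (h θ + κ * (θ ⬝ᵥ θ) - θ ⬝ᵥ z))).sub ((tendsto_dotProduct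
          (tendsto_const_nhds.sub hg) (tendsto_const_nhds.sub hg)).const_mul (κ * s * (1 - s)))) h1
      have h5 : s * (F z + κ * (1 - s) * ((θ - g) ⬝ᵥ (θ - g))) ≤
          s * (h θ + κ * (θ ⬝ᵥ θ) - θ ⬝ᵥ z) := by linarith
      exact le_of_mul_le_mul_left h5 hs.1
    have hlim : Tendsto (fun s : ℝ => F z + κ * (1 - s) * ((θ - g) ⬝ᵥ (θ - g))) (𝓝[>] 0)
        (𝓝 (F z + κ * (1 - 0) * ((θ - g) ⬝ᵥ (θ - g)))) :=
      (Continuous.tendsto (by fun_prop) 0).mono_left nhdsWithin_le_nhds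
    rw [sub_zero, mul_one] at hlim
    exact le_of_tendsto hlim (by
      filter_upwards [Ioo_mem_nhdsGT (zero_lt_one' ℝ)] with s hs' using hs s hs')
  refine ⟨g, ⟨v ∘ σ, fun n => hvB _, hg, ?_⟩, fun w => ⟨?_, ?_⟩⟩
  · refine ((hψ.sub (hgg.const_mul κ)).add (hgz z)).congr fun n => ?_
    simp only [Function.comp]
    ring
  · have h1 := ge_of_tendsto' (hψ.sub (hgz (w - z))) (b := F w) fun n => by
      have := hle w _ (hvB (σ n))
      rw [dotProduct_sub]
      linarith
    exact h1
  · refine (hF w).2 ?_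
    rintro _ ⟨θ, hθ, rfl⟩
    have h1 := hgrow θ hθ
    -- Completing the square: over all `a`, the minimum of `κ a · a - a · (w - z)` is `-(w - z) · (w
    -- - z) / (4κ)`.
    have h2 : 0 ≤ ((2 * κ) • (θ - g) - (w - z)) ⬝ᵥ ((2 * κ) • (θ - g) - (w - z)) :=
      dotProduct_self_nonneg' _
    have h3 : ((2 * κ) • (θ - g) - (w - z)) ⬝ᵥ ((2 * κ) • (θ - g) - (w - z)) =
        4 * κ * (κ * ((θ - g) ⬝ᵥ (θ - g)) - (θ - g) ⬝ᵥ (w - z) +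
          (w - z) ⬝ᵥ (w - z) / (4 * κ)) := by
      generalize θ - g = a
      generalize w - z = b
      rw [sub_dotProduct, dotProduct_sub, dotProduct_sub, dotProduct_comm b (_ • a)]
      simp only [smul_dotProduct, dotProduct_smul, smul_eq_mul]
      field_simp
      ring
    rw [h3] at h2
    have h4 := nonneg_of_mul_nonneg_right h2 (by positivity)
    have h5 : θ ⬝ᵥ w = θ ⬝ᵥ z + θ ⬝ᵥ (w - z) := by rw [dotProduct_sub]; ring
    rw [sub_dotProduct θ g (w - z)] at h4
    simp only
    linarith

/-! ### Gradients on the cube -/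

theorem convex_unitCube (d : ℕ) : Convex ℝ (unitCube d) := convex_Icc 0 1

theorem isClosed_unitCube (d : ℕ) : IsClosed (unitCube d) := isClosed_Icc

theorem uniqueDiffOn_unitCube (d : ℕ) : UniqueDiffOn ℝ (unitCube d) := by
  rw [unitCube, ← Set.pi_univ_Icc]
  exact UniqueDiffOn.univ_pi fun _ => uniqueDiffOn_Icc zero_lt_one

theorem cubeGradient_dotProduct {d : ℕ} (F : (Fin d → ℝ) → ℝ) (z v : Fin d → ℝ) :
    cubeGradient F z ⬝ᵥ v = fderivWithin ℝ F (unitCube d) z v := by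
  obtain ⟨g, hg⟩ := exists_eq_dotProduct (fderivWithin ℝ F (unitCube d) z).toLinearMap
  have hg' : ∀ x, fderivWithin ℝ F (unitCube d) z x = g ⬝ᵥ x := hg
  rw [hg']
  congr 1
  funext j
  simp [cubeGradient, hg']

theorem dotProduct_self_le {d : ℕ} (x : Fin d → ℝ) : x ⬝ᵥ x ≤ d * ‖x‖ ^ 2 := by
  calc x ⬝ᵥ x ≤ ∑ _j : Fin d, ‖x‖ ^ 2 := Finset.sum_le_sum fun j _ => by
        rw [← sq, ← sq_abs]
        exact pow_le_pow_left₀ (abs_nonneg _) (norm_le_pi_norm x j) 2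
    _ = d * ‖x‖ ^ 2 := by simp

/-- The two bounds leave an error `O(‖w - z‖²)` to the affine approximation. They hold for all `w`,
so `F` is differentiable at `z` in the full space, and the derivative within the cube agrees even at
boundary points. -/
theorem cubeGradient_eq_neg {d : ℕ} {F : (Fin d → ℝ) → ℝ} {z g : Fin d → ℝ} {c : ℝ}
    (hz : z ∈ unitCube d)
    (h : ∀ w, F w ≤ F z - g ⬝ᵥ (w - z) ∧ F z - g ⬝ᵥ (w - z) - (w - z) ⬝ᵥ (w - z) / c ≤ F w) :
    cubeGradient F z = -g := by
  have h1 : HasFDerivAt (fun w => F w - (F z - g ⬝ᵥ (w - z)))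
      (0 : (Fin d → ℝ) →L[ℝ] ℝ) z := by
    refine Asymptotics.IsBigO.hasFDerivAt (n := 2) ?_ one_lt_two
    refine Asymptotics.IsBigO.of_bound (d / |c|) (Eventually.of_forall fun w => ?_)
    obtain ⟨h1, h2⟩ := h w
    rw [Real.norm_eq_abs, Real.norm_eq_abs, abs_of_nonneg (a := ‖w - z‖ ^ 2) (by positivity),
      abs_of_nonpos (by linarith)]
    have h3 : (w - z) ⬝ᵥ (w - z) / c ≤ d * ‖w - z‖ ^ 2 / |c| := by
      refine (le_abs_self _).trans ?_
      rw [abs_div, abs_of_nonneg (dotProduct_self_nonneg' _)]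
      gcongr
      exact dotProduct_self_le _
    calc _ ≤ d * ‖w - z‖ ^ 2 / |c| := by linarith
      _ = _ := by ring
  set ℓ : (Fin d → ℝ) →L[ℝ] ℝ := ∑ j, g j • ContinuousLinearMap.proj j with hℓ
  have hℓ' : ∀ v, ℓ v = g ⬝ᵥ v := fun v => by simp [hℓ, dotProduct]
  have h2 : HasFDerivAt F (-ℓ) z := by
    have h3 := h1.add (((ℓ.hasFDerivAt (x := z)).neg).add_const (F z + g ⬝ᵥ z))
    rw [zero_add] at h3
    refine h3.congr_of_eventuallyEq (Eventually.of_forall fun w => ?_)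
    simp only [Pi.add_apply, Pi.neg_apply, hℓ', dotProduct_sub]
    ring
  funext j
  rw [cubeGradient, h2.hasFDerivWithinAt.fderivWithin (uniqueDiffOn_unitCube d z hz)]
  simp [hℓ']

/-- By concavity the difference quotients along the segment from `z` to `y` are at least `F y - F
z`. Only the one-sided derivative at `z` is used, since `z` may lie on the boundary. -/
theorem ConcaveOn.sub_le_cubeGradient_dotProduct {d : ℕ} {F : (Fin d → ℝ) → ℝ}
    (hF : ConcaveOn ℝ (unitCube d) F) (hd : DifferentiableOn ℝ F (unitCube d))
    {y z : Fin d → ℝ} (hy : y ∈ unitCube d) (hz : z ∈ unitCube d) :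
    F y - F z ≤ cubeGradient F z ⬝ᵥ (y - z) := by
  rw [cubeGradient_dotProduct]
  have h1 := (hd z hz).hasFDerivWithinAt
  have hmaps : ∀ s ∈ Set.Icc (0 : ℝ) 1, z + s • (y - z) ∈ unitCube d := fun s hs =>
    (convex_unitCube d).add_smul_sub_mem hz hy hs
  have h2 : HasDerivWithinAt (fun s : ℝ => z + s • (y - z)) (y - z) (Set.Icc 0 1) 0 := by
    simpa using (((hasDerivAt_id (0 : ℝ)).smul_const (y - z)).const_add z).hasDerivWithinAt
  have h3 : HasDerivWithinAt (fun s : ℝ => F (z + s • (y - z)))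
      (fderivWithin ℝ F (unitCube d) z (y - z)) (Set.Icc 0 1) 0 := by
    have h1' : HasFDerivWithinAt F (fderivWithin ℝ F (unitCube d) z) (unitCube d)
        (z + (0 : ℝ) • (y - z)) := by simpa using h1
    exact h1'.comp_hasDerivWithinAt 0 h2 hmaps
  rw [hasDerivWithinAt_iff_tendsto_slope] at h3
  have hset : Set.Icc (0 : ℝ) 1 \ {0} = Set.Ioc 0 1 := by
    ext s; simp only [Set.mem_sdiff, Set.mem_Icc, Set.mem_singleton_iff, Set.mem_Ioc]
    constructor
    · rintro ⟨⟨h1, h2⟩, h3⟩; exact ⟨lt_of_le_of_ne h1 (Ne.symm h3), h2⟩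
    · rintro ⟨h1, h2⟩; exact ⟨⟨h1.le, h2⟩, h1.ne'⟩
  rw [hset, nhdsWithin_Ioc_eq_nhdsGT (zero_lt_one' ℝ)] at h3
  refine ge_of_tendsto h3 ?_
  filter_upwards [Ioo_mem_nhdsGT (zero_lt_one' ℝ)] with s hs
  have h4 := hF.2 hz hy (sub_nonneg.2 hs.2.le) hs.1.le (by ring)
  have h5 : (1 - s) • z + s • y = z + s • (y - z) := by module
  rw [h5, smul_eq_mul, smul_eq_mul] at h4
  rw [slope_def_field, sub_zero, le_div_iff₀ hs.1, zero_smul, add_zero]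
  linarith

/-! ### A recursion for averaged iterates -/

/-- If `(n + 1) Δ (n + 1) ≤ n Δ n + C / (n + 1)`, then `T Δ T` grows logarithmically. -/
theorem mul_le_add_log_of_recursion {Δ : ℕ → ℝ} {C : ℝ} (hC : 0 ≤ C) {T : ℕ} (hT : 1 ≤ T)
    (h : ∀ n, 1 ≤ n → n < T → (n + 1) * Δ (n + 1) ≤ n * Δ n + C / (n + 1)) :
    T * Δ T ≤ Δ 1 + C * Real.log T := by
  suffices H : ∀ n, 1 ≤ n → n ≤ T → n * Δ n ≤ Δ 1 + C * Real.log n from H T hT le_rfl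
  intro n hn
  induction n, hn using Nat.le_induction with
  | base => simp
  | succ n hn ih =>
    intro hnT
    have h1 := ih (by omega)
    have h2 := h n hn (by omega)
    have hn0 : (0 : ℝ) < n := by exact_mod_cast hn
    -- This is `log x ≤ x - 1` at `x = n / (n + 1)`.
    have h3 : 1 / ((n : ℝ) + 1) ≤ Real.log (n + 1) - Real.log n := by
      rw [← Real.log_div (by positivity) hn0.ne', ← neg_le_neg_iff, ← Real.log_inv]
      refine (Real.log_le_sub_one_of_pos (by positivity)).trans (le_of_eq ?_)
      field_simp
      ring
    have h4 := mul_le_mul_of_nonneg_left h3 hC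
    push_cast
    rw [mul_one_div] at h4
    linarith

/-! ### Exponential moments -/

theorem Real.exp_le_one_add_add_sq {y : ℝ} (h : |y| ≤ 1) : Real.exp y ≤ 1 + y + y ^ 2 := by
  have := Real.abs_exp_sub_one_sub_id_le h
  linarith [le_abs_self (Real.exp y - 1 - y)]

/-- On `[0,1]` one has `X² ≤ X`, so `exp (l X) ≤ 1 + (l + l²) X`. The second-order cost is thus
proportional to the mean, which yields deviations of order the square root of the mean. -/
theorem lintegral_exp_le_one {α : Type*} [MeasurableSpace α] {μ : Measure α}
    [IsProbabilityMeasure μ] {X : α → ℝ} (hX : Measurable X) (h01 : ∀ᵐ x ∂μ, X x ∈ Set.Icc (0 : ℝ) 1)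
    {l : ℝ} (hl : |l| ≤ 1) :
    ∫⁻ x, ENNReal.ofReal (Real.exp (l * X x - (l + l ^ 2) * ∫ x, X x ∂μ)) ∂μ ≤ 1 := by
  have hint : Integrable X μ := by
    refine Integrable.of_bound hX.aestronglyMeasurable 1 ?_
    filter_upwards [h01] with x hx
    rw [Real.norm_eq_abs, abs_le]
    exact ⟨by linarith [hx.1], hx.2⟩
  set V := ∫ x, X x ∂μ
  set c := Real.exp (-((l + l ^ 2) * V))
  have hle : ∀ᵐ x ∂μ, ENNReal.ofReal (Real.exp (l * X x - (l + l ^ 2) * V)) ≤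
      ENNReal.ofReal (c * (1 + (l + l ^ 2) * X x)) := by
    filter_upwards [h01] with x hx
    refine ENNReal.ofReal_le_ofReal ?_
    rw [sub_eq_neg_add, Real.exp_add]
    refine mul_le_mul_of_nonneg_left ?_ (Real.exp_nonneg _)
    have h1 : |l * X x| ≤ 1 := by
      rw [abs_mul, abs_of_nonneg hx.1]
      exact mul_le_one₀ hl hx.1 hx.2
    refine (Real.exp_le_one_add_add_sq h1).trans ?_
    nlinarith [mul_nonneg (sq_nonneg l) (mul_nonneg hx.1 (sub_nonneg.2 hx.2))]
  have hnonneg : ∀ᵐ x ∂μ, 0 ≤ c * (1 + (l + l ^ 2) * X x) := by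
    filter_upwards [h01] with x hx
    refine mul_nonneg (Real.exp_nonneg _) ?_
    have := abs_le.1 hl
    nlinarith [mul_nonneg (sq_nonneg l) hx.1, hx.1, hx.2]
  refine (lintegral_mono_ae hle).trans ?_
  rw [← ofReal_integral_eq_lintegral_ofReal ?_ hnonneg]
  · rw [integral_const_mul, integral_add (integrable_const _) (hint.const_mul _),
      integral_const_mul]
    simp only [integral_const, probReal_univ, smul_eq_mul, one_mul]
    rw [← ENNReal.ofReal_one]
    refine ENNReal.ofReal_le_ofReal ?_
    calc c * (1 + (l + l ^ 2) * V) ≤ c * Real.exp ((l + l ^ 2) * V) := by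
          refine mul_le_mul_of_nonneg_left ?_ (Real.exp_nonneg _)
          linarith [Real.add_one_le_exp ((l + l ^ 2) * V)]
      _ = 1 := by rw [← Real.exp_add]; simp
  · exact ((integrable_const _).add (hint.const_mul _)).const_mul _

/-- The linear term has mean zero under `p`, and the centred values are at most 1 in absolute value,
so the second-order term is at most `l²`. -/
theorem sum_mul_exp_le_one {m : ℕ} {p g : Fin m → ℝ} (hp : p ∈ stdSimplex ℝ (Fin m))
    (hg : ∀ i, g i ∈ Set.Icc (0 : ℝ) 1) {l : ℝ} (hl : |l| ≤ 1) :
    ∑ i, Real.exp (l * (g i - p ⬝ᵥ g) - l ^ 2) * p i ≤ 1 := by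
  have h0 : 0 ≤ p ⬝ᵥ g := Finset.sum_nonneg fun i _ => mul_nonneg (hp.1 i) (hg i).1
  have h1 : p ⬝ᵥ g ≤ 1 := by
    rw [← hp.2]
    exact Finset.sum_le_sum fun i _ => mul_le_of_le_one_right (hp.1 i) (hg i).2
  have hle : ∀ i, Real.exp (l * (g i - p ⬝ᵥ g) - l ^ 2) * p i ≤
      Real.exp (-l ^ 2) * ((1 + l * (g i - p ⬝ᵥ g) + l ^ 2) * p i) := fun i => by
    rw [sub_eq_neg_add, Real.exp_add, mul_assoc]
    refine mul_le_mul_of_nonneg_left (mul_le_mul_of_nonneg_right ?_ (hp.1 i)) (Real.exp_nonneg _)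
    have h3 : |g i - p ⬝ᵥ g| ≤ 1 :=
      abs_le.2 ⟨by linarith [(hg i).1], by linarith [(hg i).2]⟩
    have h4 : |l * (g i - p ⬝ᵥ g)| ≤ 1 := by
      rw [abs_mul]
      exact mul_le_one₀ hl (abs_nonneg _) h3
    have h5 : (g i - p ⬝ᵥ g) ^ 2 ≤ 1 := by
      rw [← sq_abs]
      exact pow_le_one₀ (abs_nonneg _) h3
    refine (Real.exp_le_one_add_add_sq h4).trans ?_
    rw [mul_pow]
    nlinarith [sq_nonneg l]
  refine (Finset.sum_le_sum fun i _ => hle i).trans ?_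
  rw [← Finset.mul_sum]
  have hs : ∑ i, (1 + l * (g i - p ⬝ᵥ g) + l ^ 2) * p i = 1 + l ^ 2 := by
    have h6 : ∀ i, (1 + l * (g i - p ⬝ᵥ g) + l ^ 2) * p i =
        (1 - l * (p ⬝ᵥ g) + l ^ 2) * p i + l * (p i * g i) := fun i => by ring
    simp only [h6, Finset.sum_add_distrib, ← Finset.mul_sum]
    rw [hp.2]
    simp only [dotProduct]
    ring
  rw [hs]
  calc _ ≤ Real.exp (-l ^ 2) * Real.exp (l ^ 2) := by
        refine mul_le_mul_of_nonneg_left ?_ (Real.exp_nonneg _)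
        linarith [Real.add_one_le_exp (l ^ 2)]
    _ = 1 := by rw [← Real.exp_add]; simp

namespace BanditRun

variable {m d T : ℕ} {D : Fin m → Measure (Fin d → ℝ)} {Ω : Type*} [mΩ : MeasurableSpace Ω]
  {P : Measure Ω}

/-! ### The law of a round -/

theorem measurable_arm (run : BanditRun T D P) {t : ℕ} (ht : t < T) : Measurable (run.arm t) :=
  (run.arm_measurable t ht).mono (run.hist.le _) le_rfl

theorem measurable_obs (run : BanditRun T D P) {t : ℕ} (ht : t < T) : Measurable (run.obs t) :=
  (run.obs_measurable t ht).mono (run.hist.le _) le_rfl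

theorem measurable_p (run : BanditRun T D P) {t : ℕ} (ht : t < T) : Measurable (run.p t) :=
  (run.p_measurable t ht).mono (run.hist.le _) le_rfl

theorem lintegral_mul_of_rect {Ω X E : Type*} [MeasurableSpace Ω] [MeasurableSpace X]
    [MeasurableSpace E] {μ : Measure Ω} {μ₁ : Measure X} {ν : Measure E} [SigmaFinite μ₁]
    [SigmaFinite ν] {u : Ω → X} {v : Ω → E} (hu : Measurable u) (hv : Measurable v)
    (h : ∀ A B, MeasurableSet A → MeasurableSet B → μ (u ⁻¹' A ∩ v ⁻¹' B) = μ₁ A * ν B)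
    {W : X → ℝ≥0∞} {b : E → ℝ≥0∞} (hW : Measurable W) (hb : Measurable b) :
    ∫⁻ ω, W (u ω) * b (v ω) ∂μ = (∫⁻ x, W x ∂μ₁) * ∫⁻ y, b y ∂ν := by
  have hprod : μ₁.prod ν = μ.map fun ω => (u ω, v ω) :=
    Measure.prod_eq fun A B hA hB => by
      rw [Measure.map_apply (hu.prodMk hv) (hA.prod hB), ← h A B hA hB]
      rfl
  rw [← lintegral_prod_mul hW.aemeasurable hb.aemeasurable, hprod,
    lintegral_map (by fun_prop) (hu.prodMk hv)]

/-- The law of a round is given on rectangles with a first side in `hist t`. Uniqueness of product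
measures extends it to products of functions; the first factor is trimmed to `hist t` because only
that σ-algebra is covered. -/
theorem setLIntegral_arm [IsProbabilityMeasure P] [∀ i, IsProbabilityMeasure (D i)]
    (run : BanditRun T D P) {t : ℕ} (ht : t < T) (i : Fin m) {W : Ω → ℝ≥0∞}
    (hW : Measurable[run.hist t] W) {b : (Fin d → ℝ) → ℝ≥0∞} (hb : Measurable b) :
    ∫⁻ ω in run.arm t ⁻¹' {i}, W ω * b (run.obs t ω) ∂P =
      (∫⁻ ω, W ω * ENNReal.ofReal (run.p t ω i) ∂P) * ∫⁻ x, b x ∂(D i) := by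
  have hm := run.hist.le t
  have hp : Measurable[run.hist t] fun ω => ENNReal.ofReal (run.p t ω i) :=
    ENNReal.measurable_ofReal.comp ((measurable_pi_apply i).comp (run.p_measurable t ht))
  set μ₁ : @Measure Ω (run.hist t) :=
    (P.withDensity fun ω => ENNReal.ofReal (run.p t ω i)).trim hm with hμ₁
  have hfin : @IsFiniteMeasure Ω (run.hist t) μ₁ := by
    refine @IsFiniteMeasure.mk _ (run.hist t) _ ?_
    rw [hμ₁, trim_measurableSet_eq hm MeasurableSet.univ, withDensity_apply _ MeasurableSet.univ,
      Measure.restrict_univ]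
    calc _ ≤ ∫⁻ _, 1 ∂P := lintegral_mono fun ω => by
          refine ENNReal.ofReal_le_one.2 ?_
          have := run.p_mem t ht ω
          rw [← this.2]
          exact Finset.single_le_sum (fun j _ => this.1 j) (Finset.mem_univ i)
      _ < ∞ := by simp
  have h := @lintegral_mul_of_rect Ω Ω (Fin d → ℝ) mΩ (run.hist t) _
    (P.restrict (run.arm t ⁻¹' {i})) μ₁ (D i) _ _ id (run.obs t) (measurable_id'' hm)
    (run.measurable_obs ht) (fun A B hA hB => by
      rw [Measure.restrict_apply' (run.measurable_arm ht (measurableSet_singleton i)),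
        hμ₁, trim_measurableSet_eq hm hA, withDensity_apply _ (hm _ hA),
        ← run.law t ht A hA i B hB]
      congr 1
      ext ω
      simp only [Set.mem_inter_iff, Set.mem_preimage, Set.mem_singleton_iff, id]
      tauto) W b hW hb
  refine h.trans ?_
  congr 1
  rw [hμ₁, lintegral_trim hm hW, lintegral_withDensity_eq_lintegral_mul _ (hp.mono hm le_rfl)
    (hW.mono hm le_rfl)]
  simp [mul_comm]

theorem lintegral_eq_sum_arm (run : BanditRun T D P) {t : ℕ} (ht : t < T) (F : Ω → ℝ≥0∞) :
    ∫⁻ ω, F ω ∂P = ∑ i, ∫⁻ ω in run.arm t ⁻¹' {i}, F ω ∂P := by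
  have h := lintegral_biUnion_finset (μ := P) (s := Finset.univ)
    (t := fun i => run.arm t ⁻¹' {i})
    (fun i _ j _ hij => by
      refine Set.disjoint_left.2 fun ω h1 h2 => hij ?_
      simp only [Set.mem_preimage, Set.mem_singleton_iff] at h1 h2
      rw [← h1, h2])
    (fun i _ => run.measurable_arm ht (measurableSet_singleton i)) F
  rw [← h]
  have : (⋃ i ∈ (Finset.univ : Finset (Fin m)), run.arm t ⁻¹' {i}) = Set.univ := by
    ext ω; simp
  rw [this, Measure.restrict_univ]

theorem ae_obs_mem [IsProbabilityMeasure P] [∀ i, IsProbabilityMeasure (D i)]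
    (run : BanditRun T D P) (hD : ∀ i, ∀ᵐ x ∂(D i), x ∈ unitCube d) :
    ∀ᵐ ω ∂P, ∀ t < T, run.obs t ω ∈ unitCube d := by
  rw [ae_all_iff]; intro t
  by_cases ht : t < T
  swap
  · exact Eventually.of_forall fun ω h => absurd h ht
  have hmeas : MeasurableSet (unitCube d)ᶜ := (isClosed_unitCube d).measurableSet.compl
  have h0 : P (run.obs t ⁻¹' (unitCube d)ᶜ) = 0 := by
    rw [← lintegral_indicator_one (run.measurable_obs ht hmeas), run.lintegral_eq_sum_arm ht]
    refine Finset.sum_eq_zero fun i _ => ?_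
    have h := run.setLIntegral_arm ht i (W := fun _ => 1) measurable_const
      (b := (unitCube d)ᶜ.indicator 1) (measurable_one.indicator hmeas)
    rw [lintegral_indicator_one hmeas, show D i (unitCube d)ᶜ = 0 from hD i, mul_zero] at h
    simp only [one_mul] at h
    exact h
  filter_upwards [show ∀ᵐ ω ∂P, run.obs t ω ∈ unitCube d from h0] with ω hω _ using hω

/-! ### An exponential supermartingale -/

/-- By `hab` each factor has conditional mean at most 1 given the past, so the last round can be
integrated out. The factor `a` is predictable and sees the arm only; `b` also sees the observation.
Each of the two applications takes one of them to be 1. -/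
theorem lintegral_prod_le_one [IsProbabilityMeasure P] [∀ i, IsProbabilityMeasure (D i)]
    (run : BanditRun T D P) {a : ℕ → Ω → Fin m → ℝ≥0∞} {b : Fin m → (Fin d → ℝ) → ℝ≥0∞}
    (ha : ∀ t < T, ∀ i, Measurable[run.hist t] fun ω => a t ω i) (hb : ∀ i, Measurable (b i))
    (hab : ∀ t < T, ∀ ω,
      ∑ i, a t ω i * ENNReal.ofReal (run.p t ω i) * ∫⁻ x, b i x ∂(D i) ≤ 1) :
    ∀ t ≤ T, Measurable[run.hist t] (fun ω => ∏ s ∈ Finset.range t,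
        (a s ω (run.arm s ω) * b (run.arm s ω) (run.obs s ω))) ∧
      ∫⁻ ω, ∏ s ∈ Finset.range t, (a s ω (run.arm s ω) * b (run.arm s ω) (run.obs s ω)) ∂P ≤ 1 := by
  intro t
  induction t with
  | zero => intro _; simp
  | succ t ih =>
    intro ht
    obtain ⟨ih1, ih2⟩ := ih (by omega)
    have ht' : t < T := ht
    have hle : run.hist t ≤ run.hist (t + 1) := run.hist.mono (Nat.le_succ t)
    simp only [Finset.prod_range_succ]
    set W : Ω → ℝ≥0∞ := fun ω => ∏ s ∈ Finset.range t,
        (a s ω (run.arm s ω) * b (run.arm s ω) (run.obs s ω)) with hW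
    constructor
    · refine Measurable.mul (ih1.mono hle le_rfl) ?_
      have : (fun ω => a t ω (run.arm t ω) * b (run.arm t ω) (run.obs t ω)) =
          fun ω => ∑ i, (run.arm t ⁻¹' {i}).indicator (fun ω => a t ω i * b i (run.obs t ω)) ω := by
        funext ω
        rw [Finset.sum_eq_single (run.arm t ω)]
        · simp
        · intro i _ hi; simp [Ne.symm hi]
        · simp
      rw [this]
      refine Finset.measurable_sum _ fun i _ => Measurable.indicator ?_
        (run.arm_measurable t ht' (measurableSet_singleton i))
      exact ((ha t ht' i).mono hle le_rfl).mul ((hb i).comp (run.obs_measurable t ht'))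
    · rw [run.lintegral_eq_sum_arm ht']
      have h1 : ∀ i, ∫⁻ ω in run.arm t ⁻¹' {i},
          W ω * (a t ω (run.arm t ω) * b (run.arm t ω) (run.obs t ω)) ∂P =
          ∫⁻ ω, W ω * (a t ω i * ENNReal.ofReal (run.p t ω i) * ∫⁻ x, b i x ∂(D i)) ∂P := by
        intro i
        have h2 := run.setLIntegral_arm ht' i (ih1.mul (ha t ht' i)) (hb i)
        have hmp : Measurable fun ω => ENNReal.ofReal (run.p t ω i) :=
          ENNReal.measurable_ofReal.comp ((measurable_pi_apply i).comp (run.measurable_p ht'))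
        rw [← lintegral_mul_const (f := fun ω => (W * fun ω => a t ω i) ω *
          ENNReal.ofReal (run.p t ω i)) _
          (((ih1.mul (ha t ht' i)).mono (run.hist.le t) le_rfl).mul hmp)] at h2
        calc _ = _ := setLIntegral_congr_fun (run.measurable_arm ht' (measurableSet_singleton i))
              fun ω hω => by
                have : run.arm t ω = i := hω
                simp only [this]; rw [← mul_assoc]; rfl
          _ = _ := h2
          _ = _ := lintegral_congr fun ω => by simp only [Pi.mul_apply]; ring
      rw [Finset.sum_congr rfl fun i _ => h1 i, ← lintegral_finsetSum]
      · refine le_trans (lintegral_mono fun ω => ?_) ih2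
        rw [← Finset.mul_sum]
        exact mul_le_of_le_one_right zero_le (hab t ht' ω)
      · intro i _
        refine (ih1.mono (run.hist.le t) le_rfl).mul ?_
        refine Measurable.mul_const ?_ _
        exact ((ha t ht' i).mono (run.hist.le t) le_rfl).mul
          (ENNReal.measurable_ofReal.comp ((measurable_pi_apply i).comp (run.measurable_p ht')))

/-- Markov's inequality for the exponential of a sum. -/
theorem measure_le_exp_neg {Y : Ω → ℝ} (hY : Measurable fun ω => ENNReal.ofReal (Real.exp (Y ω)))
    (h : ∫⁻ ω, ENNReal.ofReal (Real.exp (Y ω)) ∂P ≤ 1) (c : ℝ) :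
    P {ω | c ≤ Y ω} ≤ ENNReal.ofReal (Real.exp (-c)) := by
  have h1 := mul_meas_ge_le_lintegral hY (μ := P) (ENNReal.ofReal (Real.exp c))
  have h2 : {ω | c ≤ Y ω} ⊆
      {ω | ENNReal.ofReal (Real.exp c) ≤ ENNReal.ofReal (Real.exp (Y ω))} := fun ω hω =>
    ENNReal.ofReal_le_ofReal (Real.exp_le_exp.2 hω)
  have h3 : ENNReal.ofReal (Real.exp c) * P {ω | c ≤ Y ω} ≤ 1 :=
    ((mul_le_mul_right (measure_mono h2) _).trans h1).trans h
  calc P {ω | c ≤ Y ω} = ENNReal.ofReal (Real.exp (-c)) *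
        (ENNReal.ofReal (Real.exp c) * P {ω | c ≤ Y ω}) := by
        rw [← mul_assoc, ← ENNReal.ofReal_mul (Real.exp_nonneg _), ← Real.exp_add]; simp
    _ ≤ ENNReal.ofReal (Real.exp (-c)) * 1 := by gcongr
    _ = _ := mul_one _

/-- Concentration of the sum of the observations of an arm. -/
theorem measure_obs_deviation [IsProbabilityMeasure P] [∀ i, IsProbabilityMeasure (D i)]
    (run : BanditRun T D P) (hD : ∀ i, ∀ᵐ x ∂(D i), x ∈ unitCube d) {t : ℕ} (ht : t ≤ T)
    (i : Fin m) (j : Fin d) {l : ℝ} (hl : |l| ≤ 1) (c : ℝ) :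
    P {ω | c ≤ l * ∑ s ∈ (Finset.range t).filter (fun s => run.arm s ω = i), run.obs s ω j -
      (l + l ^ 2) * meanMatrix D j i * run.plays t ω i} ≤ ENNReal.ofReal (Real.exp (-c)) := by
  have hj : Measurable fun x : Fin d → ℝ => x j := measurable_pi_apply j
  have hb : ∀ i', Measurable fun x : Fin d → ℝ => if i' = i then
      ENNReal.ofReal (Real.exp (l * x j - (l + l ^ 2) * meanMatrix D j i)) else 1 := fun i' => by
    split_ifs
    · fun_prop
    · exact measurable_const
  -- Rounds in which another arm is drawn contribute the factor 1.
  obtain ⟨h1, h2⟩ := run.lintegral_prod_le_one (a := fun _ _ _ => 1)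
    (b := fun i' x => if i' = i then
      ENNReal.ofReal (Real.exp (l * x j - (l + l ^ 2) * meanMatrix D j i)) else 1)
    (fun _ _ _ => measurable_const) hb (fun s hs ω => by
      have hle : ∀ i', ∫⁻ x, (if i' = i then ENNReal.ofReal (Real.exp (l * x j -
          (l + l ^ 2) * meanMatrix D j i)) else 1) ∂(D i') ≤ 1 := fun i' => by
        split_ifs with h
        · subst h
          refine lintegral_exp_le_one hj ?_ hl
          filter_upwards [hD i'] with x hx using ⟨hx.1 j, hx.2 j⟩
        · simp
      calc _ ≤ ∑ i', ENNReal.ofReal (run.p s ω i') := Finset.sum_le_sum fun i' _ => by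
            rw [one_mul]
            exact mul_le_of_le_one_right zero_le (hle i')
        _ = 1 := by
          rw [← ENNReal.ofReal_sum_of_nonneg fun i' _ => (run.p_mem s hs ω).1 i',
            (run.p_mem s hs ω).2, ENNReal.ofReal_one]) t ht
  have heq : ∀ ω, ∏ s ∈ Finset.range t, ((1 : ℝ≥0∞) * if run.arm s ω = i then
      ENNReal.ofReal (Real.exp (l * run.obs s ω j - (l + l ^ 2) * meanMatrix D j i)) else 1) =
      ENNReal.ofReal (Real.exp (l * ∑ s ∈ (Finset.range t).filter (fun s => run.arm s ω = i),
        run.obs s ω j - (l + l ^ 2) * meanMatrix D j i * run.plays t ω i)) := fun ω => by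
    simp only [one_mul]
    rw [← Finset.prod_filter, ← ENNReal.ofReal_prod_of_nonneg fun _ _ => Real.exp_nonneg _,
      ← Real.exp_sum, Finset.sum_sub_distrib, ← Finset.mul_sum]
    simp [plays, mul_comm]
  simp only [heq] at h1 h2
  exact measure_le_exp_neg (h1.mono (run.hist.le t) le_rfl) h2 c

/-- Concentration of a predictable function of the arm that is drawn. -/
theorem measure_arm_deviation [IsProbabilityMeasure P] [∀ i, IsProbabilityMeasure (D i)]
    (run : BanditRun T D P) {g : ℕ → Ω → Fin m → ℝ}
    (hg : ∀ t < T, ∀ i, Measurable[run.hist t] fun ω => g t ω i)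
    (hg01 : ∀ t ω i, g t ω i ∈ Set.Icc (0 : ℝ) 1) {l : ℝ} (hl : |l| ≤ 1) (c : ℝ) :
    P {ω | c ≤ l * ∑ t ∈ Finset.range T, (g t ω (run.arm t ω) - run.p t ω ⬝ᵥ g t ω) -
      l ^ 2 * T} ≤ ENNReal.ofReal (Real.exp (-c)) := by
  obtain ⟨h1, h2⟩ := run.lintegral_prod_le_one
    (a := fun t ω i => ENNReal.ofReal (Real.exp (l * (g t ω i - run.p t ω ⬝ᵥ g t ω) - l ^ 2)))
    (b := fun _ _ => 1) (fun t ht i => by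
      have hp : Measurable[run.hist t] fun ω => run.p t ω ⬝ᵥ g t ω :=
        Finset.measurable_sum _ fun i _ =>
          ((measurable_pi_apply i).comp (run.p_measurable t ht)).mul (hg t ht i)
      exact ENNReal.measurable_ofReal.comp (Real.measurable_exp.comp
        ((((hg t ht i).sub hp).const_mul l).sub_const _)))
    (fun _ => measurable_const) (fun t ht ω => by
      have hp := run.p_mem t ht ω
      simp only [lintegral_const, measure_univ, mul_one]
      rw [← ENNReal.ofReal_one]
      refine le_trans (le_of_eq ?_) (ENNReal.ofReal_le_ofReal
        (sum_mul_exp_le_one hp (hg01 t ω) hl))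
      rw [ENNReal.ofReal_sum_of_nonneg fun i _ => mul_nonneg (Real.exp_nonneg _) (hp.1 i)]
      exact Finset.sum_congr rfl fun i _ => (ENNReal.ofReal_mul (Real.exp_nonneg _)).symm) T le_rfl
  have heq : ∀ ω, ∏ t ∈ Finset.range T, (ENNReal.ofReal (Real.exp (l * (g t ω (run.arm t ω) -
      run.p t ω ⬝ᵥ g t ω) - l ^ 2)) * 1) = ENNReal.ofReal (Real.exp (l * ∑ t ∈ Finset.range T,
        (g t ω (run.arm t ω) - run.p t ω ⬝ᵥ g t ω) - l ^ 2 * T)) := fun ω => by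
    simp only [mul_one]
    rw [← ENNReal.ofReal_prod_of_nonneg fun _ _ => Real.exp_nonneg _,
      ← Real.exp_sum, Finset.sum_sub_distrib, ← Finset.mul_sum]
    simp [mul_comm]
  simp only [heq] at h1 h2
  exact measure_le_exp_neg (h1.mono (run.hist.le T) le_rfl) h2 c

end BanditRun

/-! ### From exponential bounds to deviations -/

/-- The parameter of the exponential moment that is used for a sum with mean `M`. -/
noncomputable def momentParam (a M : ℝ) : ℝ := if M ≤ a then 1 else Real.sqrt (a / M)

theorem abs_momentParam_le_one {a M : ℝ} (ha : 0 < a) : |momentParam a M| ≤ 1 := by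
  unfold momentParam
  split_ifs with h
  · simp
  · rw [abs_of_nonneg (Real.sqrt_nonneg _), Real.sqrt_le_left zero_le_one, one_pow,
      div_le_one (by linarith)]
    linarith

/-- Dividing by `l` leaves `X < a / l + l M`. The choice `l = √(a / M)` balances the two terms; if
`M ≤ a` this would exceed 1, and `l = 1` gives at most `2a`. -/
theorem le_of_momentParam {a M X : ℝ} (ha : 0 < a)
    (h : momentParam a M * X - momentParam a M ^ 2 * M < a) :
    X ≤ 2 * Real.sqrt (a * M) + 2 * a := by
  have hs := Real.sqrt_nonneg (a * M)
  unfold momentParam at h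
  split_ifs at h with hMa
  · linarith
  · have hM0 : 0 < M := by linarith
    rw [Real.sq_sqrt (by positivity), div_mul_cancel₀ _ hM0.ne'] at h
    have h1 : Real.sqrt (a / M) * Real.sqrt (a * M) = a := by
      rw [← Real.sqrt_mul (by positivity)]
      have : a / M * (a * M) = a ^ 2 := by field_simp
      rw [this, Real.sqrt_sq ha.le]
    have h2 : 0 < Real.sqrt (a / M) := Real.sqrt_pos.2 (by positivity)
    by_contra! hX
    nlinarith [mul_lt_mul_of_pos_left hX h2, mul_pos h2 ha]

theorem le_two_sqrt_of_moment {γ τ X : ℝ} (hγ : 0 < γ) (hτ : γ ≤ τ)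
    (h : min 1 (Real.sqrt (γ / τ)) * X - min 1 (Real.sqrt (γ / τ)) ^ 2 * τ < γ) :
    X ≤ 2 * Real.sqrt (γ * τ) := by
  have hτ0 : 0 < τ := hγ.trans_le hτ
  rw [min_eq_right ((Real.sqrt_le_left zero_le_one).2 (by rw [one_pow]; exact (div_le_one hτ0).2 hτ)), Real.sq_sqrt (by positivity),
    div_mul_cancel₀ _ hτ0.ne'] at h
  have h1 : Real.sqrt (γ / τ) * Real.sqrt (γ * τ) = γ := by
    rw [← Real.sqrt_mul (by positivity)]
    have : γ / τ * (γ * τ) = γ ^ 2 := by field_simp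
    rw [this, Real.sqrt_sq hγ.le]
  have h2 : 0 < Real.sqrt (γ / τ) := Real.sqrt_pos.2 (by positivity)
  by_contra! hX
  nlinarith [mul_lt_mul_of_pos_left hX h2]

/-- The deviation is stated with the unknown mean, but the confidence radius contains the empirical
sum. Solving the quadratic inequality gives `√(nV) ≤ √s + √γ`. The slack in `γ / 16` pays for this
and for the denominator `n + 1`, which adds `V ≤ 1`. -/
theorem abs_sub_succ_mul_le {γ s n V : ℝ} (hγ : 4 ≤ γ) (hs : 0 ≤ s) (hn : 0 ≤ n) (hV0 : 0 ≤ V)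
    (hV1 : V ≤ 1) (h : |s - n * V| ≤ 2 * Real.sqrt (γ / 16 * (n * V)) + 2 * (γ / 16)) :
    |s - (n + 1) * V| ≤ 2 * Real.sqrt (γ * s) + 2 * γ := by
  have hγ0 : 0 ≤ γ := by linarith
  rw [Real.sqrt_mul (by positivity), Real.sqrt_div hγ0, show (16 : ℝ) = 4 ^ 2 by norm_num,
    Real.sqrt_sq (by norm_num)] at h
  rw [Real.sqrt_mul hγ0]
  set G := Real.sqrt γ
  set y := Real.sqrt (n * V) with hy
  set x := Real.sqrt s with hx
  have hG : G ^ 2 = γ := Real.sq_sqrt hγ0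
  have hy2 : y ^ 2 = n * V := Real.sq_sqrt (by positivity)
  have hx2 : x ^ 2 = s := Real.sq_sqrt hs
  have hG0 : 0 ≤ G := Real.sqrt_nonneg _
  have hy0 : 0 ≤ y := Real.sqrt_nonneg _
  have hx0 : 0 ≤ x := Real.sqrt_nonneg _
  rw [← hG, ← hx2, ← hy2] at h
  rw [← hG, ← hx2]
  rw [abs_le] at h
  have hyb : y ≤ x + G := by
    by_contra! hc
    nlinarith
  rw [abs_le]
  constructor <;> nlinarith [mul_le_mul_of_nonneg_left hyb hG0, mul_nonneg hG0 hx0]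

theorem sum_sqrt_le {m : ℕ} (n : Fin m → ℝ) (hn : ∀ i, 0 ≤ n i) :
    ∑ i, Real.sqrt (n i) ≤ Real.sqrt (m * ∑ i, n i) := by
  refine Real.le_sqrt_of_sq_le ?_
  have := sq_sum_le_card_mul_sum_sq (s := Finset.univ) (f := fun i => Real.sqrt (n i))
  simpa [Real.sq_sqrt (hn _)] using this

theorem measure_iUnion_le_card_mul {Ω ι : Type*} [MeasurableSpace Ω] [Fintype ι] {P : Measure Ω}
    {s : ι → Set Ω} {c : ℝ≥0∞} (h : ∀ i, P (s i) ≤ c) : P (⋃ i, s i) ≤ Fintype.card ι * c := by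
  refine (measure_iUnion_fintype_le P s).trans ((Finset.sum_le_sum fun i _ => h i).trans ?_)
  simp

/-- The prefactor counts the bad events and is at most `11 N²` with `N = mTd`. Since `96 = 6 · 16`,
each has probability at most `(δ / N)⁶`; two of these powers cancel `N²`, and `δ / N ≤ 1/2` absorbs
the 11. -/
theorem exp_union_bound {m d T : ℕ} (hm : 1 ≤ m) (hd : 1 ≤ d) (hT : 1 ≤ T) {δ γ : ℝ} (hδ : 0 < δ)
    (hδ1 : δ < 1) (hδ2 : 2 * δ ≤ m * T * d) (hγ : 96 * Real.log (m * T * d / δ) ≤ γ) :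
    (2 * (T + 1) ^ 2 * m * d + 2 * d + 1) * Real.exp (-(γ / 16)) ≤ δ := by
  have hm' : (1 : ℝ) ≤ m := by exact_mod_cast hm
  have hd' : (1 : ℝ) ≤ d := by exact_mod_cast hd
  have hT' : (1 : ℝ) ≤ T := by exact_mod_cast hT
  set N : ℝ := m * T * d with hN
  have hmd : 1 ≤ (m : ℝ) * d := one_le_mul_of_one_le_of_one_le hm' hd'
  have hN1 : 1 ≤ N := by rw [hN]; nlinarith
  have hN0 : 0 < N := by linarith
  have hexp : Real.exp (-(γ / 16)) ≤ (δ / N) ^ 6 := by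
    have h1 : (δ / N) ^ 6 = Real.exp (-(6 * Real.log (N / δ))) := by
      rw [← Real.exp_log (show 0 < (δ / N) ^ 6 by positivity), Real.log_pow,
        ← inv_div N δ, Real.log_inv]
      push_cast
      ring_nf
    rw [h1]
    exact Real.exp_le_exp.2 (by linarith)
  have hcard : 2 * ((T : ℝ) + 1) ^ 2 * m * d + 2 * d + 1 ≤ 11 * N ^ 2 := by
    have h1 : ((T : ℝ) + 1) ^ 2 ≤ 4 * T ^ 2 := by nlinarith
    have h2 : N ^ 2 = T ^ 2 * (m * d) * (m * d) := by rw [hN]; ring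
    have h3 : (T : ℝ) ^ 2 * (m * d) ≤ N ^ 2 := by
      rw [h2]
      exact le_mul_of_one_le_right (by positivity) hmd
    have h4 : (d : ℝ) ≤ N ^ 2 := by
      have : (d : ℝ) ≤ N := by
        rw [hN]
        exact le_mul_of_one_le_left (by positivity) (one_le_mul_of_one_le_of_one_le hm' hT')
      nlinarith
    have h5 : 2 * ((T : ℝ) + 1) ^ 2 * m * d ≤ 8 * (T ^ 2 * (m * d)) := by
      have := mul_le_mul_of_nonneg_right h1 (show 0 ≤ 2 * ((m : ℝ) * d) by positivity)
      linarith
    nlinarith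
  have hu : δ / N ≤ 1 / 2 := by rw [div_le_iff₀ hN0]; linarith
  have hu0 : 0 ≤ δ / N := by positivity
  calc _ ≤ 11 * N ^ 2 * (δ / N) ^ 6 := by gcongr
    _ = 11 * δ ^ 2 * (δ / N) ^ 4 := by field_simp
    _ ≤ 11 * δ ^ 2 * (1 / 2) ^ 4 := by gcongr
    _ ≤ δ := by nlinarith

/-! ### Accurate outcomes and confidence widths -/

namespace BanditRun

variable {m d T : ℕ} {D : Fin m → Measure (Fin d → ℝ)} {Ω : Type*} [mΩ : MeasurableSpace Ω]
  {P : Measure Ω}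

/-- The outcomes for which the means lie within their confidence bounds, and the observed vectors
are close, on average, to the estimated points. -/
structure Accurate (γ : ℝ) (run : BanditRun T D P) (ω : Ω) : Prop where
  obs_mem : ∀ t < T, run.obs t ω ∈ unitCube d
  lcb_le : ∀ t < T, ∀ j i, lcb γ run t ω j i ≤ meanMatrix D j i
  le_ucb : ∀ t < T, ∀ j i, meanMatrix D j i ≤ ucb γ run t ω j i
  close : ∀ (θ : ℕ → Ω → Fin d → ℝ) (j : Fin d),
    |∑ t ∈ Finset.range T, (run.obs t ω j - estPoint γ run θ t ω j)| ≤ 35 * Real.sqrt (γ * m * T)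

theorem sum_plays (run : BanditRun T D P) (t : ℕ) (ω : Ω) :
    ∑ i, (run.plays t ω i : ℝ) = t := by
  have := Finset.card_eq_sum_card_fiberwise (s := Finset.range t) (t := Finset.univ)
    (f := fun s => run.arm s ω) (fun _ _ => Finset.mem_coe.2 (Finset.mem_univ _))
  rw [Finset.card_range] at this
  rw [← Nat.cast_sum]
  exact_mod_cast this.symm

theorem plays_succ (run : BanditRun T D P) (t : ℕ) (ω : Ω) (i : Fin m) :
    run.plays (t + 1) ω i = run.plays t ω i + if run.arm t ω = i then 1 else 0 := by
  simp only [plays, Finset.range_add_one, Finset.filter_insert]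
  split_ifs with h
  · rw [Finset.card_insert_of_notMem (by simp)]
  · rw [add_zero]

theorem plays_le (run : BanditRun T D P) (t : ℕ) (ω : Ω) (i : Fin m) : run.plays t ω i ≤ t :=
  (Finset.card_filter_le _ _).trans (by simp)

theorem measurable_plays (run : BanditRun T D P) {t : ℕ} (ht : t ≤ T) (i : Fin m) :
    Measurable[run.hist t] fun ω => run.plays t ω i := by
  simp only [plays, Finset.card_filter]
  refine Finset.measurable_sum _ fun s hs => ?_
  have hs' := Finset.mem_range.1 hs
  refine Measurable.ite ?_ measurable_const measurable_const
  exact run.hist.mono (show s + 1 ≤ t by omega) _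
    (run.arm_measurable s (by omega) (measurableSet_singleton i))

/-- A bound on the width of the confidence intervals. -/
noncomputable def width (γ : ℝ) (run : BanditRun T D P) (t : ℕ) (ω : Ω) (i : Fin m) : ℝ :=
  min 1 (Real.sqrt (γ / (run.plays t ω i + 1)))

theorem width_mem (γ : ℝ) (run : BanditRun T D P) (t : ℕ) (ω : Ω) (i : Fin m) :
    width γ run t ω i ∈ Set.Icc (0 : ℝ) 1 :=
  ⟨le_min zero_le_one (Real.sqrt_nonneg _), min_le_left _ _⟩

/-- Playing an arm after `k` earlier plays costs at most `√γ / √(k + 1) ≤ 2 √γ (√(k + 1) - √k)`,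
which telescopes for each arm. -/
theorem sum_width_le {γ : ℝ} (hγ : 0 ≤ γ) (run : BanditRun T D P) (ω : Ω) (t : ℕ) :
    ∑ s ∈ Finset.range t, width γ run s ω (run.arm s ω) ≤
      2 * Real.sqrt γ * ∑ i, Real.sqrt (run.plays t ω i) := by
  induction t with
  | zero => simp [plays]
  | succ t ih =>
    rw [Finset.sum_range_succ]
    set k := run.arm t ω with hk
    have h1 : ∑ i, Real.sqrt (run.plays (t + 1) ω i) = ∑ i, Real.sqrt (run.plays t ω i) +
        (Real.sqrt (run.plays t ω k + 1) - Real.sqrt (run.plays t ω k)) := by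
      rw [← sub_eq_iff_eq_add', ← Finset.sum_sub_distrib, Finset.sum_eq_single k]
      · simp [plays_succ, ← hk]
      · intro i _ hi
        simp [plays_succ, ← hk, Ne.symm hi]
      · simp
    have h2 : width γ run t ω k ≤ 2 * Real.sqrt γ *
        (Real.sqrt (run.plays t ω k + 1) - Real.sqrt (run.plays t ω k)) := by
      refine (min_le_right _ _).trans ?_
      rw [Real.sqrt_div hγ]
      set x := Real.sqrt (run.plays t ω k + 1)
      set y := Real.sqrt (run.plays t ω k)
      have hx : x ^ 2 = run.plays t ω k + 1 := Real.sq_sqrt (by positivity)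
      have hy : y ^ 2 = run.plays t ω k := Real.sq_sqrt (by positivity)
      have hx0 : 0 < x := Real.sqrt_pos.2 (by positivity)
      rw [div_le_iff₀ hx0, mul_assoc, mul_comm 2, mul_assoc]
      refine le_mul_of_one_le_right (Real.sqrt_nonneg _) ?_
      nlinarith [sq_nonneg (x - y)]
    rw [h1, mul_add]
    linarith

theorem empSum_mem (run : BanditRun T D P) {ω : Ω} (hobs : ∀ t < T, run.obs t ω ∈ unitCube d)
    {t : ℕ} (ht : t ≤ T) (j : Fin d) (i : Fin m) :
    ∑ s ∈ (Finset.range t).filter (fun s => run.arm s ω = i), run.obs s ω j ∈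
      Set.Icc (0 : ℝ) (run.plays t ω i) := by
  have h : ∀ s ∈ (Finset.range t).filter (fun s => run.arm s ω = i),
      run.obs s ω ∈ unitCube d := fun s hs => by
    have := Finset.mem_range.1 (Finset.mem_filter.1 hs).1
    exact hobs s (by omega)
  refine ⟨Finset.sum_nonneg fun s hs => (h s hs).1 j, ?_⟩
  calc _ ≤ ∑ s ∈ (Finset.range t).filter (fun s => run.arm s ω = i), (1 : ℝ) :=
        Finset.sum_le_sum fun s hs => (h s hs).2 j
    _ = _ := by simp [plays]

theorem meanMatrix_mem [∀ i, IsProbabilityMeasure (D i)]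
    (hD : ∀ i, ∀ᵐ x ∂(D i), x ∈ unitCube d) (j : Fin d) (i : Fin m) :
    meanMatrix D j i ∈ Set.Icc (0 : ℝ) 1 := by
  refine (convex_Icc (0 : ℝ) 1).integral_mem isClosed_Icc ?_ ?_
  · filter_upwards [hD i] with x hx using ⟨hx.1 j, hx.2 j⟩
  · refine Integrable.of_bound (measurable_pi_apply j).aestronglyMeasurable 1 ?_
    filter_upwards [hD i] with x hx
    rw [Real.norm_eq_abs, abs_le]
    exact ⟨by linarith [show (0 : ℝ) ≤ x j from hx.1 j], hx.2 j⟩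

/-! ### Closeness of observations and estimates on a fixed outcome -/

section Pathwise

variable {γ : ℝ} {run : BanditRun T D P} {ω : Ω}

theorem rad_eq (t : ℕ) (j : Fin d) (i : Fin m) :
    rad γ run t ω j i = (Real.sqrt (γ * ∑ s ∈ (Finset.range t).filter (fun s => run.arm s ω = i),
      run.obs s ω j) + γ) / (run.plays t ω i + 1) := by
  rw [rad, empMean, add_div]
  congr 1
  rw [← mul_div_assoc, div_div, ← sq, Real.sqrt_div' _ (by positivity),
    Real.sqrt_sq (by positivity)]

theorem abs_empMean_sub_le (hγ : 4 ≤ γ) (hobs : ∀ t < T, run.obs t ω ∈ unitCube d) {t : ℕ}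
    (ht : t ≤ T) {j : Fin d} {i : Fin m} (hV : meanMatrix D j i ∈ Set.Icc (0 : ℝ) 1)
    (h : |∑ s ∈ (Finset.range t).filter (fun s => run.arm s ω = i), run.obs s ω j -
        run.plays t ω i * meanMatrix D j i| ≤
      2 * Real.sqrt (γ / 16 * (run.plays t ω i * meanMatrix D j i)) + 2 * (γ / 16)) :
    |run.empMean t ω j i - meanMatrix D j i| ≤ 2 * rad γ run t ω j i := by
  have h1 := abs_sub_succ_mul_le hγ (run.empSum_mem hobs ht j i).1 (by positivity) hV.1 hV.2 h
  rw [rad_eq, empMean]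
  have hn : (0 : ℝ) < run.plays t ω i + 1 := by positivity
  rw [div_sub' hn.ne', abs_div, abs_of_pos hn, ← mul_div_assoc, div_le_div_iff_of_pos_right hn]
  linarith

theorem rad_nonneg (hγ : 0 ≤ γ) (t : ℕ) (j : Fin d) (i : Fin m) : 0 ≤ rad γ run t ω j i :=
  add_nonneg (Real.sqrt_nonneg _) (by positivity)

theorem lcb_le_of_abs_le {t : ℕ} {j : Fin d} {i : Fin m}
    (hV : meanMatrix D j i ∈ Set.Icc (0 : ℝ) 1)
    (h : |run.empMean t ω j i - meanMatrix D j i| ≤ 2 * rad γ run t ω j i) :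
    lcb γ run t ω j i ≤ meanMatrix D j i :=
  max_le hV.1 (by linarith [(abs_le.1 h).2])

theorem le_ucb_of_abs_le {t : ℕ} {j : Fin d} {i : Fin m}
    (hV : meanMatrix D j i ∈ Set.Icc (0 : ℝ) 1)
    (h : |run.empMean t ω j i - meanMatrix D j i| ≤ 2 * rad γ run t ω j i) :
    meanMatrix D j i ≤ ucb γ run t ω j i :=
  le_min hV.2 (by linarith [(abs_le.1 h).1])

theorem vertex_mem {t : ℕ} {j : Fin d} {i : Fin m} (hV : meanMatrix D j i ∈ Set.Icc (0 : ℝ) 1)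
    (hl : lcb γ run t ω j i ≤ meanMatrix D j i) (hu : meanMatrix D j i ≤ ucb γ run t ω j i)
    (θ : Fin d → ℝ) : vertex γ run t ω θ j i ∈ Set.Icc (0 : ℝ) 1 := by
  unfold vertex
  split_ifs
  · exact ⟨hV.1.trans hu, min_le_left _ _⟩
  · exact ⟨le_max_left _ _, hl.trans hV.2⟩

/-- The mean and the vertex both lie within `2 rad` of the empirical mean, hence within `4 rad` of
each other, and `rad ≤ 2 √(γ / (k + 1))` when that root is at most 1; otherwise the distance is
trivially at most 1. The bound depends on the play counts only, so it is predictable and uniform in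
`θ`. -/
theorem abs_mean_sub_vertex_le (hγ : 0 ≤ γ) (hobs : ∀ t < T, run.obs t ω ∈ unitCube d) {t : ℕ}
    (ht : t ≤ T) {j : Fin d} {i : Fin m} (hV : meanMatrix D j i ∈ Set.Icc (0 : ℝ) 1)
    (h : |run.empMean t ω j i - meanMatrix D j i| ≤ 2 * rad γ run t ω j i) (θ : Fin d → ℝ) :
    |meanMatrix D j i - vertex γ run t ω θ j i| ≤ 8 * width γ run t ω i := by
  have hl := lcb_le_of_abs_le hV h
  have hu := le_ucb_of_abs_le hV h
  have hmem := vertex_mem hV hl hu θ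
  have h4 : |meanMatrix D j i - vertex γ run t ω θ j i| ≤ 4 * rad γ run t ω j i := by
    rw [abs_le] at h ⊢
    have hr := rad_nonneg (run := run) (ω := ω) hγ t j i
    unfold vertex
    split_ifs
    · have := min_le_right 1 (run.empMean t ω j i + 2 * rad γ run t ω j i)
      unfold ucb at *
      constructor <;> linarith
    · have := le_max_right 0 (run.empMean t ω j i - 2 * rad γ run t ω j i)
      unfold lcb at *
      constructor <;> linarith
  have h1 : |meanMatrix D j i - vertex γ run t ω θ j i| ≤ 1 :=
    abs_le.2 ⟨by linarith [hV.1, hmem.2], by linarith [hV.2, hmem.1]⟩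
  unfold width
  rcases le_total 1 (Real.sqrt (γ / (run.plays t ω i + 1))) with hc | hc
  · rw [min_eq_left hc]; linarith
  · rw [min_eq_right hc]
    have hn : (0 : ℝ) < run.plays t ω i + 1 := by positivity
    have h2 : γ / (run.plays t ω i + 1) ≤ Real.sqrt (γ / (run.plays t ω i + 1)) := by
      refine Real.le_sqrt_of_sq_le ?_
      have h3 := (Real.sqrt_le_left zero_le_one).1 hc
      have h5 : 0 ≤ γ / (run.plays t ω i + 1) := by positivity
      nlinarith
    have h3 : Real.sqrt (γ * run.empMean t ω j i / (run.plays t ω i + 1)) ≤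
        Real.sqrt (γ / (run.plays t ω i + 1)) := by
      refine Real.sqrt_le_sqrt (div_le_div_of_nonneg_right ?_ hn.le)
      refine mul_le_of_le_one_right hγ ?_
      rw [empMean, div_le_one hn]
      linarith [(run.empSum_mem hobs ht j i).2]
    unfold rad at h4
    linarith

theorem sum_obs_sub_mean (t : ℕ) (j : Fin d) :
    ∑ s ∈ Finset.range t, (run.obs s ω j - meanMatrix D j (run.arm s ω)) =
      ∑ i, (∑ s ∈ (Finset.range t).filter (fun s => run.arm s ω = i), run.obs s ω j -
        run.plays t ω i * meanMatrix D j i) := by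
  rw [← Finset.sum_fiberwise (Finset.range t) (fun s => run.arm s ω)]
  refine Finset.sum_congr rfl fun i _ => ?_
  rw [Finset.sum_sub_distrib]
  congr 1
  rw [Finset.sum_congr rfl fun s hs => by rw [(Finset.mem_filter.1 hs).2]]
  simp [plays]

theorem dotProduct_mem_Icc {p g : Fin m → ℝ} (hp : p ∈ stdSimplex ℝ (Fin m))
    (hg : ∀ i, g i ∈ Set.Icc (0 : ℝ) 1) : g ⬝ᵥ p ∈ Set.Icc (0 : ℝ) 1 := by
  refine ⟨Finset.sum_nonneg fun i _ => mul_nonneg (hg i).1 (hp.1 i), ?_⟩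
  rw [← hp.2]
  exact Finset.sum_le_sum fun i _ => mul_le_of_le_one_left (hp.1 i) (hg i).2

theorem accurate_of_deviations (hγ : 4 ≤ γ) (hT : 1 ≤ T)
    (hV : ∀ j i, meanMatrix D j i ∈ Set.Icc (0 : ℝ) 1)
    (hobs : ∀ t < T, run.obs t ω ∈ unitCube d)
    (h1 : ∀ t ≤ T, ∀ i j, |∑ s ∈ (Finset.range t).filter (fun s => run.arm s ω = i),
        run.obs s ω j - run.plays t ω i * meanMatrix D j i| ≤
      2 * Real.sqrt (γ / 16 * (run.plays t ω i * meanMatrix D j i)) + 2 * (γ / 16))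
    (h2 : γ ≤ T → ∀ j, |∑ t ∈ Finset.range T, (meanMatrix D j (run.arm t ω) -
      run.p t ω ⬝ᵥ meanMatrix D j)| ≤ 2 * Real.sqrt (γ * T))
    (h3 : γ ≤ T → -∑ t ∈ Finset.range T, (width γ run t ω (run.arm t ω) -
      run.p t ω ⬝ᵥ width γ run t ω) ≤ 2 * Real.sqrt (γ * T)) : Accurate γ run ω := by
  have hγ0 : 0 ≤ γ := by linarith
  have hrad : ∀ t ≤ T, ∀ j i, |run.empMean t ω j i - meanMatrix D j i| ≤ 2 * rad γ run t ω j i :=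
    fun t ht j i => abs_empMean_sub_le hγ hobs ht (hV j i) (h1 t ht i j)
  refine ⟨hobs, fun t ht j i => lcb_le_of_abs_le (hV j i) (hrad t ht.le j i),
    fun t ht j i => le_ucb_of_abs_le (hV j i) (hrad t ht.le j i), fun θ j => ?_⟩
  have hm0 : 1 ≤ (m : ℝ) := by
    have : 0 < m := Fin.pos (run.arm 0 ω)
    exact_mod_cast this
  -- For `T < γ m` the trivial bound `T` is below `√(γ m T)`. Otherwise `γ ≤ T`, as the optimal
  -- exponent `√(γ / T) ≤ 1` requires.
  rcases lt_or_ge (T : ℝ) (γ * m) with hc | hc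
  · have h4 : ∀ t ∈ Finset.range T, |run.obs t ω j - estPoint γ run θ t ω j| ≤ 1 := by
      intro t ht
      have ht' := Finset.mem_range.1 ht
      have h5 : estPoint γ run θ t ω j ∈ Set.Icc (0 : ℝ) 1 :=
        dotProduct_mem_Icc (run.p_mem t ht' ω) fun i => vertex_mem (hV j i)
          (lcb_le_of_abs_le (hV j i) (hrad t ht'.le j i))
          (le_ucb_of_abs_le (hV j i) (hrad t ht'.le j i)) _
      have h6 : (0 : ℝ) ≤ run.obs t ω j := (hobs t ht').1 j
      have h7 : run.obs t ω j ≤ (1 : ℝ) := (hobs t ht').2 j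
      exact abs_le.2 ⟨by linarith [h5.2], by linarith [h5.1]⟩
    refine (Finset.abs_sum_le_sum_abs _ _).trans ((Finset.sum_le_sum h4).trans ?_)
    have h8 : (T : ℝ) ≤ Real.sqrt (γ * m * T) := by
      refine Real.le_sqrt_of_sq_le ?_
      rw [sq]
      exact mul_le_mul_of_nonneg_right hc.le (Nat.cast_nonneg _)
    simp only [Finset.sum_const, Finset.card_range, nsmul_eq_mul, mul_one]
    linarith [Real.sqrt_nonneg (γ * m * T)]
  · have hγT : γ ≤ T := (le_mul_of_one_le_right hγ0 hm0).trans hc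
    set E := Real.sqrt (γ * m * T) with hE
    have hE1 : Real.sqrt (γ * T) ≤ E := Real.sqrt_le_sqrt (by
      have : 0 ≤ γ * T := by positivity
      nlinarith)
    have hE2 : γ * m ≤ E := by
      refine Real.le_sqrt_of_sq_le ?_
      rw [sq]
      exact mul_le_mul_of_nonneg_left hc (by positivity)
    have hE3 : Real.sqrt γ * ∑ i, Real.sqrt (run.plays T ω i) ≤ E := by
      refine (mul_le_mul_of_nonneg_left (sum_sqrt_le _ fun i => by positivity)
        (Real.sqrt_nonneg _)).trans (le_of_eq ?_)
      rw [sum_plays, ← Real.sqrt_mul hγ0, ← mul_assoc]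
    -- Observation noise: the arms contribute `√(γ k_i) / 2 + γ / 8`, and Cauchy–Schwarz gives `Σ
    -- √k_i ≤ √(m T)`.
    have hA : |∑ t ∈ Finset.range T, (run.obs t ω j - meanMatrix D j (run.arm t ω))| ≤ E := by
      rw [sum_obs_sub_mean]
      refine (Finset.abs_sum_le_sum_abs _ _).trans ?_
      have h4 : ∀ i, |∑ s ∈ (Finset.range T).filter (fun s => run.arm s ω = i),
          run.obs s ω j - run.plays T ω i * meanMatrix D j i| ≤
          1 / 2 * (Real.sqrt γ * Real.sqrt (run.plays T ω i)) + γ / 8 := fun i => by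
        refine (h1 T le_rfl i j).trans ?_
        have h5 : Real.sqrt (γ / 16 * (run.plays T ω i * meanMatrix D j i)) ≤
            Real.sqrt γ / 4 * Real.sqrt (run.plays T ω i) := by
          rw [Real.sqrt_mul (by positivity), Real.sqrt_div hγ0,
            show (16 : ℝ) = 4 ^ 2 by norm_num, Real.sqrt_sq (by norm_num)]
          refine mul_le_mul_of_nonneg_left (Real.sqrt_le_sqrt ?_) (by positivity)
          exact mul_le_of_le_one_right (by positivity) (hV j i).2
        linarith
      refine (Finset.sum_le_sum fun i _ => h4 i).trans ?_
      rw [Finset.sum_add_distrib, ← Finset.mul_sum, ← Finset.mul_sum]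
      simp only [Finset.sum_const, Finset.card_univ, Fintype.card_fin, nsmul_eq_mul]
      linarith [Real.sqrt_nonneg (γ * m * T)]
    have hB := h2 hγT j
    -- Estimation error: 8 times the expected widths. These exceed the widths of the drawn arms, at
    -- most `2E` in total, by at most `2E`; so `8 · 4 = 32`. With `1` from `hA` and `2` from `hB`
    -- the total is 35.
    have hC : |∑ t ∈ Finset.range T, (run.p t ω ⬝ᵥ meanMatrix D j - estPoint γ run θ t ω j)| ≤
        32 * E := by
      have h4 : ∀ t ∈ Finset.range T,
          |run.p t ω ⬝ᵥ meanMatrix D j - estPoint γ run θ t ω j| ≤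
          8 * (run.p t ω ⬝ᵥ width γ run t ω) := fun t ht => by
        have ht' := Finset.mem_range.1 ht
        have hp := run.p_mem t ht' ω
        simp only [estPoint, mulVec, dotProduct]
        rw [← Finset.sum_sub_distrib, Finset.mul_sum]
        refine (Finset.abs_sum_le_sum_abs _ _).trans (Finset.sum_le_sum fun i _ => ?_)
        rw [mul_comm (vertex _ _ _ _ _ _ _), ← mul_sub, abs_mul, abs_of_nonneg (hp.1 i)]
        have := mul_le_mul_of_nonneg_left (abs_mean_sub_vertex_le hγ0 hobs ht'.le (hV j i)
          (hrad t ht'.le j i) (θ t ω)) (hp.1 i)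
        linarith
      refine (Finset.abs_sum_le_sum_abs _ _).trans ((Finset.sum_le_sum h4).trans ?_)
      have h5 := h3 hγT
      have h6 := sum_width_le hγ0 run ω T
      rw [Finset.sum_sub_distrib] at h5
      rw [← Finset.mul_sum]
      linarith
    have hsplit : ∑ t ∈ Finset.range T, (run.obs t ω j - estPoint γ run θ t ω j) =
        ∑ t ∈ Finset.range T, (run.obs t ω j - meanMatrix D j (run.arm t ω)) +
        ∑ t ∈ Finset.range T, (meanMatrix D j (run.arm t ω) - run.p t ω ⬝ᵥ meanMatrix D j) +
        ∑ t ∈ Finset.range T, (run.p t ω ⬝ᵥ meanMatrix D j - estPoint γ run θ t ω j) := by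
      rw [← Finset.sum_add_distrib, ← Finset.sum_add_distrib]
      exact Finset.sum_congr rfl fun t _ => by ring
    rw [hsplit]
    refine (abs_add_three _ _ _).trans ?_
    linarith

end Pathwise

/-! ### The probability of inaccurate outcomes -/

theorem four_le_of_log_le {m d T : ℕ} {δ γ : ℝ} (hδ : 0 < δ) (hδ2 : 2 * δ ≤ m * T * d)
    (hγ : 96 * Real.log (m * T * d / δ) ≤ γ) : 4 ≤ γ := by
  have h1 : (2 : ℝ) ≤ m * T * d / δ := by rwa [le_div_iff₀ hδ]
  have h2 := Real.log_le_log (by norm_num) h1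
  have := Real.log_two_gt_d9
  linarith

theorem measure_not_accurate_le [IsProbabilityMeasure P] [∀ i, IsProbabilityMeasure (D i)]
    (run : BanditRun T D P) (hD : ∀ i, ∀ᵐ x ∂(D i), x ∈ unitCube d)
    (hm : 1 ≤ m) (hd : 1 ≤ d) (hT : 1 ≤ T) {δ γ : ℝ} (hδ : 0 < δ)
    (hδ1 : δ < 1) (hδ2 : 2 * δ ≤ m * T * d) (hγ : 96 * Real.log (m * T * d / δ) ≤ γ) :
    P {ω | ¬ Accurate γ run ω} ≤ ENNReal.ofReal δ := by
  have hγ4 : 4 ≤ γ := four_le_of_log_le hδ hδ2 hγ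
  have hγ0 : 0 < γ := by linarith
  have ha : 0 < γ / 16 := by positivity
  have hV := meanMatrix_mem (D := D) hD
  let sgn : Bool → ℝ := fun b => if b then 1 else -1
  have hsgn : ∀ b l, |l| ≤ 1 → |sgn b * l| ≤ 1 := fun b l hl => by
    cases b <;> simpa [sgn] using hl
  let l₁ : Fin (T + 1) → Fin m → Fin d → ℝ := fun n i j =>
    momentParam (γ / 16) (n * meanMatrix D j i)
  let l₂ : ℝ := min 1 (Real.sqrt (γ / T))
  have hl₂ : |l₂| ≤ 1 := by
    rw [abs_of_nonneg (le_min zero_le_one (Real.sqrt_nonneg _))]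
    exact min_le_left _ _
  -- The best exponent depends on the random play count, whereas the exponential bound needs a fixed
  -- one. The second index guesses this count, and the union bound runs over all guesses.
  let bad₁ : Fin (T + 1) × Fin (T + 1) × Fin m × Fin d × Bool → Set Ω := fun x =>
    {ω | γ / 16 ≤ sgn x.2.2.2.2 * l₁ x.2.1 x.2.2.1 x.2.2.2.1 *
      ∑ s ∈ (Finset.range x.1).filter (fun s => run.arm s ω = x.2.2.1), run.obs s ω x.2.2.2.1 -
      (sgn x.2.2.2.2 * l₁ x.2.1 x.2.2.1 x.2.2.2.1 +
        (sgn x.2.2.2.2 * l₁ x.2.1 x.2.2.1 x.2.2.2.1) ^ 2) *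
        meanMatrix D x.2.2.2.1 x.2.2.1 * run.plays x.1 ω x.2.2.1}
  let bad₂ : Fin d × Bool → Set Ω := fun x =>
    {ω | γ ≤ sgn x.2 * l₂ * ∑ t ∈ Finset.range T, (meanMatrix D x.1 (run.arm t ω) -
      run.p t ω ⬝ᵥ meanMatrix D x.1) - (sgn x.2 * l₂) ^ 2 * T}
  let bad₃ : Set Ω := {ω | γ ≤ -l₂ * ∑ t ∈ Finset.range T, (width γ run t ω (run.arm t ω) -
      run.p t ω ⬝ᵥ width γ run t ω) - (-l₂) ^ 2 * T}
  have hb₁ : P (⋃ x, bad₁ x) ≤ _ := measure_iUnion_le_card_mul fun x =>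
    run.measure_obs_deviation hD (Nat.lt_succ_iff.1 x.1.2) x.2.2.1 x.2.2.2.1
      (hsgn _ _ (abs_momentParam_le_one ha)) (γ / 16)
  have hexp : ENNReal.ofReal (Real.exp (-γ)) ≤ ENNReal.ofReal (Real.exp (-(γ / 16))) :=
    ENNReal.ofReal_le_ofReal (Real.exp_le_exp.2 (by linarith))
  have hb₂ : P (⋃ x, bad₂ x) ≤ _ := measure_iUnion_le_card_mul fun x =>
    (run.measure_arm_deviation (g := fun _ _ => meanMatrix D x.1) (fun _ _ _ => measurable_const)
      (fun _ _ i => hV x.1 i) (hsgn x.2 _ hl₂) γ).trans hexp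
  have hb₃ : P bad₃ ≤ ENNReal.ofReal (Real.exp (-(γ / 16))) :=
    (run.measure_arm_deviation (g := fun t ω => width γ run t ω) (fun t ht i => by
      have h := run.measurable_plays ht.le i
      have hc : Measurable fun n : ℕ => min 1 (Real.sqrt (γ / ((n : ℝ) + 1))) :=
        measurable_from_top
      exact hc.comp h)
      (fun t ω i => width_mem γ run t ω i) (by rwa [abs_neg]) γ).trans hexp
  have hsub : {ω | ¬ Accurate γ run ω} ⊆ {ω | ¬ ∀ t < T, run.obs t ω ∈ unitCube d} ∪
      ((⋃ x, bad₁ x) ∪ ((⋃ x, bad₂ x) ∪ bad₃)) := by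
    intro ω hω
    by_contra hc
    simp only [Set.mem_union, not_or, Set.mem_iUnion, not_exists] at hc
    obtain ⟨hobs, hc₁, hc₂, hc₃⟩ := hc
    simp only [bad₁, bad₂, bad₃, Set.mem_ofPred_eq, not_le] at hc₁ hc₂ hc₃
    refine hω (accurate_of_deviations hγ4 hT hV (not_not.1 hobs) (fun t ht i j => ?_)
      (fun hγT j => ?_) (fun hγT => ?_))
    -- The guess is now the actual count, for which `momentParam` is tuned.
    · have h := fun b => hc₁ (⟨t, by omega⟩,
        ⟨run.plays t ω i, Nat.lt_succ_iff.2 ((run.plays_le t ω i).trans ht)⟩, i, j, b)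
      have ht := h true
      have hf := h false
      simp only [sgn, l₁, if_true, Bool.false_eq_true, if_false] at ht hf
      rw [abs_le']
      constructor
      · refine le_of_momentParam ha ?_
        linarith
      · refine le_of_momentParam ha ?_
        linarith
    · have h := fun b => hc₂ (j, b)
      have ht := h true
      have hf := h false
      simp only [sgn, l₂, if_true, Bool.false_eq_true, if_false] at ht hf
      rw [abs_le']
      constructor
      · refine le_two_sqrt_of_moment hγ0 hγT ?_
        linarith
      · refine le_two_sqrt_of_moment hγ0 hγT ?_
        linarith
    · refine le_two_sqrt_of_moment hγ0 hγT ?_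
      have h := hc₃
      simp only [l₂] at h
      linarith
  have h0 : P {ω | ¬ ∀ t < T, run.obs t ω ∈ unitCube d} = 0 := run.ae_obs_mem hD
  calc P {ω | ¬ Accurate γ run ω} ≤ _ := measure_mono hsub
    _ ≤ 0 + (_ + (_ + ENNReal.ofReal (Real.exp (-(γ / 16))))) :=
      (measure_union_le _ _).trans (add_le_add h0.le ((measure_union_le _ _).trans
        (add_le_add hb₁ ((measure_union_le _ _).trans (add_le_add hb₂ hb₃)))))
    _ = ENNReal.ofReal ((2 * (T + 1) ^ 2 * m * d + 2 * d + 1) * Real.exp (-(γ / 16))) := by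
      rw [ENNReal.ofReal_mul (by positivity)]
      have : (2 * ((T : ℝ) + 1) ^ 2 * m * d + 2 * d + 1) =
          ((2 * (T + 1) ^ 2 * m * d + 2 * d + 1 : ℕ) : ℝ) := by push_cast; ring
      rw [this, ENNReal.ofReal_natCast]
      simp only [Fintype.card_prod, Fintype.card_fin, Fintype.card_bool]
      push_cast
      ring
    _ ≤ ENNReal.ofReal δ := ENNReal.ofReal_le_ofReal (exp_union_bound hm hd hT hδ hδ1 hδ2 hγ)

end BanditRun

/-! ### Dynamic policies against static distributions -/

theorem continuousOn_of_lipschitz {d : ℕ} {q : ℝ≥0∞} (hq : 1 ≤ q) {A : Set (Fin d → ℝ)}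
    {f : (Fin d → ℝ) → ℝ} {L : ℝ} (hf : ∀ x ∈ A, ∀ y ∈ A, f x - f y ≤ L * lqNorm q (x - y)) :
    ContinuousOn f A := by
  intro x hx
  rw [ContinuousWithinAt, tendsto_iff_dist_tendsto_zero]
  have h1 : Tendsto (fun y => L * lqNorm q (y - x)) (𝓝[A] x) (𝓝 0) := by
    have hc : Continuous fun y => L * lqNorm q (y - x) :=
      ((continuous_lqNorm hq).comp (continuous_id.sub continuous_const)).const_mul L |>.congr
        fun _ => rfl
    have h2 := (hc.tendsto x).mono_left (nhdsWithin_le_nhds (s := A))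
    simpa [lqNorm_zero hq] using h2
  refine squeeze_zero' (Eventually.of_forall fun _ => dist_nonneg) ?_ h1
  filter_upwards [self_mem_nhdsWithin] with y hy
  rw [Real.dist_eq, abs_le']
  refine ⟨hf y hy x hx, ?_⟩
  have := hf x hx y hy
  rw [← neg_sub y x, lqNorm_neg hq] at this
  linarith

theorem unitCube_average_mem {d : ℕ} {n : ℕ} (hn : 1 ≤ n) {x : ℕ → Fin d → ℝ}
    (hx : ∀ t < n, x t ∈ unitCube d) :
    (n : ℝ)⁻¹ • ∑ t ∈ Finset.range n, x t ∈ unitCube d := by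
  rw [Finset.smul_sum]
  refine (convex_unitCube d).sum_mem (fun _ _ => by positivity) ?_
    fun t ht => hx t (Finset.mem_range.1 ht)
  have : (n : ℝ) ≠ 0 := by positivity
  simp [this]

namespace BanditRun

variable {m d T : ℕ} {D : Fin m → Measure (Fin d → ℝ)} {Ω : Type*} [mΩ : MeasurableSpace Ω]
  {P : Measure Ω}

theorem map_obs [IsProbabilityMeasure P] [∀ i, IsProbabilityMeasure (D i)]
    (run : BanditRun T D P) {t : ℕ} (ht : t < T) :
    P.map (run.obs t) = ∑ i, P (run.arm t ⁻¹' {i}) • D i := by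
  have hlaw : ∀ i B, MeasurableSet B → P (run.arm t ⁻¹' {i} ∩ run.obs t ⁻¹' B) =
      P (run.arm t ⁻¹' {i}) * D i B := fun i B hB => by
    have h1 := run.law t ht Set.univ MeasurableSet.univ i B hB
    have h2 := run.law t ht Set.univ MeasurableSet.univ i Set.univ MeasurableSet.univ
    rw [measure_univ, mul_one, Set.preimage_univ, Set.inter_univ, Set.univ_inter] at h2
    rwa [Set.univ_inter, ← h2] at h1
  ext B hB
  rw [Measure.map_apply (run.measurable_obs ht) hB, Measure.finsetSum_apply]
  simp only [Measure.smul_apply, smul_eq_mul, ← hlaw _ B hB]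
  rw [← lintegral_indicator_one (run.measurable_obs ht hB), run.lintegral_eq_sum_arm ht]
  refine Finset.sum_congr rfl fun i _ => ?_
  rw [lintegral_indicator_one (run.measurable_obs ht hB),
    Measure.restrict_apply (run.measurable_obs ht hB), Set.inter_comm]

theorem integrable_eval_of_mem [∀ i, IsProbabilityMeasure (D i)]
    (hD : ∀ i, ∀ᵐ x ∂(D i), x ∈ unitCube d) (i : Fin m) (j : Fin d) :
    Integrable (fun x : Fin d → ℝ => x j) (D i) := by
  refine Integrable.of_bound (measurable_pi_apply j).aestronglyMeasurable 1 ?_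
  filter_upwards [hD i] with x hx
  rw [Real.norm_eq_abs, abs_le]
  exact ⟨by linarith [show (0 : ℝ) ≤ x j from hx.1 j], hx.2 j⟩

/-- The expected average observation is the mean of a static distribution on the arms. -/
theorem exists_integral_obsAvg [IsProbabilityMeasure P] [∀ i, IsProbabilityMeasure (D i)]
    (run : BanditRun T D P) (hD : ∀ i, ∀ᵐ x ∂(D i), x ∈ unitCube d) (hT : 1 ≤ T) :
    Integrable run.obsAvg P ∧
      ∃ p ∈ stdSimplex ℝ (Fin m), ∫ ω, run.obsAvg ω ∂P = meanMatrix D *ᵥ p := by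
  have hobs := run.ae_obs_mem hD
  have hint : ∀ t < T, Integrable (run.obs t) P := fun t ht => by
    refine Integrable.of_bound (run.measurable_obs ht).aestronglyMeasurable 1 ?_
    filter_upwards [hobs] with ω hω
    refine (pi_norm_le_iff_of_nonneg zero_le_one).2 fun j => ?_
    have := hω t ht
    rw [Real.norm_eq_abs, abs_le]
    exact ⟨by linarith [show (0 : ℝ) ≤ run.obs t ω j from this.1 j], this.2 j⟩
  have hint' : Integrable run.obsAvg P :=
    (integrable_finsetSum _ fun t ht => hint t (Finset.mem_range.1 ht)).smul (T : ℝ)⁻¹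
  set c : ℕ → Fin m → ℝ := fun t i => P.real (run.arm t ⁻¹' {i}) with hc
  have hc1 : ∀ t < T, ∑ i, c t i = 1 := fun t ht => by
    have h1 := run.lintegral_eq_sum_arm ht fun _ => 1
    simp only [lintegral_const, one_mul, measure_univ, Measure.restrict_apply_univ] at h1
    simp only [hc, Measure.real]
    rw [← ENNReal.toReal_sum fun i _ => measure_ne_top _ _, ← h1, ENNReal.toReal_one]
  have hT0 : (T : ℝ) ≠ 0 := by positivity
  refine ⟨hint', fun i => (T : ℝ)⁻¹ * ∑ t ∈ Finset.range T, c t i, ⟨fun i => ?_, ?_⟩, ?_⟩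
  · exact mul_nonneg (by positivity) (Finset.sum_nonneg fun t _ => measureReal_nonneg)
  · rw [← Finset.mul_sum, Finset.sum_comm,
      Finset.sum_congr rfl fun t ht => hc1 t (Finset.mem_range.1 ht)]
    simp [hT0]
  · have hmean : ∀ t < T, ∀ j, ∫ ω, run.obs t ω j ∂P = ∑ i, meanMatrix D j i * c t i :=
      fun t ht j => by
        have h1 := integral_map (μ := P) (run.measurable_obs ht).aemeasurable
          (f := fun x : Fin d → ℝ => x j) (measurable_pi_apply j).aestronglyMeasurable
        rw [← h1, run.map_obs ht, integral_finsetSum_measure fun i _ =>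
          (integrable_eval_of_mem hD i j).smul_measure (measure_ne_top _ _)]
        refine Finset.sum_congr rfl fun i _ => ?_
        rw [integral_smul_measure, smul_eq_mul, mul_comm]
        rfl
    funext j
    rw [eval_integral fun j => hint'.eval j]
    simp only [obsAvg, Pi.smul_apply, Finset.sum_apply, smul_eq_mul]
    rw [integral_const_mul, integral_finsetSum _ fun t ht =>
      (hint t (Finset.mem_range.1 ht)).eval j,
      Finset.sum_congr rfl fun t ht => hmean t (Finset.mem_range.1 ht) j, Finset.sum_comm]
    simp only [mulVec, dotProduct, Finset.mul_sum]
    exact Finset.sum_congr rfl fun i _ => Finset.sum_congr rfl fun t _ => by ring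

/-- A dynamic policy is not better than the best static distribution on the arms. -/
theorem exists_static_ge [IsProbabilityMeasure P] [∀ i, IsProbabilityMeasure (D i)]
    (run : BanditRun T D P) (hD : ∀ i, ∀ᵐ x ∂(D i), x ∈ unitCube d) (hT : 1 ≤ T)
    {S : Set (Fin d → ℝ)} (hSc : IsClosed S) (hSconv : Convex ℝ S) {f : (Fin d → ℝ) → ℝ}
    (hf : ConcaveOn ℝ (unitCube d) f) (hfc : ContinuousOn f (unitCube d))
    (hf0 : ∀ x ∈ unitCube d, 0 ≤ f x) (hS : ∀ᵐ ω ∂P, run.obsAvg ω ∈ S) :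
    ∃ p ∈ stdSimplex ℝ (Fin m), meanMatrix D *ᵥ p ∈ S ∧
      ∫ ω, f (run.obsAvg ω) ∂P ≤ f (meanMatrix D *ᵥ p) := by
  obtain ⟨hint, p, hp, hpe⟩ := run.exists_integral_obsAvg hD hT
  have hcube : ∀ᵐ ω ∂P, run.obsAvg ω ∈ unitCube d := by
    filter_upwards [run.ae_obs_mem hD] with ω hω using unitCube_average_mem hT hω
  refine ⟨p, hp, hpe ▸ hSconv.integral_mem hSc hS hint, ?_⟩
  rw [← hpe]
  -- Jensen's inequality needs integrability; without it the integral is 0 by convention, and `f ≥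
  -- 0` suffices.
  by_cases hfi : Integrable (fun ω => f (run.obsAvg ω)) P
  · exact hf.le_map_integral hfc (isClosed_unitCube d) hcube hint hfi
  · rw [integral_undef hfi]
    exact hf0 _ ((convex_unitCube d).integral_mem (isClosed_unitCube d) hcube hint)

end BanditRun

theorem forall_objBenchmarks_sub_le {m d T : ℕ} {D : Fin m → Measure (Fin d → ℝ)}
    [∀ i, IsProbabilityMeasure (D i)] (hD : ∀ i, ∀ᵐ x ∂(D i), x ∈ unitCube d) (hT : 1 ≤ T)
    {S : Set (Fin d → ℝ)} (hSc : IsClosed S) (hSconv : Convex ℝ S)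
    (hVS : ∃ p ∈ stdSimplex ℝ (Fin m), meanMatrix D *ᵥ p ∈ S) {f : (Fin d → ℝ) → ℝ}
    (hf : ConcaveOn ℝ (unitCube d) f) (hfc : ContinuousOn f (unitCube d))
    (hf0 : ∀ x ∈ unitCube d, 0 ≤ f x) {c : ℝ} {X : EReal}
    (h : ∀ p ∈ stdSimplex ℝ (Fin m), meanMatrix D *ᵥ p ∈ S →
      ((f (meanMatrix D *ᵥ p) - c : ℝ) : EReal) ≤ X) :
    ∀ b ∈ objBenchmarks T D f S, ((b - c : ℝ) : EReal) ≤ X := by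
  rintro b (rfl | ⟨p, hp, hpS, rfl⟩)
  swap
  · exact h p hp hpS
  obtain ⟨p₀, hp₀, hpS₀⟩ := hVS
  have hp₀' := h p₀ hp₀ hpS₀
  induction X with
  | bot => exact absurd (le_bot_iff.1 hp₀') (EReal.coe_ne_bot _)
  | top => exact le_top
  | coe x =>
    simp only [EReal.coe_le_coe_iff] at h hp₀' ⊢
    have hV0 : 0 ≤ f (meanMatrix D *ᵥ p₀) := hf0 _ <|
      ⟨fun j => (BanditRun.dotProduct_mem_Icc hp₀ (BanditRun.meanMatrix_mem hD j)).1,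
        fun j => (BanditRun.dotProduct_mem_Icc hp₀ (BanditRun.meanMatrix_mem hD j)).2⟩
    rw [sub_le_iff_le_add']
    -- The bound must be nonnegative because `sSup ∅ = 0`: possibly no policy keeps its average in
    -- `S` almost surely. The static `p₀` supplies this, as `f (V p₀) ≥ 0`.
    refine Real.sSup_le ?_ (by linarith)
    rintro r ⟨Ω, _, P, _, run, hrun, rfl⟩
    obtain ⟨p, hp, hpS, hle⟩ := run.exists_static_ge hD hT hSc hSconv hf hfc hf0 hrun
    linarith [h p hp hpS]

/-! ### The conjugate, the support function and the distance -/

section Duality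

variable {d : ℕ} {f : (Fin d → ℝ) → ℝ} {S : Set (Fin d → ℝ)}

theorem bddAbove_fenchelConj (hf1 : ∀ x ∈ unitCube d, f x ≤ 1) (θ : Fin d → ℝ) :
    BddAbove ((fun y => y ⬝ᵥ θ + f y) '' unitCube d) := by
  refine ⟨∑ j, |θ j| + 1, ?_⟩
  rintro _ ⟨y, hy, rfl⟩
  refine add_le_add (Finset.sum_le_sum fun j _ => ?_) (hf1 y hy)
  have h0 : (0 : ℝ) ≤ y j := hy.1 j
  have h1 : y j ≤ (1 : ℝ) := hy.2 j
  calc y j * θ j ≤ y j * |θ j| := mul_le_mul_of_nonneg_left (le_abs_self _) h0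
    _ ≤ |θ j| := mul_le_of_le_one_left (abs_nonneg _) h1

theorem le_fenchelConj (hf1 : ∀ x ∈ unitCube d, f x ≤ 1) (θ : Fin d → ℝ) {y : Fin d → ℝ}
    (hy : y ∈ unitCube d) : y ⬝ᵥ θ + f y ≤ fenchelConj f θ :=
  le_csSup (bddAbove_fenchelConj hf1 θ) (Set.mem_image_of_mem _ hy)

theorem fenchelConj_le {θ : Fin d → ℝ} {c : ℝ} (h : ∀ y ∈ unitCube d, y ⬝ᵥ θ + f y ≤ c) :
    fenchelConj f θ ≤ c := by
  refine csSup_le ⟨_, 0, ⟨le_rfl, zero_le_one⟩, rfl⟩ ?_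
  rintro _ ⟨y, hy, rfl⟩
  exact h y hy

theorem convexOn_fenchelConj (hf1 : ∀ x ∈ unitCube d, f x ≤ 1) {B : Set (Fin d → ℝ)}
    (hB : Convex ℝ B) : ConvexOn ℝ B (fenchelConj f) := by
  refine ⟨hB, fun θ _ θ' _ a b ha hb hab => fenchelConj_le fun y hy => ?_⟩
  have h1 := mul_le_mul_of_nonneg_left (le_fenchelConj hf1 θ hy) ha
  have h2 := mul_le_mul_of_nonneg_left (le_fenchelConj hf1 θ' hy) hb
  have h3 : f y = a * f y + b * f y := by rw [← add_mul, hab, one_mul]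
  rw [dotProduct_add, dotProduct_smul, dotProduct_smul]
  simp only [smul_eq_mul] at *
  linarith

/-- Fenchel duality for a concave Lipschitz function on the cube. -/
theorem exists_fenchelConj_le {q : ℝ≥0∞} (hq : 1 ≤ q) (hf : ConcaveOn ℝ (unitCube d) f) {L : ℝ}
    (hL : 0 ≤ L) (hfL : ∀ x ∈ unitCube d, ∀ y ∈ unitCube d, f x - f y ≤ L * lqNorm q (x - y))
    {z : Fin d → ℝ} (hz : z ∈ unitCube d) :
    ∃ θ ∈ dualBall q L, fenchelConj f θ - θ ⬝ᵥ z ≤ f z := by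
  obtain ⟨g, hg, hgle⟩ := exists_mem_dualBall_le hq ⟨z, hz⟩ hf z (f z) hL fun y hy => by
    linarith [hfL y hy z hz]
  refine ⟨-g, fun y => ?_, ?_⟩
  · have := hg (-y)
    rw [lqNorm_neg hq] at this
    simpa using this
  · rw [sub_le_iff_le_add]
    refine fenchelConj_le fun y hy => ?_
    have := hgle y hy
    rw [dotProduct_comm y, neg_dotProduct, neg_dotProduct]
    rw [dotProduct_sub] at this
    linarith

theorem le_supportFn {s : Fin d → ℝ} (hs : s ∈ S) (φ : Fin d → ℝ) :
    ((φ ⬝ᵥ s : ℝ) : EReal) ≤ supportFn S φ :=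
  le_iSup₂ (f := fun s (_ : s ∈ S) => ((φ ⬝ᵥ s : ℝ) : EReal)) s hs

theorem supportFn_le {φ : Fin d → ℝ} {c : ℝ} (h : ∀ s ∈ S, φ ⬝ᵥ s ≤ c) :
    supportFn S φ ≤ (c : EReal) :=
  iSup₂_le fun s hs => EReal.coe_le_coe_iff.2 (h s hs)

theorem coe_toReal_supportFn (hS : S.Nonempty) {φ : Fin d → ℝ} (h : supportFn S φ ≠ ⊤) :
    ((supportFn S φ).toReal : EReal) = supportFn S φ := by
  obtain ⟨s, hs⟩ := hS
  exact EReal.coe_toReal h (ne_bot_of_le_ne_bot (EReal.coe_ne_bot _) (le_supportFn hs φ))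

theorem le_toReal_supportFn {s : Fin d → ℝ} (hs : s ∈ S) {φ : Fin d → ℝ}
    (h : supportFn S φ ≠ ⊤) : φ ⬝ᵥ s ≤ (supportFn S φ).toReal := by
  rw [← EReal.coe_le_coe_iff, coe_toReal_supportFn ⟨s, hs⟩ h]
  exact le_supportFn hs φ

/-- Infinite values are removed from the domain since `toReal` sends `⊤` to 0. The remaining set
need not be closed. -/
theorem convexOn_supportFn (hS : S.Nonempty) {B : Set (Fin d → ℝ)} (hB : Convex ℝ B) :
    ConvexOn ℝ {φ ∈ B | supportFn S φ ≠ ⊤} fun φ => (supportFn S φ).toReal := by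
  have key : ∀ φ φ', supportFn S φ ≠ ⊤ → supportFn S φ' ≠ ⊤ → ∀ a b : ℝ, 0 ≤ a → 0 ≤ b →
      supportFn S (a • φ + b • φ') ≤
        ((a * (supportFn S φ).toReal + b * (supportFn S φ').toReal : ℝ) : EReal) := by
    intro φ φ' h h' a b ha hb
    refine supportFn_le fun s hs => ?_
    rw [add_dotProduct, smul_dotProduct, smul_dotProduct]
    exact add_le_add (mul_le_mul_of_nonneg_left (le_toReal_supportFn hs h) ha)
      (mul_le_mul_of_nonneg_left (le_toReal_supportFn hs h') hb)
  have hfin : ∀ φ φ', supportFn S φ ≠ ⊤ → supportFn S φ' ≠ ⊤ → ∀ a b : ℝ, 0 ≤ a → 0 ≤ b →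
      supportFn S (a • φ + b • φ') ≠ ⊤ := fun φ φ' h h' a b ha hb =>
    ne_top_of_le_ne_top (EReal.coe_ne_top _) (key φ φ' h h' a b ha hb)
  refine ⟨fun φ hφ φ' hφ' a b ha hb hab =>
    ⟨hB hφ.1 hφ'.1 ha hb hab, hfin φ φ' hφ.2 hφ'.2 a b ha hb⟩, ?_⟩
  intro φ hφ φ' hφ' a b ha hb _
  rw [← EReal.coe_le_coe_iff, coe_toReal_supportFn hS (hfin φ φ' hφ.2 hφ'.2 a b ha hb)]
  exact key φ φ' hφ.2 hφ'.2 a b ha hb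

theorem lqDist_le {q : ℝ≥0∞} (hq : 1 ≤ q) {x s : Fin d → ℝ} (hs : s ∈ S) :
    lqDist q x S ≤ lqNorm q (x - s) := by
  refine csInf_le ⟨0, ?_⟩ (Set.mem_image_of_mem _ hs)
  rintro _ ⟨s, _, rfl⟩
  exact lqNorm_nonneg hq _

theorem lqDist_le_add {q : ℝ≥0∞} (hq : 1 ≤ q) (hS : S.Nonempty) (x y : Fin d → ℝ) :
    lqDist q x S ≤ lqDist q y S + lqNorm q (x - y) := by
  rw [← sub_le_iff_le_add]
  refine le_csInf (hS.image _) ?_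
  rintro _ ⟨s, hs, rfl⟩
  have h1 := lqDist_le hq (x := x) hs
  have h2 := lqNorm_add_le hq (x - y) (y - s)
  rw [sub_add_sub_cancel] at h2
  linarith

/-- Duality for the distance to a convex set. -/
theorem exists_supportFn_le {q : ℝ≥0∞} (hq : 1 ≤ q) (hS : S.Nonempty) (hSconv : Convex ℝ S)
    (z : Fin d → ℝ) :
    ∃ φ ∈ dualBall q 1, supportFn S φ ≤ ((φ ⬝ᵥ z - lqDist q z S : ℝ) : EReal) := by
  -- On `S` the constant `d(z, S)` lies below the cone `‖y - z‖`; the affine function between them,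
  -- which vanishes at `z`, separates `z` from `S`.
  obtain ⟨g, hg, hgle⟩ := exists_mem_dualBall_le hq hS (concaveOn_const (lqDist q z S) hSconv) z 0
    zero_le_one fun y hy => by
      rw [zero_add, one_mul, ← neg_sub z y, lqNorm_neg hq]
      exact lqDist_le hq hy
  refine ⟨-g, fun y => ?_, supportFn_le fun s hs => ?_⟩
  · have := hg (-y)
    rw [lqNorm_neg hq] at this
    simpa using this
  · have := hgle s hs
    rw [neg_dotProduct, neg_dotProduct]
    rw [dotProduct_sub] at this
    linarith

theorem dotProduct_le_lqNorm_two (x y : Fin d → ℝ) : x ⬝ᵥ y ≤ lqNorm 2 x * lqNorm 2 y := by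
  refine le_of_sq_le_sq ?_ (mul_nonneg (lqNorm_nonneg (by norm_num) _)
    (lqNorm_nonneg (by norm_num) _))
  rw [mul_pow, lqNorm_two_sq, lqNorm_two_sq]
  have := Finset.sum_mul_sq_le_sq_mul_sq Finset.univ x y
  simpa [dotProduct, sq] using this

theorem dotProduct_self_le_of_lqNorm_two_le {L : ℝ} {θ : Fin d → ℝ} (h : lqNorm 2 θ ≤ L) :
    θ ⬝ᵥ θ ≤ L ^ 2 := by
  rw [← lqNorm_two_sq]
  exact pow_le_pow_left₀ (lqNorm_nonneg (by norm_num) _) h 2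

theorem isGLB_smoothApprox (hf0 : ∀ x ∈ unitCube d, 0 ≤ f x) (hf1 : ∀ x ∈ unitCube d, f x ≤ 1)
    {L μ : ℝ} (hL : 0 ≤ L) (hμ : 0 ≤ μ) (z : Fin d → ℝ) :
    IsGLB ((fun θ => fenchelConj f θ + μ / (2 * L) * (θ ⬝ᵥ θ) - θ ⬝ᵥ z) ''
      {θ : Fin d → ℝ | lqNorm 2 θ ≤ L}) (smoothApprox L μ f z) := by
  refine isGLB_csInf ⟨_, 0, ?_, rfl⟩ ⟨-(L * lqNorm 2 z), ?_⟩
  · simpa [lqNorm_zero] using hL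
  · rintro _ ⟨θ, hθ, rfl⟩
    have hc : (0 : Fin d → ℝ) ∈ unitCube d := ⟨le_rfl, zero_le_one⟩
    have h1 := le_fenchelConj hf1 θ hc
    have h2 := hf0 0 hc
    have h3 := dotProduct_le_lqNorm_two θ z
    have h4 := mul_le_mul_of_nonneg_right (show lqNorm 2 θ ≤ L from hθ)
      (lqNorm_nonneg (q := 2) (by norm_num) z)
    have h5 : 0 ≤ μ / (2 * L) * (θ ⬝ᵥ θ) := mul_nonneg (by positivity) (dotProduct_self_nonneg' θ)
    rw [zero_dotProduct] at h1
    simp only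
    linarith

/-- Without the regularizer the minimum would be `f z` by duality. On the ball the regularizer lies
between 0 and `μ L / 2`, whence this bound and the next. -/
theorem le_smoothApprox (hf0 : ∀ x ∈ unitCube d, 0 ≤ f x) (hf1 : ∀ x ∈ unitCube d, f x ≤ 1)
    {L μ : ℝ} (hL : 0 ≤ L) (hμ : 0 ≤ μ) {z : Fin d → ℝ} (hz : z ∈ unitCube d) :
    f z ≤ smoothApprox L μ f z := by
  refine (isGLB_smoothApprox hf0 hf1 hL hμ z).2 ?_
  rintro _ ⟨θ, hθ, rfl⟩
  have h1 := le_fenchelConj hf1 θ hz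
  have h5 : 0 ≤ μ / (2 * L) * (θ ⬝ᵥ θ) := mul_nonneg (by positivity) (dotProduct_self_nonneg' θ)
  rw [dotProduct_comm] at h1
  simp only
  linarith

theorem smoothApprox_le (hf : ConcaveOn ℝ (unitCube d) f) (hf0 : ∀ x ∈ unitCube d, 0 ≤ f x)
    (hf1 : ∀ x ∈ unitCube d, f x ≤ 1) {L μ : ℝ} (hL : 0 < L) (hμ : 0 ≤ μ)
    (hfL : ∀ x ∈ unitCube d, ∀ y ∈ unitCube d, f x - f y ≤ L * lqNorm 2 (x - y))
    {z : Fin d → ℝ} (hz : z ∈ unitCube d) : smoothApprox L μ f z ≤ f z + μ * L / 2 := by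
  obtain ⟨θ, hθ, hle⟩ := exists_fenchelConj_le (by norm_num) hf hL.le hfL hz
  have hθ' := lqNorm_two_le_of_mem_dualBall hL.le hθ
  refine ((isGLB_smoothApprox hf0 hf1 hL.le hμ z).1 (Set.mem_image_of_mem _ hθ')).trans ?_
  have h1 := mul_le_mul_of_nonneg_left (dotProduct_self_le_of_lqNorm_two_le hθ')
    (show 0 ≤ μ / (2 * L) by positivity)
  have h2 : μ / (2 * L) * L ^ 2 = μ * L / 2 := by field_simp
  linarith

theorem supportFn_zero_le (S : Set (Fin d → ℝ)) : supportFn S 0 ≤ ((0 : ℝ) : EReal) :=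
  supportFn_le fun s _ => by simp

/-- Turns the extended-real supremum into the form of `exists_regularized_gradient` with `h = h_S`.
Terms with `h_S = ⊤` are `⊥` and drop out; `φ = 0` and a point of `S` bound the supremum from below
and above, so that `toReal` is faithful. -/
theorem isGLB_neg_smoothDist (hS : S.Nonempty) {μ : ℝ} (hμ : 0 ≤ μ) (z : Fin d → ℝ) :
    IsGLB ((fun φ => (supportFn S φ).toReal + μ / 2 * (φ ⬝ᵥ φ) - φ ⬝ᵥ z) ''
      {φ ∈ {φ : Fin d → ℝ | lqNorm 2 φ ≤ 1} | supportFn S φ ≠ ⊤}) (-smoothDist μ S z) := by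
  set X : EReal := ⨆ φ ∈ {φ : Fin d → ℝ | lqNorm 2 φ ≤ 1},
    ((φ ⬝ᵥ z - μ / 2 * (φ ⬝ᵥ φ) : ℝ) : EReal) - supportFn S φ with hX
  have hterm : ∀ φ, supportFn S φ ≠ ⊤ →
      ((φ ⬝ᵥ z - μ / 2 * (φ ⬝ᵥ φ) : ℝ) : EReal) - supportFn S φ =
        ((-((supportFn S φ).toReal + μ / 2 * (φ ⬝ᵥ φ) - φ ⬝ᵥ z) : ℝ) : EReal) := fun φ h => by
    rw [← coe_toReal_supportFn hS h, ← EReal.coe_sub, EReal.toReal_coe]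
    congr 1
    ring
  have hXle : ∀ r : ℝ, (∀ φ, lqNorm 2 φ ≤ 1 → supportFn S φ ≠ ⊤ →
      r ≤ (supportFn S φ).toReal + μ / 2 * (φ ⬝ᵥ φ) - φ ⬝ᵥ z) → X ≤ ((-r : ℝ) : EReal) := by
    refine fun r hr => iSup₂_le fun φ hφ => ?_
    by_cases h : supportFn S φ = ⊤
    · rw [h, EReal.sub_top]
      exact bot_le
    · rw [hterm φ h, EReal.coe_le_coe_iff]
      exact neg_le_neg (hr φ hφ h)
  have hleX : ∀ φ, lqNorm 2 φ ≤ 1 → supportFn S φ ≠ ⊤ →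
      ((-((supportFn S φ).toReal + μ / 2 * (φ ⬝ᵥ φ) - φ ⬝ᵥ z) : ℝ) : EReal) ≤ X := by
    intro φ hφ h
    rw [← hterm φ h]
    exact le_iSup₂ (f := fun φ (_ : φ ∈ {φ : Fin d → ℝ | lqNorm 2 φ ≤ 1}) =>
      ((φ ⬝ᵥ z - μ / 2 * (φ ⬝ᵥ φ) : ℝ) : EReal) - supportFn S φ) φ hφ
  obtain ⟨s, hs⟩ := hS
  have hbot : X ≠ ⊥ := ne_bot_of_le_ne_bot (EReal.coe_ne_bot _)
    (hleX 0 (by rw [lqNorm_zero (by norm_num)]; exact zero_le_one)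
      (ne_top_of_le_ne_top (EReal.coe_ne_top _) (supportFn_zero_le S)))
  have htop : X ≠ ⊤ := ne_top_of_le_ne_top (EReal.coe_ne_top _)
    (hXle (-lqNorm 2 (z - s)) fun φ hφ h => by
      have h1 := le_toReal_supportFn hs h
      have h2 := dotProduct_le_lqNorm_two φ (z - s)
      have h3 := mul_le_mul_of_nonneg_right hφ (lqNorm_nonneg (q := 2) (by norm_num) (z - s))
      have h4 : 0 ≤ μ / 2 * (φ ⬝ᵥ φ) := mul_nonneg (by positivity) (dotProduct_self_nonneg' φ)
      rw [dotProduct_sub] at h2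
      linarith)
  have hD : ((smoothDist μ S z : ℝ) : EReal) = X := EReal.coe_toReal htop hbot
  constructor
  · rintro _ ⟨φ, ⟨hφ, h⟩, rfl⟩
    have := hleX φ hφ h
    rw [← hD, EReal.coe_le_coe_iff] at this
    simp only
    linarith
  · intro r hr
    have := hXle r fun φ hφ h => hr (Set.mem_image_of_mem _ ⟨hφ, h⟩)
    rw [← hD, EReal.coe_le_coe_iff] at this
    linarith

theorem smoothDist_le_lqNorm {μ : ℝ} (hμ : 0 ≤ μ) {s : Fin d → ℝ} (hs : s ∈ S) (z : Fin d → ℝ) :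
    smoothDist μ S z ≤ lqNorm 2 (z - s) := by
  rw [← neg_le_neg_iff]
  refine (isGLB_neg_smoothDist ⟨s, hs⟩ hμ z).2 ?_
  rintro _ ⟨φ, ⟨hφ, h⟩, rfl⟩
  have h1 := le_toReal_supportFn hs h
  have h2 := dotProduct_le_lqNorm_two φ (z - s)
  have h3 := mul_le_mul_of_nonneg_right (show lqNorm 2 φ ≤ 1 from hφ)
    (lqNorm_nonneg (q := 2) (by norm_num) (z - s))
  have h4 : 0 ≤ μ / 2 * (φ ⬝ᵥ φ) := mul_nonneg (by positivity) (dotProduct_self_nonneg' φ)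
  rw [dotProduct_sub] at h2
  simp only
  linarith

theorem lqDist_le_smoothDist (hS : S.Nonempty) (hSconv : Convex ℝ S) {μ : ℝ} (hμ : 0 ≤ μ)
    (z : Fin d → ℝ) : lqDist 2 z S ≤ smoothDist μ S z + μ / 2 := by
  obtain ⟨φ, hφ, hle⟩ := exists_supportFn_le (by norm_num) hS hSconv z (q := 2)
  have hφ' := lqNorm_two_le_of_mem_dualBall zero_le_one hφ
  have htop : supportFn S φ ≠ ⊤ := ne_top_of_le_ne_top (EReal.coe_ne_top _) hle
  rw [← coe_toReal_supportFn hS htop, EReal.coe_le_coe_iff] at hle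
  have h1 := (isGLB_neg_smoothDist hS hμ z).1 (Set.mem_image_of_mem _ ⟨hφ', htop⟩)
  have h2 := mul_le_mul_of_nonneg_left (dotProduct_self_le_of_lqNorm_two_le hφ')
    (show 0 ≤ μ / 2 by positivity)
  linarith

end Duality

/-! ### Rates of the primal updates -/

theorem mul_sub_le_of_averaging {a : ℕ → ℝ} {b C : ℝ} (hC : 0 ≤ C) {T : ℕ} (hT : 1 ≤ T)
    (h : ∀ n : ℕ, 1 ≤ n → n < T →
      a n + ((n : ℝ) + 1)⁻¹ * (b - a n) - C / 2 * ((n : ℝ) + 1)⁻¹ ^ 2 ≤ a (n + 1)) :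
    b - a T ≤ (b - a 1) / T + C / 2 * (Real.log T / T) := by
  have hT0 : (0 : ℝ) < T := by exact_mod_cast hT
  have h1 := mul_le_add_log_of_recursion (Δ := fun n => b - a n) (show 0 ≤ C / 2 by positivity) hT
    fun n hn hnT => by
      have h2 := h n hn hnT
      have hn0 : (0 : ℝ) < n + 1 := by positivity
      have h3 := mul_le_mul_of_nonneg_left h2 hn0.le
      have h4 : ((n : ℝ) + 1) * (a n + ((n : ℝ) + 1)⁻¹ * (b - a n) -
          C / 2 * ((n : ℝ) + 1)⁻¹ ^ 2) = n * a n + b - C / 2 / (n + 1) := by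
        field_simp
        ring
      rw [h4] at h3
      linarith
  rw [← mul_div_assoc, ← add_div, le_div_iff₀ hT0]
  linarith

/-- The curvature `d / μ`, summed over the rounds, and the smoothing error `μ` are both of order
`√(d log T / T)`. At `T = 1` that root vanishes while `μ = √d`; the extra `√d / T` covers this and
is later absorbed by the `√(γ m / T)` term. -/
theorem smoothingParam_bounds {d T : ℕ} (hd : 1 ≤ d) (hT : 1 ≤ T) :
    0 < smoothingParam d T ∧
    d / smoothingParam d T / 2 * (Real.log T / T) ≤ Real.sqrt (d * Real.log T / T) / 2 ∧
    smoothingParam d T ≤ 2 * Real.sqrt (d * Real.log T / T) + Real.sqrt d / T := by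
  have hd0 : (0 : ℝ) < d := by exact_mod_cast hd
  have hT1 : (1 : ℝ) ≤ T := by exact_mod_cast hT
  have hT0 : (0 : ℝ) < T := by linarith
  have hlog : 0 ≤ Real.log T := Real.log_nonneg hT1
  have hl2 := Real.log_two_gt_d9
  have hl2' := Real.log_two_lt_d9
  have hl20 : 0 < Real.log 2 := by linarith
  have hlogb : Real.logb 2 (2 * T) = 1 + Real.log T / Real.log 2 := by
    rw [Real.logb, Real.log_mul (by norm_num) hT0.ne', add_div, div_self hl20.ne']
  set e := Real.sqrt (d * Real.log T / T) with he
  have he0 : 0 ≤ e := Real.sqrt_nonneg _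
  have he2 : e ^ 2 = d * Real.log T / T := Real.sq_sqrt (by positivity)
  set μ := smoothingParam d T with hμ
  have hdiv : 0 ≤ Real.log T / Real.log 2 := by positivity
  have hμ2 : μ ^ 2 = d / T * (1 + Real.log T / Real.log 2) := by
    rw [hμ, smoothingParam, hlogb]
    exact Real.sq_sqrt (by positivity)
  have hμ0 : 0 < μ := by
    rw [hμ, smoothingParam, hlogb]
    exact Real.sqrt_pos.2 (by positivity)
  have hle : Real.log T ≤ Real.log T / Real.log 2 := by
    rw [le_div_iff₀ hl20]
    exact mul_le_of_le_one_right hlog (by linarith)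
  have heμ : e ≤ μ := by
    refine le_of_sq_le_sq ?_ hμ0.le
    rw [he2, hμ2, mul_div_right_comm]
    exact mul_le_mul_of_nonneg_left (by linarith) (by positivity)
  refine ⟨hμ0, ?_, ?_⟩
  · have h1 : d / μ / 2 * (Real.log T / T) = e ^ 2 / (2 * μ) := by
      rw [he2]
      field_simp
    rw [h1, div_le_iff₀ (by positivity)]
    nlinarith
  · rcases hT.eq_or_lt with rfl | hT2
    · have : μ = Real.sqrt d := by
        rw [hμ, smoothingParam]
        simp
      rw [this]
      simp [he0]
    · have hT2' : (2 : ℝ) ≤ T := by exact_mod_cast hT2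
      have hlog2 : Real.log 2 ≤ Real.log T := Real.log_le_log (by norm_num) hT2'
      have h1 : μ ≤ 2 * e := by
        refine le_of_sq_le_sq ?_ (by positivity)
        rw [mul_pow, he2, hμ2]
        have h2 : 1 + Real.log T / Real.log 2 ≤ 4 * Real.log T := by
          have h3 : 1 ≤ Real.log T / Real.log 2 := (one_le_div hl20).2 hlog2
          have h4 : Real.log T / Real.log 2 ≤ 2 * Real.log T := by
            rw [div_le_iff₀ hl20]
            nlinarith
          linarith
        have := mul_le_mul_of_nonneg_left h2 (show 0 ≤ (d : ℝ) / T by positivity)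
        calc _ ≤ _ := this
          _ = _ := by ring
      have : 0 ≤ Real.sqrt d / T := by positivity
      linarith

theorem inv_le_sqrt {γ : ℝ} (hγ : 1 ≤ γ) {m T : ℕ} (hm : 1 ≤ m) (hT : 1 ≤ T) :
    (T : ℝ)⁻¹ ≤ Real.sqrt (γ * m / T) := by
  have hT1 : (1 : ℝ) ≤ T := by exact_mod_cast hT
  have hm1 : (1 : ℝ) ≤ m := by exact_mod_cast hm
  refine Real.le_sqrt_of_sq_le ?_
  rw [sq, ← div_eq_mul_inv, div_le_div_iff_of_pos_right (by linarith)]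
  exact (inv_le_one_of_one_le₀ hT1).trans (one_le_mul_of_one_le_of_one_le hγ hm1)

theorem ereal_coe_sum {ι : Type*} (s : Finset ι) (g : ι → ℝ) :
    ((∑ i ∈ s, g i : ℝ) : EReal) = ∑ i ∈ s, (g i : EReal) :=
  map_sum (⟨⟨Real.toEReal, EReal.coe_zero⟩, EReal.coe_add⟩ : ℝ →+ EReal) g s

theorem dotProduct_self_sub_le {d : ℕ} {x y : Fin d → ℝ} (hx : x ∈ unitCube d)
    (hy : y ∈ unitCube d) : (x - y) ⬝ᵥ (x - y) ≤ d := by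
  rw [← lqNorm_two_sq]
  have h1 := lqNorm_sub_le_of_mem_unitCube (q := 2) (by norm_num) hx hy
  rw [lqNorm_two_one] at h1
  calc _ ≤ Real.sqrt d ^ 2 := pow_le_pow_left₀ (lqNorm_nonneg (by norm_num) _) h1 2
    _ = d := Real.sq_sqrt (by positivity)

/-! ### Optimism on accurate outcomes -/

namespace BanditRun

variable {m d T : ℕ} {D : Fin m → Measure (Fin d → ℝ)} {Ω : Type*} [mΩ : MeasurableSpace Ω]
  {P : Measure Ω} {γ : ℝ} {run : BanditRun T D P} {ω : Ω} {θ φ : ℕ → Ω → Fin d → ℝ}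
  {S : Set (Fin d → ℝ)}

theorem mean_mulVec_mem [∀ i, IsProbabilityMeasure (D i)]
    (hD : ∀ i, ∀ᵐ x ∂(D i), x ∈ unitCube d) {p : Fin m → ℝ} (hp : p ∈ stdSimplex ℝ (Fin m)) :
    meanMatrix D *ᵥ p ∈ unitCube d :=
  ⟨fun j => (dotProduct_mem_Icc hp (meanMatrix_mem hD j)).1,
    fun j => (dotProduct_mem_Icc hp (meanMatrix_mem hD j)).2⟩

theorem estAvg_succ {n : ℕ} (hn : 1 ≤ n) :
    estAvg γ run θ (n + 1) ω = estAvg γ run θ n ω +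
      ((n : ℝ) + 1)⁻¹ • (estPoint γ run θ n ω - estAvg γ run θ n ω) := by
  have hn0 : (n : ℝ) ≠ 0 := by positivity
  have hn1 : (n : ℝ) + 1 ≠ 0 := by positivity
  funext j
  simp only [estAvg, Finset.sum_range_succ, Pi.smul_apply, Pi.add_apply, Pi.sub_apply, smul_eq_mul]
  push_cast
  field_simp
  ring

namespace Accurate

theorem estPoint_mem [∀ i, IsProbabilityMeasure (D i)]
    (hD : ∀ i, ∀ᵐ x ∂(D i), x ∈ unitCube d) (hacc : Accurate γ run ω) {t : ℕ} (ht : t < T) :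
    estPoint γ run θ t ω ∈ unitCube d := by
  have h : ∀ j, estPoint γ run θ t ω j ∈ Set.Icc (0 : ℝ) 1 := fun j =>
    dotProduct_mem_Icc (run.p_mem t ht ω) fun i => vertex_mem (meanMatrix_mem hD j i)
      (hacc.lcb_le t ht j i) (hacc.le_ucb t ht j i) _
  exact ⟨fun j => (h j).1, fun j => (h j).2⟩

theorem estAvg_mem [∀ i, IsProbabilityMeasure (D i)]
    (hD : ∀ i, ∀ᵐ x ∂(D i), x ∈ unitCube d) (hacc : Accurate γ run ω) {n : ℕ} (hn : 1 ≤ n)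
    (hnT : n ≤ T) : estAvg γ run θ n ω ∈ unitCube d :=
  unitCube_average_mem hn fun _ ht => hacc.estPoint_mem hD (ht.trans_le hnT)

theorem obsAvg_mem (hacc : Accurate γ run ω) (hT : 1 ≤ T) : run.obsAvg ω ∈ unitCube d :=
  unitCube_average_mem hT hacc.obs_mem

/-- The signs in `vertex` are chosen so that every entry of the confidence box contributes its least
possible value. -/
theorem dotProduct_vertex_le (hacc : Accurate γ run ω) {t : ℕ} (ht : t < T) (ξ : Fin d → ℝ)
    {p : Fin m → ℝ} (hp : p ∈ stdSimplex ℝ (Fin m)) :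
    ξ ⬝ᵥ (vertex γ run t ω ξ *ᵥ p) ≤ ξ ⬝ᵥ (meanMatrix D *ᵥ p) := by
  refine Finset.sum_le_sum fun j _ => ?_
  simp only [mulVec, dotProduct]
  rw [Finset.mul_sum, Finset.mul_sum]
  refine Finset.sum_le_sum fun i _ => ?_
  rw [← mul_assoc, ← mul_assoc]
  refine mul_le_mul_of_nonneg_right ?_ (hp.1 i)
  unfold vertex
  split_ifs with h
  · exact mul_le_mul_of_nonpos_left (hacc.le_ucb t ht j i) h
  · exact mul_le_mul_of_nonneg_left (hacc.lcb_le t ht j i) (not_le.1 h).le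

theorem feasible (hacc : Accurate γ run ω) {t : ℕ} (ht : t < T) (ξ : Fin d → ℝ)
    {p : Fin m → ℝ} (hp : p ∈ stdSimplex ℝ (Fin m)) (hpS : meanMatrix D *ᵥ p ∈ S) :
    Feasible γ run S t ω ξ p :=
  (EReal.coe_le_coe_iff.2 (hacc.dotProduct_vertex_le ht ξ hp)).trans (le_supportFn hpS ξ)

/-- As `p` is feasible, the minimizer `p_t` does at least as well as `p` under the optimistic
estimate, which in turn underestimates the true value of `p`. -/
theorem theta_dotProduct_le (hacc : Accurate γ run ω) (heff : run.IsEfficient γ S θ φ) {t : ℕ}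
    (ht : t < T) {p : Fin m → ℝ} (hp : p ∈ stdSimplex ℝ (Fin m)) (hpS : meanMatrix D *ᵥ p ∈ S) :
    θ t ω ⬝ᵥ estPoint γ run θ t ω ≤ θ t ω ⬝ᵥ (meanMatrix D *ᵥ p) :=
  (heff.choice t ht ω p hp (hacc.feasible ht _ hp hpS)).2.trans
    (hacc.dotProduct_vertex_le ht _ hp)

theorem phi_dotProduct_le (hacc : Accurate γ run ω) (heff : run.IsEfficient γ S θ φ)
    (hVS : ∃ p ∈ stdSimplex ℝ (Fin m), meanMatrix D *ᵥ p ∈ S) {t : ℕ} (ht : t < T) :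
    ((φ t ω ⬝ᵥ estPoint γ run φ t ω : ℝ) : EReal) ≤ supportFn S (φ t ω) := by
  obtain ⟨p, hp, hpS⟩ := hVS
  exact (heff.choice t ht ω p hp (hacc.feasible ht _ hp hpS)).1

theorem lqNorm_obsAvg_sub_le (hacc : Accurate γ run ω) (hT : 1 ≤ T) {q : ℝ≥0∞} (hq : 1 ≤ q)
    (ξ : ℕ → Ω → Fin d → ℝ) : lqNorm q (run.obsAvg ω - estAvg γ run ξ T ω) ≤
      35 * Real.sqrt (γ * m / T) * lqNorm q (1 : Fin d → ℝ) := by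
  have hT0 : (0 : ℝ) < T := by exact_mod_cast hT
  refine lqNorm_le_mul_lqNorm_one hq (by positivity) fun j => ?_
  have h1 := hacc.close ξ j
  have h2 : (run.obsAvg ω - estAvg γ run ξ T ω) j =
      (T : ℝ)⁻¹ * ∑ t ∈ Finset.range T, (run.obs t ω j - estPoint γ run ξ t ω j) := by
    simp only [obsAvg, estAvg, Pi.sub_apply, Pi.smul_apply, Finset.sum_apply, smul_eq_mul,
      Finset.sum_sub_distrib, mul_sub]
  have h3 : Real.sqrt (γ * m * T) = T * Real.sqrt (γ * m / T) := by
    have : γ * m * T = T ^ 2 * (γ * m / T) := by field_simp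
    rw [this, Real.sqrt_mul (by positivity), Real.sqrt_sq hT0.le]
  rw [h2, abs_mul, abs_of_pos (inv_pos.2 hT0), inv_mul_le_iff₀ hT0]
  rw [h3] at h1
  linarith

theorem le_add_of_lipschitz [∀ i, IsProbabilityMeasure (D i)]
    (hD : ∀ i, ∀ᵐ x ∂(D i), x ∈ unitCube d) (hacc : Accurate γ run ω) (hT : 1 ≤ T) {q : ℝ≥0∞}
    (hq : 1 ≤ q) {f : (Fin d → ℝ) → ℝ} {L : ℝ} (hL : 0 ≤ L)
    (hfL : ∀ x ∈ unitCube d, ∀ y ∈ unitCube d, f x - f y ≤ L * lqNorm q (x - y))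
    (ξ : ℕ → Ω → Fin d → ℝ) : f (estAvg γ run ξ T ω) - f (run.obsAvg ω) ≤
      35 * (L * lqNorm q (1 : Fin d → ℝ) * Real.sqrt (γ * m / T)) := by
  have h1 := hfL _ (hacc.estAvg_mem hD hT le_rfl (θ := ξ)) _ (hacc.obsAvg_mem hT)
  rw [← neg_sub (run.obsAvg ω), lqNorm_neg hq] at h1
  have h2 := mul_le_mul_of_nonneg_left (hacc.lqNorm_obsAvg_sub_le hT hq ξ) hL
  linarith

/-! ### The objective -/

section Objective

variable [∀ i, IsProbabilityMeasure (D i)] {q : ℝ≥0∞} {f : (Fin d → ℝ) → ℝ} {L : ℝ}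
  {p : Fin m → ℝ}

/-- Each loss suffered is at least `f*(θ_t) - θ_t · V p ≥ f (V p)`, while the dual point at `x̄_T`
has average loss at most `f x̄_T`; the gap is at most the average regret. -/
theorem objective_dual (hD : ∀ i, ∀ᵐ x ∂(D i), x ∈ unitCube d) (hacc : Accurate γ run ω)
    (heff : run.IsEfficient γ S θ φ) (hT : 1 ≤ T) (hq : 1 ≤ q) (hf : ConcaveOn ℝ (unitCube d) f)
    (hf1 : ∀ x ∈ unitCube d, f x ≤ 1) (hL : 0 ≤ L)
    (hfL : ∀ x ∈ unitCube d, ∀ y ∈ unitCube d, f x - f y ≤ L * lqNorm q (x - y))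
    (hp : p ∈ stdSimplex ℝ (Fin m)) (hpS : meanMatrix D *ᵥ p ∈ S) {K : ℝ} (hK : 35 ≤ K) :
    ((f (meanMatrix D *ᵥ p) - f (run.obsAvg ω) : ℝ) : EReal) ≤
      ((K * (L * lqNorm q (1 : Fin d → ℝ) * Real.sqrt (γ * m / T)) : ℝ) : EReal) +
        run.objOcoRegret γ q L f θ ω / (T : EReal) := by
  have hT0 : (0 : ℝ) < T := by exact_mod_cast hT
  set b := f (meanMatrix D *ᵥ p) with hb
  set z := estAvg γ run θ T ω with hz
  have hsum : ((T * b : ℝ) : EReal) ≤ ∑ t ∈ Finset.range T,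
      ((fenchelConj f (θ t ω) - θ t ω ⬝ᵥ estPoint γ run θ t ω : ℝ) : EReal) := by
    rw [← ereal_coe_sum, EReal.coe_le_coe_iff]
    have h1 : ∀ t ∈ Finset.range T,
        b ≤ fenchelConj f (θ t ω) - θ t ω ⬝ᵥ estPoint γ run θ t ω := fun t ht => by
      have h2 := hacc.theta_dotProduct_le heff (Finset.mem_range.1 ht) hp hpS
      have h3 := le_fenchelConj hf1 (θ t ω) (mean_mulVec_mem hD hp)
      rw [dotProduct_comm] at h3
      linarith
    simpa using Finset.sum_le_sum h1
  obtain ⟨ξ, hξ, hξz⟩ := exists_fenchelConj_le hq hf hL hfL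
    (hacc.estAvg_mem hD hT le_rfl (θ := θ))
  have hinf : (⨅ θ' ∈ dualBall q L, ∑ t ∈ Finset.range T,
      ((fenchelConj f θ' - θ' ⬝ᵥ estPoint γ run θ t ω : ℝ) : EReal)) ≤ ((T * f z : ℝ) : EReal) := by
    refine (iInf₂_le ξ hξ).trans ?_
    rw [← ereal_coe_sum, EReal.coe_le_coe_iff]
    have h1 : ∑ t ∈ Finset.range T, (fenchelConj f ξ - ξ ⬝ᵥ estPoint γ run θ t ω) =
        T * (fenchelConj f ξ - ξ ⬝ᵥ z) := by
      rw [hz, estAvg, dotProduct_smul, dotProduct_sum, Finset.sum_sub_distrib, smul_eq_mul]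
      simp only [Finset.sum_const, Finset.card_range, nsmul_eq_mul]
      field_simp
    rw [h1]
    exact mul_le_mul_of_nonneg_left hξz hT0.le
  have hreg : ((b - f z : ℝ) : EReal) ≤ run.objOcoRegret γ q L f θ ω / (T : EReal) := by
    rw [EReal.le_div_iff_mul_le (by exact_mod_cast hT0) (EReal.natCast_ne_top T)]
    have h1 : ((b - f z : ℝ) : EReal) * (T : EReal) =
        ((T * b : ℝ) : EReal) - ((T * f z : ℝ) : EReal) := by
      rw [← EReal.coe_sub, show (T : EReal) = ((T : ℝ) : EReal) from rfl, ← EReal.coe_mul]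
      congr 1
      ring
    rw [h1]
    exact EReal.sub_le_sub hsum hinf
  have hlip := hacc.le_add_of_lipschitz hD hT hq hL hfL θ
  have hpos : 0 ≤ L * lqNorm q (1 : Fin d → ℝ) * Real.sqrt (γ * m / T) :=
    mul_nonneg (mul_nonneg hL (lqNorm_nonneg hq _)) (Real.sqrt_nonneg _)
  calc ((b - f (run.obsAvg ω) : ℝ) : EReal) ≤
      ((K * (L * lqNorm q (1 : Fin d → ℝ) * Real.sqrt (γ * m / T)) + (b - f z) : ℝ) : EReal) := by
        rw [EReal.coe_le_coe_iff]
        nlinarith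
    _ ≤ _ := by
      rw [EReal.coe_add]
      exact add_le_add le_rfl hreg

/-- The first parameter is arbitrary, so nothing better than the Lipschitz bound over the cube holds
for the first gap; the division by `T` makes it harmless. -/
theorem sub_first_le (hD : ∀ i, ∀ᵐ x ∂(D i), x ∈ unitCube d) (hacc : Accurate γ run ω)
    (hT : 1 ≤ T) (hm : 1 ≤ m) (hγ : 1 ≤ γ) (hq : 1 ≤ q) (hL : 0 ≤ L)
    (hfL : ∀ x ∈ unitCube d, ∀ y ∈ unitCube d, f x - f y ≤ L * lqNorm q (x - y))
    (hp : p ∈ stdSimplex ℝ (Fin m)) :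
    (f (meanMatrix D *ᵥ p) - f (estAvg γ run θ 1 ω)) / T ≤
      L * lqNorm q (1 : Fin d → ℝ) * Real.sqrt (γ * m / T) := by
  have h1 := hfL _ (mean_mulVec_mem hD hp) _ (hacc.estAvg_mem hD le_rfl hT (θ := θ))
  have h2 := mul_le_mul_of_nonneg_left (lqNorm_sub_le_of_mem_unitCube hq (mean_mulVec_mem hD hp)
    (hacc.estAvg_mem hD le_rfl hT (θ := θ))) hL
  have h3 : 0 ≤ L * lqNorm q (1 : Fin d → ℝ) := mul_nonneg hL (lqNorm_nonneg hq _)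
  rw [div_eq_mul_inv]
  exact (mul_le_mul_of_nonneg_right (h1.trans h2) (by positivity)).trans
    (mul_le_mul_of_nonneg_left (inv_le_sqrt hγ hm hT) h3)

theorem objective_primal (hD : ∀ i, ∀ᵐ x ∂(D i), x ∈ unitCube d) (hacc : Accurate γ run ω)
    (heff : run.IsEfficient γ S θ φ) (hT : 1 ≤ T) (hm : 1 ≤ m) (hγ : 1 ≤ γ) (hq : 1 ≤ q)
    (hf : ConcaveOn ℝ (unitCube d) f) (hL : 0 ≤ L)
    (hfL : ∀ x ∈ unitCube d, ∀ y ∈ unitCube d, f x - f y ≤ L * lqNorm q (x - y))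
    (hp : p ∈ stdSimplex ℝ (Fin m)) (hpS : meanMatrix D *ᵥ p ∈ S) {C : ℝ}
    (hsm : IsCubeSmooth C f) (hup : run.PrimalUpdate γ f θ) {K : ℝ} (hK : 36 ≤ K) :
    f (meanMatrix D *ᵥ p) - f (run.obsAvg ω) ≤
      K * (L * lqNorm q (1 : Fin d → ℝ) * Real.sqrt (γ * m / T) + C * Real.log T / T) := by
  have hT0 : (0 : ℝ) < T := by exact_mod_cast hT
  set v := meanMatrix D *ᵥ p with hv
  have hvmem : v ∈ unitCube d := mean_mulVec_mem hD hp
  -- Smoothness with `y = z` and `α = 1` reads `f z - C / 2 ≤ f z`.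
  have hC : 0 ≤ C := by
    have := hsm.2 v hvmem v hvmem 1 ⟨zero_le_one, le_rfl⟩
    simp at this
    linarith
  have hrec := mul_sub_le_of_averaging (a := fun n => f (estAvg γ run θ n ω)) (b := f v) hC hT
    fun n hn hnT => by
      have hz := hacc.estAvg_mem hD hn hnT.le (θ := θ)
      have h1 := hsm.2 _ (hacc.estPoint_mem hD hnT (θ := θ)) _ hz ((n : ℝ) + 1)⁻¹
        ⟨by positivity, inv_le_one_of_one_le₀ (by linarith [(Nat.cast_nonneg n : (0 : ℝ) ≤ n)])⟩
      rw [← estAvg_succ hn] at h1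
      have h2 := hacc.theta_dotProduct_le heff hnT hp hpS
      obtain ⟨k, rfl⟩ : ∃ k, n = k + 1 := ⟨n - 1, by omega⟩
      rw [hup k hnT ω, neg_dotProduct, neg_dotProduct] at h2
      have h3 := hf.sub_le_cubeGradient_dotProduct hsm.1 hvmem hz
      rw [dotProduct_sub] at h1 h3
      -- The gap is at most `∇f(x̄) · (v - x̄)` by concavity, and optimism with `θ = -∇f(x̄)` allows
      -- `v` to be replaced by the new point.
      have h4 := mul_le_mul_of_nonneg_left (show f v - f (estAvg γ run θ (k + 1) ω) ≤
        cubeGradient f (estAvg γ run θ (k + 1) ω) ⬝ᵥ estPoint γ run θ (k + 1) ω -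
        cubeGradient f (estAvg γ run θ (k + 1) ω) ⬝ᵥ estAvg γ run θ (k + 1) ω by linarith)
        (show 0 ≤ (((k + 1 : ℕ) : ℝ) + 1)⁻¹ by positivity)
      linarith
  have h1 := hacc.sub_first_le hD hT hm hγ hq hL hfL hp (θ := θ)
  have h2 := hacc.le_add_of_lipschitz hD hT hq hL hfL θ
  have hpos : 0 ≤ L * lqNorm q (1 : Fin d → ℝ) * Real.sqrt (γ * m / T) :=
    mul_nonneg (mul_nonneg hL (lqNorm_nonneg hq _)) (Real.sqrt_nonneg _)
  have hpos' : 0 ≤ C * Real.log T / T :=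
    div_nonneg (mul_nonneg hC (Real.log_nonneg (by exact_mod_cast hT))) hT0.le
  have h3 : C / 2 * (Real.log T / T) = C * Real.log T / T / 2 := by ring
  have h4 := mul_le_mul_of_nonneg_right hK (add_nonneg hpos hpos')
  rw [h3] at hrec
  linarith

theorem objective_smooth (hD : ∀ i, ∀ᵐ x ∂(D i), x ∈ unitCube d) (hacc : Accurate γ run ω)
    (heff : run.IsEfficient γ S θ φ) (hT : 1 ≤ T) (hm : 1 ≤ m) (hd : 1 ≤ d) (hγ : 1 ≤ γ)
    (hf : ConcaveOn ℝ (unitCube d) f) (hf0 : ∀ x ∈ unitCube d, 0 ≤ f x)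
    (hf1 : ∀ x ∈ unitCube d, f x ≤ 1) (hL : 0 ≤ L)
    (hfL : ∀ x ∈ unitCube d, ∀ y ∈ unitCube d, f x - f y ≤ L * lqNorm 2 (x - y))
    (hp : p ∈ stdSimplex ℝ (Fin m)) (hpS : meanMatrix D *ᵥ p ∈ S)
    (hup : run.PrimalUpdate γ (smoothApprox L (smoothingParam d T) f) θ) {K : ℝ} (hK : 37 ≤ K) :
    f (meanMatrix D *ᵥ p) - f (run.obsAvg ω) ≤
      K * (L * lqNorm 2 (1 : Fin d → ℝ) * Real.sqrt (γ * m / T) +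
        L * Real.sqrt (d * Real.log T / T)) := by
  set v := meanMatrix D *ᵥ p with hv
  have hvmem : v ∈ unitCube d := mean_mulVec_mem hD hp
  have hpos : 0 ≤ L * lqNorm 2 (1 : Fin d → ℝ) * Real.sqrt (γ * m / T) :=
    mul_nonneg (mul_nonneg hL (lqNorm_nonneg (by norm_num) _)) (Real.sqrt_nonneg _)
  have hpos' : 0 ≤ L * Real.sqrt (d * Real.log T / T) := mul_nonneg hL (Real.sqrt_nonneg _)
  -- The regularizer `μ / (2L)` degenerates at `L = 0`, but then `f` is constant on the cube.
  rcases hL.eq_or_lt with rfl | hL0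
  · have h1 := hfL v hvmem _ (hacc.obsAvg_mem hT)
    rw [zero_mul] at h1
    exact h1.trans (mul_nonneg (by linarith) (add_nonneg hpos hpos'))
  obtain ⟨hμ0, hμ1, hμ2⟩ := smoothingParam_bounds hd hT
  set μ := smoothingParam d T with hμ
  set F := smoothApprox L μ f with hF
  have hκ : 0 < μ / (2 * L) := by positivity
  have hstep : ∀ n : ℕ, 1 ≤ n → n < T → F (estAvg γ run θ n ω) +
      ((n : ℝ) + 1)⁻¹ * (f v - F (estAvg γ run θ n ω)) -
      L * (d / μ) / 2 * ((n : ℝ) + 1)⁻¹ ^ 2 ≤ F (estAvg γ run θ (n + 1) ω) := by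
    intro n hn hnT
    have hz := hacc.estAvg_mem hD hn hnT.le (θ := θ)
    obtain ⟨g, -, hg⟩ := exists_regularized_gradient (isBounded_lqNorm_two_le L)
      ⟨0, by simpa [lqNorm_zero] using hL⟩
      (convexOn_fenchelConj hf1 (convex_lqNorm_le (by norm_num) L)) hκ
      (isGLB_smoothApprox hf0 hf1 hL hμ0.le) (estAvg γ run θ n ω)
    have hgrad := cubeGradient_eq_neg hz hg
    have h2 := hacc.theta_dotProduct_le heff hnT hp hpS
    have h1 := (hg (estAvg γ run θ (n + 1) ω)).2
    rw [estAvg_succ hn] at h1 ⊢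
    have hxz := dotProduct_self_sub_le (hacc.estPoint_mem hD hnT (θ := θ)) hz
    obtain ⟨k, rfl⟩ : ∃ k, n = k + 1 := ⟨n - 1, by omega⟩
    rw [hup k hnT ω, hgrad, neg_neg] at h2
    set z := estAvg γ run θ (k + 1) ω
    set x := estPoint γ run θ (k + 1) ω
    set α := (((k + 1 : ℕ) : ℝ) + 1)⁻¹
    have hα : 0 ≤ α := by positivity
    rw [add_sub_cancel_left, dotProduct_smul, smul_dotProduct, dotProduct_smul, smul_eq_mul,
      smul_eq_mul, smul_eq_mul, dotProduct_sub g] at h1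
    have h3 := (hg v).1
    rw [dotProduct_sub] at h3
    have h4 := le_smoothApprox hf0 hf1 hL hμ0.le hvmem
    have h5 := mul_le_mul_of_nonneg_left (show f v - F z ≤ -(g ⬝ᵥ x - g ⬝ᵥ z) by linarith) hα
    -- Two points of the cube are at squared Euclidean distance at most `d`, so the effective
    -- smoothness constant is `L d / μ`.
    have h6 : α * (α * ((x - z) ⬝ᵥ (x - z))) / (4 * (μ / (2 * L))) ≤
        L * (d / μ) / 2 * α ^ 2 := by
      calc _ ≤ α * (α * d) / (4 * (μ / (2 * L))) := by gcongr
        _ = _ := by field_simp; ring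
    linarith
  have hrec := mul_sub_le_of_averaging (a := fun n => F (estAvg γ run θ n ω)) (b := f v)
    (show 0 ≤ L * (d / μ) by positivity) hT hstep
  have hz1 := hacc.estAvg_mem hD le_rfl hT (θ := θ)
  have h0 : (f v - F (estAvg γ run θ 1 ω)) / T ≤ (f v - f (estAvg γ run θ 1 ω)) / T :=
    div_le_div_of_nonneg_right (by linarith [le_smoothApprox hf0 hf1 hL hμ0.le hz1])
      (Nat.cast_nonneg T)
  have h1 := hacc.sub_first_le hD hT hm hγ (q := 2) (by norm_num) hL hfL hp (θ := θ)
  have h2 := hacc.le_add_of_lipschitz hD hT (q := 2) (by norm_num) hL hfL θ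
  have h3 := smoothApprox_le hf hf0 hf1 hL0 hμ0.le hfL (hacc.estAvg_mem hD hT le_rfl (θ := θ))
  have h4 := mul_le_mul_of_nonneg_left hμ1 hL
  have h5 := mul_le_mul_of_nonneg_left hμ2 hL
  have h6 : L * (Real.sqrt d / T) ≤ L * lqNorm 2 (1 : Fin d → ℝ) * Real.sqrt (γ * m / T) := by
    rw [lqNorm_two_one, mul_assoc, div_eq_mul_inv]
    exact mul_le_mul_of_nonneg_left (mul_le_mul_of_nonneg_left (inv_le_sqrt hγ hm hT)
      (Real.sqrt_nonneg _)) hL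
  have h7 := mul_le_mul_of_nonneg_right hK (add_nonneg hpos hpos')
  linarith

end Objective

/-! ### The constraint -/

/-- Feasibility makes each loss suffered nonnegative, whereas the functional separating `z̄_T` from
`S` has average loss at most `-d(z̄_T, S)`. -/
theorem constraint_dual {q : ℝ≥0∞} (hacc : Accurate γ run ω)
    (heff : run.IsEfficient γ S θ φ) (hT : 1 ≤ T) (hq : 1 ≤ q) (hSconv : Convex ℝ S)
    (hVS : ∃ p ∈ stdSimplex ℝ (Fin m), meanMatrix D *ᵥ p ∈ S) {K : ℝ} (hK : 35 ≤ K) :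
    ((lqDist q (run.obsAvg ω) S : ℝ) : EReal) ≤
      ((K * (lqNorm q (1 : Fin d → ℝ) * Real.sqrt (γ * m / T)) : ℝ) : EReal) +
        run.conOcoRegret γ q S φ ω / (T : EReal) := by
  have hT0 : (0 : ℝ) < T := by exact_mod_cast hT
  have hS : S.Nonempty := by
    obtain ⟨p, -, hpS⟩ := hVS
    exact ⟨_, hpS⟩
  set z := estAvg γ run φ T ω with hz
  have hsum : (0 : EReal) ≤ ∑ t ∈ Finset.range T,
      (supportFn S (φ t ω) - ((φ t ω ⬝ᵥ estPoint γ run φ t ω : ℝ) : EReal)) :=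
    Finset.sum_nonneg fun t ht =>
      (EReal.sub_nonneg (Or.inr (EReal.coe_ne_top _)) (Or.inr (EReal.coe_ne_bot _))).2
        (hacc.phi_dotProduct_le heff hVS (Finset.mem_range.1 ht))
  obtain ⟨ξ, hξ, hξz⟩ := exists_supportFn_le hq hS hSconv z
  have hinf : (⨅ φ' ∈ dualBall q 1, ∑ t ∈ Finset.range T,
      (supportFn S φ' - ((φ' ⬝ᵥ estPoint γ run φ t ω : ℝ) : EReal))) ≤
      ((-(T * lqDist q z S) : ℝ) : EReal) := by
    refine (iInf₂_le ξ hξ).trans ?_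
    refine (Finset.sum_le_sum fun t _ => EReal.sub_le_sub hξz le_rfl).trans ?_
    simp only [← EReal.coe_sub]
    rw [← ereal_coe_sum, EReal.coe_le_coe_iff]
    refine le_of_eq ?_
    rw [Finset.sum_sub_distrib, hz, estAvg, ← dotProduct_sum, dotProduct_smul, smul_eq_mul]
    simp only [Finset.sum_const, Finset.card_range, nsmul_eq_mul]
    field_simp
    ring
  have hreg : ((lqDist q z S : ℝ) : EReal) ≤ run.conOcoRegret γ q S φ ω / (T : EReal) := by
    rw [EReal.le_div_iff_mul_le (by exact_mod_cast hT0) (EReal.natCast_ne_top T)]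
    have h1 : ((lqDist q z S : ℝ) : EReal) * (T : EReal) =
        0 - ((-(T * lqDist q z S) : ℝ) : EReal) := by
      rw [← EReal.coe_zero, ← EReal.coe_sub, show (T : EReal) = ((T : ℝ) : EReal) from rfl,
        ← EReal.coe_mul]
      congr 1
      ring
    rw [h1]
    exact EReal.sub_le_sub hsum hinf
  have h1 := lqDist_le_add hq hS (run.obsAvg ω) z
  have h2 := hacc.lqNorm_obsAvg_sub_le hT hq φ
  have hpos : 0 ≤ lqNorm q (1 : Fin d → ℝ) * Real.sqrt (γ * m / T) :=
    mul_nonneg (lqNorm_nonneg hq _) (Real.sqrt_nonneg _)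
  calc ((lqDist q (run.obsAvg ω) S : ℝ) : EReal) ≤
      ((K * (lqNorm q (1 : Fin d → ℝ) * Real.sqrt (γ * m / T)) + lqDist q z S : ℝ) : EReal) := by
        rw [EReal.coe_le_coe_iff]
        linarith [mul_le_mul_of_nonneg_right hK hpos]
    _ ≤ _ := by
      rw [EReal.coe_add]
      exact add_le_add le_rfl hreg

theorem constraint_primal [∀ i, IsProbabilityMeasure (D i)]
    (hD : ∀ i, ∀ᵐ x ∂(D i), x ∈ unitCube d) (hacc : Accurate γ run ω)
    (heff : run.IsEfficient γ S θ φ) (hT : 1 ≤ T) (hm : 1 ≤ m) (hd : 1 ≤ d) (hγ : 1 ≤ γ)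
    (hSconv : Convex ℝ S) (hVS : ∃ p ∈ stdSimplex ℝ (Fin m), meanMatrix D *ᵥ p ∈ S)
    (hup : run.PrimalUpdate γ (fun z => -smoothDist (smoothingParam d T) S z) φ) {K : ℝ}
    (hK : 37 ≤ K) :
    lqDist 2 (run.obsAvg ω) S ≤ K * (lqNorm 2 (1 : Fin d → ℝ) * Real.sqrt (γ * m / T) +
      Real.sqrt (d * Real.log T / T)) := by
  obtain ⟨p, hp, hpS⟩ := id hVS
  have hS : S.Nonempty := ⟨_, hpS⟩
  obtain ⟨hμ0, hμ1, hμ2⟩ := smoothingParam_bounds hd hT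
  set μ := smoothingParam d T with hμ
  set F : (Fin d → ℝ) → ℝ := fun z => -smoothDist μ S z with hF
  have hstep : ∀ n : ℕ, 1 ≤ n → n < T → F (estAvg γ run φ n ω) +
      ((n : ℝ) + 1)⁻¹ * (0 - F (estAvg γ run φ n ω)) -
      d / μ / 2 * ((n : ℝ) + 1)⁻¹ ^ 2 ≤ F (estAvg γ run φ (n + 1) ω) := by
    intro n hn hnT
    have hz := hacc.estAvg_mem hD hn hnT.le (θ := φ)
    obtain ⟨g, ⟨u, huB, hug, hhu⟩, hg⟩ := exists_regularized_gradient
      ((isBounded_lqNorm_two_le 1).subset (Set.sep_subset _ _))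
      ⟨0, by
        rw [Set.mem_ofPred_eq, lqNorm_zero (by norm_num)]
        exact zero_le_one, ne_top_of_le_ne_top (EReal.coe_ne_top _) (supportFn_zero_le S)⟩
      (convexOn_supportFn hS (convex_lqNorm_le (by norm_num) 1)) (half_pos hμ0)
      (isGLB_neg_smoothDist hS hμ0.le) (estAvg γ run φ n ω)
    have hgrad := cubeGradient_eq_neg hz hg
    have h2 := hacc.phi_dotProduct_le heff hVS hnT
    have h1 := (hg (estAvg γ run φ (n + 1) ω)).2
    rw [estAvg_succ hn] at h1 ⊢
    have hxz := dotProduct_self_sub_le (hacc.estPoint_mem hD hnT (θ := φ)) hz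
    obtain ⟨k, rfl⟩ : ∃ k, n = k + 1 := ⟨n - 1, by omega⟩
    rw [hup k hnT ω, hgrad, neg_neg] at h2
    set z := estAvg γ run φ (k + 1) ω
    set x := estPoint γ run φ (k + 1) ω
    set α := (((k + 1 : ℕ) : ℝ) + 1)⁻¹
    have hα : 0 ≤ α := by positivity
    -- Lower semicontinuity of `h_S`: for each `s` the inequality `u_n · s ≤ h_S(u_n)` passes to the
    -- limit, although `g` itself need not belong to the set of minimization.
    have h3 : supportFn S g ≤ ((F z - μ / 2 * (g ⬝ᵥ g) + g ⬝ᵥ z : ℝ) : EReal) :=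
      supportFn_le fun s hs => le_of_tendsto_of_tendsto'
        (tendsto_dotProduct hug tendsto_const_nhds) hhu
        fun n => le_toReal_supportFn hs (huB n).2
    have h4 := EReal.coe_le_coe_iff.1 (h2.trans h3)
    have h5 : 0 ≤ μ / 2 * (g ⬝ᵥ g) := mul_nonneg (by positivity) (dotProduct_self_nonneg' g)
    rw [add_sub_cancel_left, dotProduct_smul, smul_dotProduct, dotProduct_smul, smul_eq_mul,
      smul_eq_mul, smul_eq_mul, dotProduct_sub g] at h1
    have h6 := mul_le_mul_of_nonneg_left (show 0 - F z ≤ -(g ⬝ᵥ x - g ⬝ᵥ z) by linarith) hα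
    have h7 : α * (α * ((x - z) ⬝ᵥ (x - z))) / (4 * (μ / 2)) ≤ d / μ / 2 * α ^ 2 := by
      calc _ ≤ α * (α * d) / (4 * (μ / 2)) := by gcongr
        _ = _ := by field_simp; ring
    simp only [hF] at *
    linarith
  have hrec := mul_sub_le_of_averaging (a := fun n => F (estAvg γ run φ n ω)) (b := 0)
    (show 0 ≤ d / μ by positivity) hT hstep
  have hz1 := hacc.estAvg_mem hD le_rfl hT (θ := φ)
  have hfirst : (0 - F (estAvg γ run φ 1 ω)) / T ≤
      lqNorm 2 (1 : Fin d → ℝ) * Real.sqrt (γ * m / T) := by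
    have h1 := smoothDist_le_lqNorm hμ0.le hpS (estAvg γ run φ 1 ω)
    have h2 := lqNorm_sub_le_of_mem_unitCube (q := 2) (by norm_num) hz1 (mean_mulVec_mem hD hp)
    have h3 : 0 - F (estAvg γ run φ 1 ω) ≤ lqNorm 2 (1 : Fin d → ℝ) := by
      simp only [hF]
      linarith
    rw [div_eq_mul_inv]
    exact (mul_le_mul_of_nonneg_right h3 (by positivity)).trans
      (mul_le_mul_of_nonneg_left (inv_le_sqrt hγ hm hT) (lqNorm_nonneg (by norm_num) _))
  have h2 := lqDist_le_add (q := 2) (by norm_num) hS (run.obsAvg ω) (estAvg γ run φ T ω)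
  have h3 := hacc.lqNorm_obsAvg_sub_le hT (q := 2) (by norm_num) φ
  have h4 := lqDist_le_smoothDist hS hSconv hμ0.le (estAvg γ run φ T ω)
  have h6 : Real.sqrt d / T ≤ lqNorm 2 (1 : Fin d → ℝ) * Real.sqrt (γ * m / T) := by
    rw [lqNorm_two_one, div_eq_mul_inv]
    exact mul_le_mul_of_nonneg_left (inv_le_sqrt hγ hm hT) (Real.sqrt_nonneg _)
  have hpos : 0 ≤ lqNorm 2 (1 : Fin d → ℝ) * Real.sqrt (γ * m / T) :=
    mul_nonneg (lqNorm_nonneg (by norm_num) _) (Real.sqrt_nonneg _)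
  have h7 := mul_le_mul_of_nonneg_right hK (add_nonneg hpos
    (Real.sqrt_nonneg (d * Real.log T / T)))
  have h8 := Real.sqrt_nonneg (d * Real.log T / T)
  simp only [hF] at hrec hfirst
  linarith

end Accurate

end BanditRun

end

/-! ### The regret bounds -/

theorem mainTheorem6 :
    ∃ c₀ : ℝ, 0 < c₀ ∧ ∃ K : ℝ, 0 < K ∧
    ∀ (m d T : ℕ), 1 ≤ m → 1 ≤ d → 1 ≤ T →
    -- the norm in the Lipschitz condition, and the norm that measures the distance from `S`
    ∀ (qf qS : ℝ≥0∞), 1 ≤ qf → 1 ≤ qS →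
    ∀ (D : Fin m → Measure (Fin d → ℝ)), (∀ i, IsProbabilityMeasure (D i)) →
      (∀ i, ∀ᵐ x ∂(D i), x ∈ unitCube d) →
    ∀ (S : Set (Fin d → ℝ)), IsClosed S → Convex ℝ S →
      (∃ p ∈ stdSimplex ℝ (Fin m), meanMatrix D *ᵥ p ∈ S) →
    ∀ (f : (Fin d → ℝ) → ℝ) (L : ℝ), ConcaveOn ℝ (unitCube d) f →
      (∀ x ∈ unitCube d, f x ∈ Set.Icc (0 : ℝ) 1) → 0 ≤ L →
      (∀ x ∈ unitCube d, ∀ y ∈ unitCube d, f x - f y ≤ L * lqNorm qf (x - y)) →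
    ∀ (δ γ : ℝ), 0 < δ → δ < 1 → 2 * δ ≤ m * T * d →
      c₀ * Real.log (m * T * d / δ) ≤ γ →
    ∀ (Ω : Type*) [MeasurableSpace Ω] (P : Measure Ω) [IsProbabilityMeasure P]
      (run : BanditRun T D P) (θ φ : ℕ → Ω → Fin d → ℝ), run.IsEfficient γ S θ φ →
    ∀ C : ℝ,
      P {ω | ¬ (
        -- objective, dual update
        (BanditRun.DualUpdate T qf L θ → ∀ b ∈ objBenchmarks T D f S,
          ((b - f (run.obsAvg ω) : ℝ) : EReal) ≤
            ((K * (L * lqNorm qf (1 : Fin d → ℝ) * Real.sqrt (γ * m / T)) : ℝ) : EReal) +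
              run.objOcoRegret γ qf L f θ ω / (T : EReal)) ∧
        -- objective, primal update, for `C`-smooth `f`
        (IsCubeSmooth C f → run.PrimalUpdate γ f θ → ∀ b ∈ objBenchmarks T D f S,
          b - f (run.obsAvg ω) ≤
            K * (L * lqNorm qf (1 : Fin d → ℝ) * Real.sqrt (γ * m / T) +
              C * Real.log T / T)) ∧
        -- objective, primal update with smooth approximation, Euclidean norm
        (qf = 2 → run.PrimalUpdate γ (smoothApprox L (smoothingParam d T) f) θ →
          ∀ b ∈ objBenchmarks T D f S,
          b - f (run.obsAvg ω) ≤
            K * (L * lqNorm qf (1 : Fin d → ℝ) * Real.sqrt (γ * m / T) +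
              L * Real.sqrt (d * Real.log T / T))) ∧
        -- constraint, dual update
        (BanditRun.DualUpdate T qS 1 φ →
          ((lqDist qS (run.obsAvg ω) S : ℝ) : EReal) ≤
            ((K * (lqNorm qS (1 : Fin d → ℝ) * Real.sqrt (γ * m / T)) : ℝ) : EReal) +
              run.conOcoRegret γ qS S φ ω / (T : EReal)) ∧
        -- constraint, primal update with smooth approximation, Euclidean norm
        (qS = 2 → run.PrimalUpdate γ (fun z => -smoothDist (smoothingParam d T) S z) φ →
          lqDist qS (run.obsAvg ω) S ≤
            K * (lqNorm qS (1 : Fin d → ℝ) * Real.sqrt (γ * m / T) +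
              Real.sqrt (d * Real.log T / T))))} ≤ ENNReal.ofReal δ := by
  -- The union bound requires 96; the bounds on accurate outcomes hold with 35, 36 or 37 in place of
  -- 40.
  refine ⟨96, by norm_num, 40, by norm_num, ?_⟩
  intro m d T hm hd hT qf qS hqf hqS D hDp hD S hSc hSconv hVS f L hf hf01 hL hfL δ γ hδ hδ1 hδ2
    hγ Ω _ P _ run θ φ heff C
  have hγ1 : 1 ≤ γ := by linarith [BanditRun.four_le_of_log_le hδ hδ2 hγ]
  have hf0 : ∀ x ∈ unitCube d, 0 ≤ f x := fun x hx => (hf01 x hx).1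
  have hf1 : ∀ x ∈ unitCube d, f x ≤ 1 := fun x hx => (hf01 x hx).2
  -- Monotonicity of the outer measure suffices, so the set of bad outcomes need not be measurable.
  refine le_trans (measure_mono fun ω hω => ?_)
    (run.measure_not_accurate_le hD hm hd hT hδ hδ1 hδ2 hγ)
  refine fun hacc : BanditRun.Accurate γ run ω => hω ?_
  have bench := fun X => forall_objBenchmarks_sub_le hD hT hSc hSconv hVS hf
    (continuousOn_of_lipschitz hqf hfL) hf0 (c := f (run.obsAvg ω)) (X := X)
  refine ⟨fun _ => ?_, fun hsm hup b hb => ?_, ?_, fun _ => ?_, ?_⟩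
  · exact bench _ fun p hp hpS => hacc.objective_dual hD heff hT hqf hf hf1 hL hfL hp hpS
      (by norm_num)
  · exact EReal.coe_le_coe_iff.1 (bench _ (fun p hp hpS => EReal.coe_le_coe_iff.2
      (hacc.objective_primal hD heff hT hm hγ1 hqf hf hL hfL hp hpS hsm hup (by norm_num))) b hb)
  · rintro rfl hup b hb
    exact EReal.coe_le_coe_iff.1 (bench _ (fun p hp hpS => EReal.coe_le_coe_iff.2
      (hacc.objective_smooth hD heff hT hm hd hγ1 hf hf0 hf1 hL hfL hp hpS hup (by norm_num))) b hb)
  · exact hacc.constraint_dual heff hT hqS hSconv hVS (by norm_num)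
  · rintro rfl hup
    exact hacc.constraint_primal hD heff hT hm hd hγ1 hSconv hVS hup (by norm_num)
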